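/- Let $K$ be an algebraically closed field of characteristic $0$, $S=K[Y_1,Y_2,Y_3,Y_4]$, $f_4=Y_1^3+Y_2^3+Y_3^3+Y_4^3$ and $R_4=S/(f_4)$ with its standard grading. A *matrix factorization* of $f_4$ is a pair $(\varphi,\psi)$ of square matrices over $S$ with $\varphi\psi=\psi\varphi=f_4 I$; it is a matrix factorization of a graded $R_4$-module $M$ if moreover $\operatorname{Coker}\varphi\cong M$ as graded modules, up to a shift of the grading. Write $\operatorname{adj}\varphi$ for the adjugate matrix. For $1\le i\le 4$ let $\mathcal L_i$ be the set of the linear forms $Y_i-aY_j$ with $j>i$, $a\in K$, $a^3=-1$. **(1)** Let $M$ be a graded maximal Cohen–Macaulay $R_4$-module of rank one whose minimal number of generators is three. Then there are $i,j\ge 2$, $K$-linearly independent linear forms $\alpha,\gamma\in\mathcal L_1$, $\beta\in\mathcal L_j$, $\delta\in\mathcal L_i$, and linear forms $m,n,w,t$ such that, with $$\varphi=\begin{pmatrix}0&\alpha&\beta\\ \gamma&m&n\\ \delta&w&t\end{pmatrix},$$ $(\varphi,\operatorname{adj}\varphi)$ is a matrix factorization of $M$. Moreover $\varphi$ can be chosen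 to be one of the nine matrices $A,A^t,B,B^t,C,C^t,D,E,F$ below, where $a,b,c,d\in K$ satisfy $a^3=b^3=c^3=d^3=-1$, where $\varepsilon\in K$, $\varepsilon^3=1$, $\varepsilon\ne1$, and where the parameters satisfy the condition stated with the matrix. $$A=\begin{pmatrix}0&Y_1-aY_4&Y_2-bY_3\\ Y_1-cY_2&-b^2Y_3-abc^2\varepsilon^2Y_4&b^2c^2Y_3-abc\varepsilon^2Y_4\\ Y_3-dY_4&c^2Y_2+bc^2Y_3+acY_4&-Y_1-cY_2-aY_4\end{pmatrix},\quad bcd=\varepsilon a;$$ $$B=\begin{pmatrix}0&Y_1-aY_3&Y_2-bY_4\\ Y_1-cY_2&a^2cY_3+(abc^2+a^2cd)Y_4&a^2Y_3-a^2d\varepsilon Y_4\\ Y_3-dY_4&c^2Y_2+acY_3+bc^2Y_4&-Y_1-cY_2-aY_3\end{pmatrix},\quad ad=\varepsilon bc;$$ $$C=\begin{pmatrix}0&Y_1-aY_4&Y_2-bY_3\\ Y_1-cY_3&-Y_2-bY_3-dY_4&-b^2c^2Y_3+bc^2d\varepsilon^2Y_4\\ Y_2-dY_4&b^2c^2Y_3-bc^2d\varepsilon^2Y_4&-Y_1-cY_3-aY_4\end{pmatrix},\quad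 ab=\varepsilon cd;$$ $$D=\begin{pmatrix}0&Y_1-aY_2&Y_3-bY_4\\ Y_1-cY_2&-Y_3-(b+d)Y_4&0\\ Y_3-dY_4&0&-Y_1-(a+c)Y_2\end{pmatrix},\quad a\ne c,\ b\ne d;$$ $$E=\begin{pmatrix}0&Y_1-aY_3&Y_2-bY_4\\ Y_1-cY_3&-Y_2-(b+d)Y_4&0\\ Y_2-dY_4&0&-Y_1-(a+c)Y_3\end{pmatrix},\quad a\ne c,\ b\ne d;$$ $$F=\begin{pmatrix}0&Y_1-aY_4&Y_2-bY_3\\ Y_1-cY_4&-Y_2-(b+d)Y_3&0\\ Y_2-dY_3&0&-Y_1-(a+c)Y_4\end{pmatrix},\quad a\ne c,\ b\ne d.$$ **(2)** Let $a^3=b^3=c^3=d^3=-1$. The four forms in the first row and the first column other than the corner entry are linearly independent if and only if: $bcd\ne a$ in the cases $A,A^t$; $ad\ne bc$ in the cases $B,B^t$; $ab\ne cd$ in the cases $C,C^t$; $a\ne c$ and $b\ne d$ in the cases $D,E,F$. Moreover $bcd\neq a$, $ad\ne bc$, $ab\ne cd$ hold if and only if $bcd=\varepsilon a$, $ad=\varepsilon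 bc$, $ab=\varepsilon cd$, respectively, for some $\varepsilon\in K$ with $\varepsilon^3=1$, $\varepsilon\ne1$. **(3)** Each of the nine matrices $X$, with parameters satisfying its condition, forms together with its adjugate a matrix factorization $(X,\operatorname{adj}X)$ of $f_4$. -/

import Mathlib

noncomputable section

namespace FermatCubic

open MvPolynomial

/-- The polynomial ring `K[Y₁, Y₂, Y₃, Y₄]`; the variable `Y_k` is `X (k - 1)`. -/
abbrev S (K : Type*) [Field K] : Type _ := MvPolynomial (Fin 4) K

/-- `f₄ = Y₁³ + Y₂³ + Y₃³ + Y₄³`. -/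
def f (K : Type*) [Field K] : S K := X 0 ^ 3 + X 1 ^ 3 + X 2 ^ 3 + X 3 ^ 3

/-- The hypersurface ring `R₄ = K[Y₁, Y₂, Y₃, Y₄] / (f₄)`. -/
abbrev R (K : Type*) [Field K] : Type _ := S K ⧸ Ideal.span {f K}

/-- The degree `k` part of the standard grading of `R₄` (zero for negative `k`). -/
def piece (K : Type*) [Field K] (k : ℤ) : Submodule K (R K) :=
  if 0 ≤ k then
    (homogeneousSubmodule (Fin 4) K k.toNat).map
      (Ideal.Quotient.mkₐ K (Ideal.span {f K})).toLinearMap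
  else ⊥

/-- The graded maximal ideal `(Y₁, Y₂, Y₃, Y₄)` of `R₄`. -/
def irrelevant (K : Type*) [Field K] : Ideal (R K) :=
  Ideal.span (Set.range fun i : Fin 4 => Ideal.Quotient.mk (Ideal.span {f K}) (X i))

/-- `ℳ` is a `ℤ`-grading of the `R₄`-module `M`. -/
structure IsGrading {K : Type*} [Field K] {M : Type*} [AddCommGroup M] [Module (R K) M]
    (ℳ : ℤ → AddSubgroup M) : Prop where
  isInternal : DirectSum.IsInternal ℳ
  smul_mem : ∀ (i j : ℤ) (r : R K) (x : M), r ∈ piece K i → x ∈ ℳ j → r • x ∈ ℳ (i + j)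

/-- Maximal Cohen-Macaulay, for graded modules: finitely generated, and there is an `M`-regular
sequence in the graded maximal ideal whose length is the Krull dimension of `R₄`.
(`IsRegular` includes that `M` is not zero.) -/
def IsMCM (K : Type*) [Field K] (M : Type*) [AddCommGroup M] [Module (R K) M] : Prop :=
  Module.Finite (R K) M ∧
    ∃ rs : List (R K), (∀ r ∈ rs, r ∈ irrelevant K) ∧
      RingTheory.Sequence.IsRegular M rs ∧ ((rs.length : ℕ) : WithBot ℕ∞) = ringKrullDim (R K)

/-- `M` is minimally generated by three elements. -/
def ThreeGenerated (K : Type*) [Field K] (M : Type*) [AddCommGroup M] [Module (R K) M] : Prop :=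
  Submodule.spanFinrank (⊤ : Submodule (R K) M) = 3

/-- `(φ, ψ)` is a matrix factorization of `f₄`. -/
def IsMatrixFactorization {K : Type*} [Field K] (φ ψ : Matrix (Fin 3) (Fin 3) (S K)) : Prop :=
  φ * ψ = f K • (1 : Matrix (Fin 3) (Fin 3) (S K)) ∧
    ψ * φ = f K • (1 : Matrix (Fin 3) (Fin 3) (S K))

/-- The image of `φ` modulo `f₄`, a submodule of `R₄³`. -/
def image {K : Type*} [Field K] (φ : Matrix (Fin 3) (Fin 3) (S K)) :
    Submodule (R K) (Fin 3 → R K) :=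
  LinearMap.range (Matrix.mulVecLin (φ.map (Ideal.Quotient.mk (Ideal.span {f K}))))

/-- `Coker φ`, as an `R₄`-module. -/
abbrev Coker {K : Type*} [Field K] (φ : Matrix (Fin 3) (Fin 3) (S K)) : Type _ :=
  (Fin 3 → R K) ⧸ image φ

/-- The degree `k` part of `Coker φ`, the three standard generators having degree `0`. -/
def cokerPiece {K : Type*} [Field K] (φ : Matrix (Fin 3) (Fin 3) (S K)) (k : ℤ) :
    Set (Coker φ) :=
  {x | ∃ v : Fin 3 → R K, (∀ i, v i ∈ piece K k) ∧ (image φ).mkQ v = x}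

/-- `(φ, ψ)` is a matrix factorization of the graded module `M`: it is a matrix factorization of
`f₄`, and `Coker φ` is isomorphic to `M` as a graded module, up to a shift of the degrees. -/
def IsMatrixFactorizationOf {K : Type*} [Field K] {M : Type*} [AddCommGroup M] [Module (R K) M]
    (ℳ : ℤ → AddSubgroup M) (φ ψ : Matrix (Fin 3) (Fin 3) (S K)) : Prop :=
  IsMatrixFactorization φ ψ ∧
    ∃ (e : Coker φ ≃ₗ[R K] M) (s : ℤ), ∀ (k : ℤ) (x : Coker φ),
      x ∈ cokerPiece φ k ↔ e x ∈ ℳ (k + s)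

/-- The set `ℒ_i` of the linear forms `Y_i - a Y_j` with `j > i` and `a³ = -1`
(with `i`, `j` counted from `0`). -/
def 𝓛 (K : Type*) [Field K] (i : Fin 4) : Set (S K) :=
  {p | ∃ (j : Fin 4) (a : K), i < j ∧ a ^ 3 = -1 ∧ p = X i - C a * X j}

section Matrices

variable {K : Type*} [Field K]

/-- `Y₁`, `Y₂`, `Y₃`, `Y₄`. -/
local notation "Y₁" => (X 0 : MvPolynomial (Fin 4) _)
local notation "Y₂" => (X 1 : MvPolynomial (Fin 4) _)
local notation "Y₃" => (X 2 : MvPolynomial (Fin 4) _)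
local notation "Y₄" => (X 3 : MvPolynomial (Fin 4) _)

def matA (a b c d ε : K) : Matrix (Fin 3) (Fin 3) (S K) :=
  !![0, Y₁ - C a * Y₄, Y₂ - C b * Y₃;
     Y₁ - C c * Y₂, -C (b ^ 2) * Y₃ - C (a * b * c ^ 2 * ε ^ 2) * Y₄,
       C (b ^ 2 * c ^ 2) * Y₃ - C (a * b * c * ε ^ 2) * Y₄;
     Y₃ - C d * Y₄, C (c ^ 2) * Y₂ + C (b * c ^ 2) * Y₃ + C (a * c) * Y₄,
       -Y₁ - C c * Y₂ - C a * Y₄]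

def matB (a b c d ε : K) : Matrix (Fin 3) (Fin 3) (S K) :=
  !![0, Y₁ - C a * Y₃, Y₂ - C b * Y₄;
     Y₁ - C c * Y₂, C (a ^ 2 * c) * Y₃ + C (a * b * c ^ 2 + a ^ 2 * c * d) * Y₄,
       C (a ^ 2) * Y₃ - C (a ^ 2 * d * ε) * Y₄;
     Y₃ - C d * Y₄, C (c ^ 2) * Y₂ + C (a * c) * Y₃ + C (b * c ^ 2) * Y₄,
       -Y₁ - C c * Y₂ - C a * Y₃]

def matC (a b c d ε : K) : Matrix (Fin 3) (Fin 3) (S K) :=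
  !![0, Y₁ - C a * Y₄, Y₂ - C b * Y₃;
     Y₁ - C c * Y₃, -Y₂ - C b * Y₃ - C d * Y₄,
       -C (b ^ 2 * c ^ 2) * Y₃ + C (b * c ^ 2 * d * ε ^ 2) * Y₄;
     Y₂ - C d * Y₄, C (b ^ 2 * c ^ 2) * Y₃ - C (b * c ^ 2 * d * ε ^ 2) * Y₄,
       -Y₁ - C c * Y₃ - C a * Y₄]

def matD (a b c d : K) : Matrix (Fin 3) (Fin 3) (S K) :=
  !![0, Y₁ - C a * Y₂, Y₃ - C b * Y₄;
     Y₁ - C c * Y₂, -Y₃ - C (b + d) * Y₄, 0;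
     Y₃ - C d * Y₄, 0, -Y₁ - C (a + c) * Y₂]

def matE (a b c d : K) : Matrix (Fin 3) (Fin 3) (S K) :=
  !![0, Y₁ - C a * Y₃, Y₂ - C b * Y₄;
     Y₁ - C c * Y₃, -Y₂ - C (b + d) * Y₄, 0;
     Y₂ - C d * Y₄, 0, -Y₁ - C (a + c) * Y₃]

def matF (a b c d : K) : Matrix (Fin 3) (Fin 3) (S K) :=
  !![0, Y₁ - C a * Y₄, Y₂ - C b * Y₃;
     Y₁ - C c * Y₄, -Y₂ - C (b + d) * Y₃, 0;
     Y₂ - C d * Y₃, 0, -Y₁ - C (a + c) * Y₄]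

/-- The matrix `φ` is one of the nine listed matrices `A, Aᵗ, B, Bᵗ, C, Cᵗ, D, E, F`,
with parameters satisfying the condition of its case. -/
def Listed (φ : Matrix (Fin 3) (Fin 3) (S K)) : Prop :=
  ∃ a b c d : K, a ^ 3 = -1 ∧ b ^ 3 = -1 ∧ c ^ 3 = -1 ∧ d ^ 3 = -1 ∧
    ((∃ ε : K, ε ^ 3 = 1 ∧ ε ≠ 1 ∧
        ((b * c * d = ε * a ∧ (φ = matA a b c d ε ∨ φ = (matA a b c d ε).transpose)) ∨
         (a * d = ε * (b * c) ∧ (φ = matB a b c d ε ∨ φ = (matB a b c d ε).transpose)) ∨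
         (a * b = ε * (c * d) ∧ (φ = matC a b c d ε ∨ φ = (matC a b c d ε).transpose)))) ∨
      (a ≠ c ∧ b ≠ d ∧ (φ = matD a b c d ∨ φ = matE a b c d ∨ φ = matF a b c d)))

/-- The entries `α, β` and `γ, δ` of the first row and the first column of `φ`. -/
def border (φ : Matrix (Fin 3) (Fin 3) (S K)) : Fin 4 → S K :=
  ![φ 0 1, φ 0 2, φ 1 0, φ 2 0]

end Matrices

end FermatCubic

end

open FermatCubic

/-! ### Determinants of the listed matrices and independence of their borders -/

noncomputable section

namespace FermatCubic

open MvPolynomial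

variable {K : Type*} [Field K]

/-! Every listed matrix has determinant f₄, so it forms a matrix factorization with its adjugate,
and independence of the four border forms is the nonvanishing of a 4 × 4 determinant of
coefficients. The substance is the classification. Commutative algebra turns the module into a
linear determinantal representation of the cubic surface, and geometry of the surface normalizes
that representation.

Algebra. Put A = K[Y₂, Y₃, Y₄]. The ring R₄ is a domain and is free over A on 1, Y₁, Y₁². A graded
maximal Cohen-Macaulay module M is free over A with a homogeneous basis
(`exists_homogeneous_basis`): prime avoidance replaces the given regular sequence by three
independent linear forms of A (`exists_regular_linear_sequence`), and a minimal homogeneous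
generating family is independent modulo these forms, hence over A (`independent_of_regularOn`). Rank
one over R₄ bounds the A-rank by 3, and the three generators bound it from below. Multiplication by
Y₁ is then a 3 × 3 matrix T over A. Unequal degrees of the basis would split off a factor of det(Y₁
- T) or produce torsion, so the degrees agree (`degrees_eq`) and T consists of linear forms. The
determinant of Y₁ - T annihilates M, so it is zero in R₄; being a monic cubic in Y₁, it equals f₄.
The module is the cokernel of Y₁ - T (`exists_linear_presentation`).

Geometry. Row and column operations over K create a zero in the corner
(`exists_equivalent_bordered`). The two remaining forms of the first row then cut out a line on the
surface, and so do those of the first column. Each line is given by two binomials attached to one of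
the three pairings of the variables (`joins_of_line`), so the border can be brought to one of 3 · 3
shapes, which are the shapes of the nine families. Smoothness of the surface makes the four border
forms independent (`det_borderCoeff_ne_zero`). Finally, border and determinant fix the matrix up to
equivalence (`equivalent_of_border_eq`), because the ambiguity in the lower block is a linear syzygy
of αγ, αδ, βγ, βδ, and these syzygies come from adding multiples of the first row and column. The
listed matrix with the same border has the same determinant, so it is equivalent to the given one.
-/

theorem isMatrixFactorization_adjugate {φ : Matrix (Fin 3) (Fin 3) (S K)} (h : φ.det = f K) :
    IsMatrixFactorization φ φ.adjugate := by
  constructor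
  · rw [Matrix.mul_adjugate, h]
  · rw [Matrix.adjugate_mul, h]

theorem sq_add_self_add_one_eq_zero {ε : K} (h : ε ^ 3 = 1) (h1 : ε ≠ 1) : ε ^ 2 + ε + 1 = 0 := by
  have h2 : (ε - 1) * (ε ^ 2 + ε + 1) = 0 := by linear_combination h
  exact (mul_eq_zero.1 h2).resolve_left (sub_ne_zero.2 h1)

theorem sq_add_mul_add_sq_eq_zero {a c : K} (h : a ^ 3 = c ^ 3) (h1 : a ≠ c) :
    a ^ 2 + a * c + c ^ 2 = 0 := by
  have h2 : (a - c) * (a ^ 2 + a * c + c ^ 2) = 0 := by linear_combination h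
  exact (mul_eq_zero.1 h2).resolve_left (sub_ne_zero.2 h1)

theorem det_matA [CharZero K] {a b c d ε : K} (ha : a ^ 3 = -1) (hb : b ^ 3 = -1) (hc : c ^ 3 = -1)
    (hd : d ^ 3 = -1) (hε : ε ^ 3 = 1) (hε1 : ε ≠ 1) (h : b * c * d = ε * a) :
    (matA a b c d ε).det = f K := by
  have h2 := sq_add_self_add_one_eq_zero hε hε1
  -- The condition times b²c², with b³c³ = 1, solves for d. Eliminating d leaves only the cubic
  -- relations and ε² + ε + 1 = 0. Cases B and C are treated in the same way.
  have hd' : d = ε * a * b ^ 2 * c ^ 2 := by grind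
  refine MvPolynomial.funext fun y => ?_
  simp [matA, f, Matrix.det_fin_three]
  subst hd'
  clear h hd
  grind

theorem det_matB [CharZero K] {a b c d ε : K} (ha : a ^ 3 = -1) (hb : b ^ 3 = -1) (hc : c ^ 3 = -1)
    (hd : d ^ 3 = -1) (hε : ε ^ 3 = 1) (hε1 : ε ≠ 1) (h : a * d = ε * (b * c)) :
    (matB a b c d ε).det = f K := by
  have h2 := sq_add_self_add_one_eq_zero hε hε1
  have hd' : d = - ε * b * c * a ^ 2 := by grind
  refine MvPolynomial.funext fun y => ?_
  simp [matB, f, Matrix.det_fin_three]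
  subst hd'
  clear h hd
  grind

theorem det_matC [CharZero K] {a b c d ε : K} (ha : a ^ 3 = -1) (hb : b ^ 3 = -1) (hc : c ^ 3 = -1)
    (hd : d ^ 3 = -1) (hε : ε ^ 3 = 1) (hε1 : ε ≠ 1) (h : a * b = ε * (c * d)) :
    (matC a b c d ε).det = f K := by
  have h2 := sq_add_self_add_one_eq_zero hε hε1
  have ha' : a = - ε * c * d * b ^ 2 := by grind
  refine MvPolynomial.funext fun y => ?_
  simp [matC, f, Matrix.det_fin_three]
  subst ha'
  clear h ha
  grind

/-- With zeros off the diagonal of the lower block, the determinant is a sum of two products of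
three linear forms. Since a ≠ c are cube roots of -1, the third one is -(a + c), so the first
product is Y₁³ + Y₂³. The second is handled likewise, and so are E and F. -/
theorem det_matD [CharZero K] {a b c d : K} (ha : a ^ 3 = -1) (hb : b ^ 3 = -1) (hc : c ^ 3 = -1)
    (hd : d ^ 3 = -1) (hac : a ≠ c) (hbd : b ≠ d) : (matD a b c d).det = f K := by
  have h1 := sq_add_mul_add_sq_eq_zero (ha.trans hc.symm) hac
  have h2 := sq_add_mul_add_sq_eq_zero (hb.trans hd.symm) hbd
  refine MvPolynomial.funext fun y => ?_
  simp [matD, f, Matrix.det_fin_three]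
  grind

theorem det_matE [CharZero K] {a b c d : K} (ha : a ^ 3 = -1) (hb : b ^ 3 = -1) (hc : c ^ 3 = -1)
    (hd : d ^ 3 = -1) (hac : a ≠ c) (hbd : b ≠ d) : (matE a b c d).det = f K := by
  have h1 := sq_add_mul_add_sq_eq_zero (ha.trans hc.symm) hac
  have h2 := sq_add_mul_add_sq_eq_zero (hb.trans hd.symm) hbd
  refine MvPolynomial.funext fun y => ?_
  simp [matE, f, Matrix.det_fin_three]
  grind

theorem det_matF [CharZero K] {a b c d : K} (ha : a ^ 3 = -1) (hb : b ^ 3 = -1) (hc : c ^ 3 = -1)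
    (hd : d ^ 3 = -1) (hac : a ≠ c) (hbd : b ≠ d) : (matF a b c d).det = f K := by
  have h1 := sq_add_mul_add_sq_eq_zero (ha.trans hc.symm) hac
  have h2 := sq_add_mul_add_sq_eq_zero (hb.trans hd.symm) hbd
  refine MvPolynomial.funext fun y => ?_
  simp [matF, f, Matrix.det_fin_three]
  grind

theorem Listed.det_eq [CharZero K] {φ : Matrix (Fin 3) (Fin 3) (S K)} (h : Listed φ) :
    φ.det = f K := by
  obtain ⟨a, b, c, d, ha, hb, hc, hd, h⟩ := h
  rcases h with ⟨ε, h1, h2, ⟨h, rfl | rfl⟩ | ⟨h, rfl | rfl⟩ | ⟨h, rfl | rfl⟩⟩ |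
    ⟨h1, h2, rfl | rfl | rfl⟩
  · exact det_matA ha hb hc hd h1 h2 h
  · rw [Matrix.det_transpose]; exact det_matA ha hb hc hd h1 h2 h
  · exact det_matB ha hb hc hd h1 h2 h
  · rw [Matrix.det_transpose]; exact det_matB ha hb hc hd h1 h2 h
  · exact det_matC ha hb hc hd h1 h2 h
  · rw [Matrix.det_transpose]; exact det_matC ha hb hc hd h1 h2 h
  · exact det_matD ha hb hc hd h1 h2
  · exact det_matE ha hb hc hd h1 h2
  · exact det_matF ha hb hc hd h1 h2

/-- The linear form with coefficients `a`. -/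
def lin : (Fin 4 → K) →ₗ[K] S K := Fintype.linearCombination K (X : Fin 4 → S K)

theorem lin_apply (a : Fin 4 → K) :
    lin a = C (a 0) * X 0 + C (a 1) * X 1 + C (a 2) * X 2 + C (a 3) * X 3 := by
  simp [lin, Fintype.linearCombination_apply, Fin.sum_univ_four, MvPolynomial.smul_eq_C_mul]

theorem eval_lin (a y : Fin 4 → K) :
    eval y (lin a) = a 0 * y 0 + a 1 * y 1 + a 2 * y 2 + a 3 * y 3 := by
  simp [lin_apply]

theorem lin_injective : Function.Injective (lin (K := K)) := by
  intro a b h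
  ext i
  have := congrArg (eval (Pi.single i 1)) h
  rw [eval_lin, eval_lin] at this
  fin_cases i <;> simpa using this

theorem linearIndependent_lin_iff (a b c d : Fin 4 → K) :
    LinearIndependent K ![lin a, lin b, lin c, lin d] ↔ (Matrix.of ![a, b, c, d]).det ≠ 0 := by
  have h1 : ![lin a, lin b, lin c, lin d] = lin ∘ ![a, b, c, d] := by
    ext i : 1; fin_cases i <;> rfl
  rw [h1, LinearMap.linearIndependent_iff_of_injOn _ lin_injective.injOn,
    ← isUnit_iff_ne_zero, ← Matrix.isUnit_iff_isUnit_det,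
    ← Matrix.linearIndependent_rows_iff_isUnit]
  rfl

theorem X_sub_C_mul_X_eq_lin (i j : Fin 4) (a : K) :
    (X i - C a * X j : S K) = lin (Pi.single i 1 - a • Pi.single j 1) := by
  simp [lin, MvPolynomial.smul_eq_C_mul]

theorem ne_iff_exists_root_of_unity {x y : K} (hx : x ^ 3 = y ^ 3) (hy : y ≠ 0) :
    x ≠ y ↔ ∃ ε : K, ε ^ 3 = 1 ∧ ε ≠ 1 ∧ x = ε * y := by
  constructor
  · intro h
    refine ⟨x / y, by rw [div_pow, hx, div_self (pow_ne_zero _ hy)], fun h1 => h ?_, ?_⟩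
    · rwa [div_eq_one_iff_eq hy] at h1
    · rw [div_mul_cancel₀ _ hy]
  · rintro ⟨ε, _, h2, h3⟩ h4
    rw [h4] at h3
    exact h2 (mul_right_cancel₀ hy (by rw [one_mul]; exact h3.symm))

theorem ne_zero_of_cube_eq_neg_one {a : K} (h : a ^ 3 = -1) : a ≠ 0 := by
  rintro rfl; simp at h

section LinearIndependence

variable {a b c d : K} (ε : K)

theorem linearIndependent_border_matA :
    LinearIndependent K (border (matA a b c d ε)) ↔ b * c * d ≠ a := by
  have : border (matA a b c d ε) = ![X 0 - C a * X 3, X 1 - C b * X 2,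
    X 0 - C c * X 1, X 2 - C d * X 3] := rfl
  rw [this]
  simp only [X_sub_C_mul_X_eq_lin]
  rw [linearIndependent_lin_iff, not_iff_not, Matrix.det_succ_row_zero]
  simp [Fin.sum_univ_succ, Matrix.det_fin_three, Fin.succAbove]
  grind

theorem linearIndependent_border_matA_transpose :
    LinearIndependent K (border (matA a b c d ε).transpose) ↔ b * c * d ≠ a := by
  have : border (matA a b c d ε).transpose = ![X 0 - C c * X 1, X 2 - C d * X 3,
    X 0 - C a * X 3, X 1 - C b * X 2] := rfl
  rw [this]
  simp only [X_sub_C_mul_X_eq_lin]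
  rw [linearIndependent_lin_iff, not_iff_not, Matrix.det_succ_row_zero]
  simp [Fin.sum_univ_succ, Matrix.det_fin_three, Fin.succAbove]
  grind

theorem linearIndependent_border_matB :
    LinearIndependent K (border (matB a b c d ε)) ↔ a * d ≠ b * c := by
  have : border (matB a b c d ε) = ![X 0 - C a * X 2, X 1 - C b * X 3,
    X 0 - C c * X 1, X 2 - C d * X 3] := rfl
  rw [this]
  simp only [X_sub_C_mul_X_eq_lin]
  rw [linearIndependent_lin_iff, not_iff_not, Matrix.det_succ_row_zero]
  simp [Fin.sum_univ_succ, Matrix.det_fin_three, Fin.succAbove]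
  grind

theorem linearIndependent_border_matB_transpose :
    LinearIndependent K (border (matB a b c d ε).transpose) ↔ a * d ≠ b * c := by
  have : border (matB a b c d ε).transpose = ![X 0 - C c * X 1, X 2 - C d * X 3,
    X 0 - C a * X 2, X 1 - C b * X 3] := rfl
  rw [this]
  simp only [X_sub_C_mul_X_eq_lin]
  rw [linearIndependent_lin_iff, not_iff_not, Matrix.det_succ_row_zero]
  simp [Fin.sum_univ_succ, Matrix.det_fin_three, Fin.succAbove]
  grind

theorem linearIndependent_border_matC :
    LinearIndependent K (border (matC a b c d ε)) ↔ a * b ≠ c * d := by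
  have : border (matC a b c d ε) = ![X 0 - C a * X 3, X 1 - C b * X 2,
    X 0 - C c * X 2, X 1 - C d * X 3] := rfl
  rw [this]
  simp only [X_sub_C_mul_X_eq_lin]
  rw [linearIndependent_lin_iff, not_iff_not, Matrix.det_succ_row_zero]
  simp [Fin.sum_univ_succ, Matrix.det_fin_three, Fin.succAbove]
  grind

theorem linearIndependent_border_matC_transpose :
    LinearIndependent K (border (matC a b c d ε).transpose) ↔ a * b ≠ c * d := by
  have : border (matC a b c d ε).transpose = ![X 0 - C c * X 2, X 1 - C d * X 3,
    X 0 - C a * X 3, X 1 - C b * X 2] := rfl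
  rw [this]
  simp only [X_sub_C_mul_X_eq_lin]
  rw [linearIndependent_lin_iff, not_iff_not, Matrix.det_succ_row_zero]
  simp [Fin.sum_univ_succ, Matrix.det_fin_three, Fin.succAbove]
  grind

theorem linearIndependent_border_matD :
    LinearIndependent K (border (matD a b c d)) ↔ a ≠ c ∧ b ≠ d := by
  have : border (matD a b c d) = ![X 0 - C a * X 1, X 2 - C b * X 3,
    X 0 - C c * X 1, X 2 - C d * X 3] := rfl
  rw [this]
  simp only [X_sub_C_mul_X_eq_lin]
  rw [linearIndependent_lin_iff, ← sub_ne_zero (a := a), ← sub_ne_zero (a := b), ← mul_ne_zero_iff,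
    not_iff_not, Matrix.det_succ_row_zero]
  simp [Fin.sum_univ_succ, Matrix.det_fin_three, Fin.succAbove]
  grind

theorem linearIndependent_border_matE :
    LinearIndependent K (border (matE a b c d)) ↔ a ≠ c ∧ b ≠ d := by
  have : border (matE a b c d) = ![X 0 - C a * X 2, X 1 - C b * X 3,
    X 0 - C c * X 2, X 1 - C d * X 3] := rfl
  rw [this]
  simp only [X_sub_C_mul_X_eq_lin]
  rw [linearIndependent_lin_iff, ← sub_ne_zero (a := a), ← sub_ne_zero (a := b), ← mul_ne_zero_iff,
    not_iff_not, Matrix.det_succ_row_zero]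
  simp [Fin.sum_univ_succ, Matrix.det_fin_three, Fin.succAbove]
  grind

theorem linearIndependent_border_matF :
    LinearIndependent K (border (matF a b c d)) ↔ a ≠ c ∧ b ≠ d := by
  have : border (matF a b c d) = ![X 0 - C a * X 3, X 1 - C b * X 2,
    X 0 - C c * X 3, X 1 - C d * X 2] := rfl
  rw [this]
  simp only [X_sub_C_mul_X_eq_lin]
  rw [linearIndependent_lin_iff, ← sub_ne_zero (a := a), ← sub_ne_zero (a := b), ← mul_ne_zero_iff,
    not_iff_not, Matrix.det_succ_row_zero]
  simp [Fin.sum_univ_succ, Matrix.det_fin_three, Fin.succAbove]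
  grind

end LinearIndependence

end FermatCubic

end

/-! ### Matrices of linear forms up to equivalence, and bordered matrices -/

noncomputable section

namespace FermatCubic

open MvPolynomial Matrix

variable {K : Type*} [Field K]

/-- The value at `y` of the matrix of linear forms with coefficient matrices `Φ`. -/
def ev (Φ : Fin 4 → Matrix (Fin 3) (Fin 3) K) (y : Fin 4 → K) : Matrix (Fin 3) (Fin 3) K :=
  ∑ k, y k • Φ k

/-- The Fermat cubic as a function. -/
def cub (y : Fin 4 → K) : K := y 0 ^ 3 + y 1 ^ 3 + y 2 ^ 3 + y 3 ^ 3

/-- Equivalence of matrices of linear forms. -/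
def Equivalent (Φ Ψ : Fin 4 → Matrix (Fin 3) (Fin 3) K) : Prop :=
  ∃ U V : Matrix (Fin 3) (Fin 3) K, U.det ≠ 0 ∧ V.det ≠ 0 ∧ ∀ k, Ψ k = U * Φ k * V

theorem Equivalent.trans {Φ Ψ Ξ : Fin 4 → Matrix (Fin 3) (Fin 3) K} (h : Equivalent Φ Ψ)
    (h' : Equivalent Ψ Ξ) : Equivalent Φ Ξ := by
  obtain ⟨U, V, hU, hV, h⟩ := h
  obtain ⟨U', V', hU', hV', h'⟩ := h'
  refine ⟨U' * U, V * V', ?_, ?_, fun k => ?_⟩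
  · rw [det_mul]; exact mul_ne_zero hU' hU
  · rw [det_mul]; exact mul_ne_zero hV hV'
  · rw [h', h]; simp only [Matrix.mul_assoc]

theorem ev_mul_mul (Φ : Fin 4 → Matrix (Fin 3) (Fin 3) K) (U V : Matrix (Fin 3) (Fin 3) K)
    (y : Fin 4 → K) : ev (fun k => U * Φ k * V) y = U * ev Φ y * V := by
  simp [ev, Matrix.mul_sum, Matrix.sum_mul]

theorem ev_apply (Φ : Fin 4 → Matrix (Fin 3) (Fin 3) K) (y : Fin 4 → K) (i j : Fin 3) :
    ev Φ y i j = y 0 * Φ 0 i j + y 1 * Φ 1 i j + y 2 * Φ 2 i j + y 3 * Φ 3 i j := by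
  simp [ev, Matrix.sum_apply, Fin.sum_univ_four]

/-- The determinant is the Fermat cubic up to a nonzero constant. -/
def HasCubicDet (Φ : Fin 4 → Matrix (Fin 3) (Fin 3) K) : Prop :=
  ∃ c : K, c ≠ 0 ∧ ∀ y, (ev Φ y).det = c * cub y

theorem HasCubicDet.of_equivalent {Φ Ψ : Fin 4 → Matrix (Fin 3) (Fin 3) K} (h : HasCubicDet Φ)
    (h' : Equivalent Φ Ψ) : HasCubicDet Ψ := by
  obtain ⟨c, hc, h⟩ := h
  obtain ⟨U, V, hU, hV, h'⟩ := h'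
  obtain rfl : Ψ = fun k => U * Φ k * V := funext h'
  refine ⟨U.det * c * V.det, by simp [hU, hV, hc], fun y => ?_⟩
  rw [ev_mul_mul, det_mul, det_mul, h]
  ring

/-- The coefficients of the off-diagonal entries of the first row and the first column. -/
def borderCoeff (Φ : Fin 4 → Matrix (Fin 3) (Fin 3) K) : Matrix (Fin 4) (Fin 4) K :=
  Matrix.of ![fun k => Φ k 0 1, fun k => Φ k 0 2, fun k => Φ k 1 0, fun k => Φ k 2 0]

/-- A dependency gives a nonzero point p where all border forms vanish. With zero corner, every term
of the determinant contains one form of the first row and one of the first column, so the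
determinant vanishes to order two at p. The Fermat cubic would be singular at p, but its partial
derivatives 3pᵢ² have no common nontrivial zero. -/
theorem det_borderCoeff_ne_zero [CharZero K] {Φ : Fin 4 → Matrix (Fin 3) (Fin 3) K}
    (h : HasCubicDet Φ) (h0 : ∀ k, Φ k 0 0 = 0) : (borderCoeff Φ).det ≠ 0 := by
  intro hD
  obtain ⟨p, hp, hDp⟩ := Matrix.exists_mulVec_eq_zero_iff.2 hD
  obtain ⟨c, hc, h⟩ := h
  have e0 := congrFun hDp 0
  have e1 := congrFun hDp 1
  have e2 := congrFun hDp 2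
  have e3 := congrFun hDp 3
  simp [borderCoeff, Matrix.mulVec, dotProduct, Fin.sum_univ_four] at e0 e1 e2 e3
  have h00 : ∀ y, ev Φ y 0 0 = 0 := fun y => by simp [ev_apply, h0]
  have key : ∀ i, p i = 0 := by
    intro i
    have hev : ∀ (s : K) (j k : Fin 3),
        ev Φ (p + s • Pi.single i 1) j k = ev Φ p j k + s * Φ i j k := by
      intro s j k
      fin_cases i <;> simp [ev_apply] <;> ring
    have b0 : ev Φ p 0 1 = 0 := by rw [ev_apply]; linear_combination e0
    have b1 : ev Φ p 0 2 = 0 := by rw [ev_apply]; linear_combination e1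
    have b2 : ev Φ p 1 0 = 0 := by rw [ev_apply]; linear_combination e2
    have b3 : ev Φ p 2 0 = 0 := by rw [ev_apply]; linear_combination e3
    have hcub : ∀ s : K, cub (p + s • Pi.single i 1) =
        cub p + 3 * s * p i ^ 2 + 3 * s ^ 2 * p i + s ^ 3 := by
      intro s
      fin_cases i <;> simp [cub] <;> ring
    have hdet : ∀ s : K, (ev Φ (p + s • Pi.single i 1)).det = s ^ 2 *
        (-(Φ i 0 1 * Φ i 1 0 * (ev Φ p 2 2 + s * Φ i 2 2)) +
          Φ i 0 1 * Φ i 2 0 * (ev Φ p 1 2 + s * Φ i 1 2) +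
          Φ i 0 2 * Φ i 1 0 * (ev Φ p 2 1 + s * Φ i 2 1) -
          Φ i 0 2 * Φ i 2 0 * (ev Φ p 1 1 + s * Φ i 1 1)) := by
      intro s
      rw [det_fin_three, h00]
      simp only [hev, b0, b1, b2, b3]
      ring
    have g : ∀ s : K, _ := fun s => ((hdet s).symm.trans (h _)).trans (by rw [hcub s])
    have g0 := g 0
    have g1 := g 1
    have g2 := g (-1)
    have g3 := g 2
    -- The weights 3, -6, 2, 1 at s = 0, 1, -1, 2 kill the coefficients of 1, s² and s³ and keep
    -- that of s.
    have : 18 * (c * p i ^ 2) = 0 := by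
      linear_combination 3 * g0 - 6 * g1 + 2 * g2 + g3
    simpa [hc] using this
  exact hp (funext key)

/-- Two bordered matrices with the same independent border and the same determinant are
equivalent. -/
theorem equivalent_of_border_eq [CharZero K] {Φ Ψ : Fin 4 → Matrix (Fin 3) (Fin 3) K}
    (hD : (borderCoeff Φ).det ≠ 0) (hdet : ∀ y, (ev Φ y).det = (ev Ψ y).det)
    (h0 : ∀ k, Φ k 0 0 = 0) (h0' : ∀ k, Ψ k 0 0 = 0) (h1 : ∀ k, Ψ k 0 1 = Φ k 0 1)
    (h2 : ∀ k, Ψ k 0 2 = Φ k 0 2) (h3 : ∀ k, Ψ k 1 0 = Φ k 1 0) (h4 : ∀ k, Ψ k 2 0 = Φ k 2 0) :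
    Equivalent Φ Ψ := by
  have hu : IsUnit (borderCoeff Φ).det := isUnit_iff_ne_zero.2 hD
  have hcoord : ∀ x : Fin 4 → K, ∃ z : Fin 4 → K, ∀ k,
      x k = z 0 * Φ k 0 1 + z 1 * Φ k 0 2 + z 2 * Φ k 1 0 + z 3 * Φ k 2 0 := by
    intro x
    refine ⟨x ᵥ* (borderCoeff Φ)⁻¹, fun k => ?_⟩
    have : (x ᵥ* (borderCoeff Φ)⁻¹) ᵥ* borderCoeff Φ = x := by
      rw [vecMul_vecMul, nonsing_inv_mul _ hu, vecMul_one]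
    conv_lhs => rw [← this]
    simp [borderCoeff, vecMul, dotProduct, Fin.sum_univ_four]
  obtain ⟨m, hm⟩ := hcoord fun k => Ψ k 1 1 - Φ k 1 1
  obtain ⟨n, hn⟩ := hcoord fun k => Ψ k 1 2 - Φ k 1 2
  obtain ⟨w, hw⟩ := hcoord fun k => Ψ k 2 1 - Φ k 2 1
  obtain ⟨t, ht⟩ := hcoord fun k => Ψ k 2 2 - Φ k 2 2
  -- The border forms are coordinates on K⁴, so A, B, C, D take arbitrary values. Equality of the
  -- determinants says that the differences of the blocks are a linear syzygy of AC, AD, BC, BD.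
  have key : ∀ A B C D : K,
      -(A * C) * (t 0 * A + t 1 * B + t 2 * C + t 3 * D) +
      A * D * (n 0 * A + n 1 * B + n 2 * C + n 3 * D) +
      B * C * (w 0 * A + w 1 * B + w 2 * C + w 3 * D) -
      B * D * (m 0 * A + m 1 * B + m 2 * C + m 3 * D) = 0 := by
    intro A B C D
    set y := (borderCoeff Φ)⁻¹ *ᵥ ![A, B, C, D] with hy
    have hy' : borderCoeff Φ *ᵥ y = ![A, B, C, D] := by
      rw [hy, mulVec_mulVec, mul_nonsing_inv _ hu, one_mulVec]
    have e0 := congrFun hy' 0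
    have e1 := congrFun hy' 1
    have e2 := congrFun hy' 2
    have e3 := congrFun hy' 3
    simp [borderCoeff, Matrix.mulVec, dotProduct, Fin.sum_univ_four] at e0 e1 e2 e3
    have a0 : ev Φ y 0 1 = A := by rw [ev_apply]; linear_combination e0
    have a1 : ev Φ y 0 2 = B := by rw [ev_apply]; linear_combination e1
    have a2 : ev Φ y 1 0 = C := by rw [ev_apply]; linear_combination e2
    have a3 : ev Φ y 2 0 = D := by rw [ev_apply]; linear_combination e3
    have b0 : ev Ψ y 0 1 = A := by rw [← a0, ev_apply, ev_apply]; simp only [h1]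
    have b1 : ev Ψ y 0 2 = B := by rw [← a1, ev_apply, ev_apply]; simp only [h2]
    have b2 : ev Ψ y 1 0 = C := by rw [← a2, ev_apply, ev_apply]; simp only [h3]
    have b3 : ev Ψ y 2 0 = D := by rw [← a3, ev_apply, ev_apply]; simp only [h4]
    have c0 : ev Φ y 0 0 = 0 := by simp [ev_apply, h0]
    have c0' : ev Ψ y 0 0 = 0 := by simp [ev_apply, h0']
    have hblock : ∀ (i j : Fin 3) (z : Fin 4 → K), (∀ k, Ψ k i j - Φ k i j =
        z 0 * Φ k 0 1 + z 1 * Φ k 0 2 + z 2 * Φ k 1 0 + z 3 * Φ k 2 0) →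
        ev Ψ y i j = ev Φ y i j + (z 0 * A + z 1 * B + z 2 * C + z 3 * D) := by
      intro i j z hz
      rw [← a0, ← a1, ← a2, ← a3]
      simp only [ev_apply]
      linear_combination y 0 * hz 0 + y 1 * hz 1 + y 2 * hz 2 + y 3 * hz 3
    have hd := hdet y
    rw [det_fin_three, det_fin_three, a0, a1, a2, a3, b0, b1, b2, b3, c0, c0', hblock 1 1 m hm,
      hblock 1 2 n hn, hblock 2 1 w hw, hblock 2 2 t ht] at hd
    linear_combination -hd
  have p1 := key 1 0 1 0
  have p2 := key 1 0 (-1) 0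
  have q1 := key 1 0 0 1
  have q2 := key 1 0 0 (-1)
  have r1 := key 0 1 1 0
  have r2 := key 0 1 (-1) 0
  have s1 := key 0 1 0 1
  have s2 := key 0 1 0 (-1)
  have u1 := key 1 1 1 0
  have u2 := key 1 1 0 1
  have u3 := key 1 0 1 1
  have u4 := key 0 1 1 1
  have t0 : t 0 = 0 := by linear_combination (p2 - p1) / 2
  have t2 : t 2 = 0 := by linear_combination (-p1 - p2) / 2
  have n0 : n 0 = 0 := by linear_combination (q1 - q2) / 2
  have n3 : n 3 = 0 := by linear_combination (q1 + q2) / 2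
  have w1 : w 1 = 0 := by linear_combination (r1 - r2) / 2
  have w2 : w 2 = 0 := by linear_combination (r1 + r2) / 2
  have m1 : m 1 = 0 := by linear_combination (s2 - s1) / 2
  have m3 : m 3 = 0 := by linear_combination (-s1 - s2) / 2
  have wt : w 0 = t 1 := by linear_combination u1 + t0 + t2 - w1 - w2
  have nm : n 1 = m 0 := by linear_combination u2 - n0 - n3 + m1 + m3
  have nt : n 2 = t 3 := by linear_combination u3 - n0 - n3 + t0 + t2
  have wm : w 3 = m 2 := by linear_combination u4 - w1 - w2 + m1 + m3
  -- The four parameters are the multiples of the first row added to the lower rows and of the first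
  -- column added to the later columns. The zero corner keeps the border unchanged.
  refine ⟨!![1, 0, 0; m 0, 1, 0; t 1, 0, 1], !![1, m 2, t 3; 0, 1, 0; 0, 0, 1], ?_, ?_, fun k => ?_⟩
  · simp [det_fin_three]
  · simp [det_fin_three]
  · have hm' := hm k
    have hn' := hn k
    have hw' := hw k
    have ht' := ht k
    rw [m1, m3] at hm'
    rw [n0, n3, nm, nt] at hn'
    rw [w1, w2, wt, wm] at hw'
    rw [t0, t2] at ht'
    ext i j
    fin_cases i <;> fin_cases j <;>
      simp [Matrix.mul_apply, vecMul, dotProduct, Fin.sum_univ_three, h0, h0', h1, h2, h3, h4]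
    · linear_combination hm'
    · linear_combination hn'
    · linear_combination hw'
    · linear_combination ht'

/-- Rescaling the determinant of a bordered matrix without changing the border. -/
theorem equivalent_smul_block (Φ : Fin 4 → Matrix (Fin 3) (Fin 3) K) (h0 : ∀ k, Φ k 0 0 = 0)
    {s : K} (hs : s ≠ 0) :
    Equivalent Φ fun k => !![0, Φ k 0 1, Φ k 0 2; Φ k 1 0, s * Φ k 1 1, s * Φ k 1 2;
      Φ k 2 0, s * Φ k 2 1, s * Φ k 2 2] := by
  -- The lower two rows are scaled by s, and the effect on the first column is undone by s⁻¹, at no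
  -- cost because the corner is zero.
  refine ⟨!![1, 0, 0; 0, s, 0; 0, 0, s], !![s⁻¹, 0, 0; 0, 1, 0; 0, 0, 1], ?_, ?_, fun k => ?_⟩
  · simp [det_fin_three, hs]
  · simp [det_fin_three, hs]
  · ext i j
    fin_cases i <;> fin_cases j <;>
      simp [Matrix.mul_apply, vecMul, dotProduct, Fin.sum_univ_three, h0] <;> field_simp

theorem exists_det_ne_zero_row_zero_eq {u : Fin 3 → K} (hu : u ≠ 0) :
    ∃ U : Matrix (Fin 3) (Fin 3) K, U.det ≠ 0 ∧ ∀ j, U 0 j = u j := by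
  by_cases h0 : u 0 = 0
  · by_cases h1 : u 1 = 0
    · have h2 : u 2 ≠ 0 := fun h2 => hu (by ext i; fin_cases i <;> simp [h0, h1, h2])
      refine ⟨!![u 0, u 1, u 2; 1, 0, 0; 0, 1, 0], by simp [det_fin_three, h2], fun j => ?_⟩
      fin_cases j <;> rfl
    · refine ⟨!![u 0, u 1, u 2; 1, 0, 0; 0, 0, 1], by simp [det_fin_three, h1], fun j => ?_⟩
      fin_cases j <;> rfl
  · refine ⟨!![u 0, u 1, u 2; 0, 1, 0; 0, 0, 1], by simp [det_fin_three, h0], fun j => ?_⟩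
    fin_cases j <;> rfl

/-- Completing u and v to bases makes the bilinear value of each coefficient matrix at (u, v) its
corner entry. -/
theorem exists_equivalent_corner_eq_zero {Φ : Fin 4 → Matrix (Fin 3) (Fin 3) K}
    {u v : Fin 3 → K} (hu : u ≠ 0) (hv : v ≠ 0) (h : ∀ k, u ⬝ᵥ (Φ k *ᵥ v) = 0) :
    ∃ Ψ, Equivalent Φ Ψ ∧ ∀ k, Ψ k 0 0 = 0 := by
  obtain ⟨U, hU, hU'⟩ := exists_det_ne_zero_row_zero_eq hu
  obtain ⟨V, hV, hV'⟩ := exists_det_ne_zero_row_zero_eq hv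
  refine ⟨fun k => U * Φ k * V.transpose, ⟨U, V.transpose, hU, by rwa [det_transpose],
    fun k => rfl⟩, fun k => ?_⟩
  change (U * Φ k * V.transpose) 0 0 = 0
  rw [← h k, Matrix.mul_assoc, Matrix.mul_apply]
  refine Finset.sum_congr rfl fun i _ => ?_
  rw [hU']
  congr 1
  rw [Matrix.mul_apply]
  simp [mulVec, dotProduct, hV']

end FermatCubic

end

/-! ### Creating a zero in the corner -/

noncomputable section

namespace FermatCubic

open MvPolynomial Matrix

variable {K : Type*} [Field K]

theorem exists_sq_add_self_add_one_eq_zero (K : Type*) [Field K] [IsAlgClosed K] [CharZero K] :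
    ∃ ω : K, ω ^ 2 + ω + 1 = 0 := by
  obtain ⟨s, hs⟩ := IsAlgClosed.exists_eq_mul_self (-3 : K)
  exact ⟨(-1 + s) / 2, by linear_combination -hs / 4⟩

/-- On the plane of the first two variables the determinant gives det(Φ 1 - μ) = 1 - μ³, so `Φ 1`
has the three distinct cube roots of unity as eigenvalues. -/
theorem exists_diagonalization [CharZero K] {Φ : Fin 4 → Matrix (Fin 3) (Fin 3) K}
    (hdet : ∀ y, (ev Φ y).det = cub y) (h1 : Φ 0 = 1) {ω : K} (hω : ω ^ 2 + ω + 1 = 0) :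
    ∃ Ψ, Equivalent Φ Ψ ∧ (∀ y, (ev Ψ y).det = cub y) ∧ Ψ 0 = 1 ∧
      Ψ 1 = Matrix.diagonal ![1, ω, ω ^ 2] := by
  have hω3 : ω ^ 3 = 1 := by linear_combination (ω - 1) * hω
  have hω1 : ω ≠ 1 := by
    rintro rfl
    norm_num at hω
  have hω0 : ω ≠ 0 := by
    rintro rfl
    norm_num at hω
  set μ : Fin 3 → K := ![1, ω, ω ^ 2] with hμ
  have hμ3 : ∀ i, μ i ^ 3 = 1 := by
    intro i
    fin_cases i <;> simp [hμ, hω3, ← pow_mul]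
    rw [show ω ^ 6 = (ω ^ 3) ^ 2 by ring, hω3, one_pow]
  have hinj : Function.Injective μ := by
    have h12 : ω ≠ ω ^ 2 := fun h => hω1 (mul_left_cancel₀ hω0 (by linear_combination -h))
    have h02 : ω ^ 2 ≠ 1 := fun h => hω1 (by linear_combination hω3 - ω * h)
    intro i j hij
    fin_cases i <;> fin_cases j <;> simp [hμ, hω1, hω1.symm, h12, h12.symm, h02] at hij ⊢
    exact h02 hij.symm
  have hker : ∀ i, ∃ v : Fin 3 → K, v ≠ 0 ∧ Φ 1 *ᵥ v = μ i • v := by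
    intro i
    have : (ev Φ ![-μ i, 1, 0, 0]).det = 0 := by
      rw [hdet]
      simp [cub]
      linear_combination -hμ3 i
    obtain ⟨v, hv, hv'⟩ := Matrix.exists_mulVec_eq_zero_iff.2 this
    refine ⟨v, hv, ?_⟩
    have e : ev Φ ![-μ i, 1, 0, 0] = Φ 1 - μ i • (1 : Matrix (Fin 3) (Fin 3) K) := by
      simp [ev, Fin.sum_univ_four, h1]
      abel
    rw [e, sub_mulVec, smul_mulVec, one_mulVec, sub_eq_zero] at hv'
    exact hv'
  choose v hv hΦv using hker
  have hli : LinearIndependent K v := by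
    refine Module.End.eigenvectors_linearIndependent' (Matrix.toLin' (Φ 1)) μ hinj v fun i => ?_
    rw [Module.End.hasEigenvector_iff, Module.End.mem_eigenspace_iff, Matrix.toLin'_apply]
    exact ⟨hΦv i, hv i⟩
  set V : Matrix (Fin 3) (Fin 3) K := Matrix.of fun i j => v j i with hV
  have hVu : IsUnit V := Matrix.linearIndependent_cols_iff_isUnit.1 hli
  have hVd : IsUnit V.det := (Matrix.isUnit_iff_isUnit_det _).1 hVu
  have hVV : V⁻¹ * V = 1 := nonsing_inv_mul _ hVd
  have hΦV : Φ 1 * V = V * Matrix.diagonal μ := by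
    ext i j
    have := congrFun (hΦv j) i
    rw [Matrix.mul_diagonal]
    simp [Matrix.mul_apply, mulVec, dotProduct, hV] at this ⊢
    rw [this, mul_comm]
  refine ⟨fun k => V⁻¹ * Φ k * V, ⟨V⁻¹, V, ?_, hVd.ne_zero, fun k => rfl⟩, fun y => ?_, ?_, ?_⟩
  · exact ((Matrix.isUnit_nonsing_inv_det_iff).2 hVd).ne_zero
  · rw [ev_mul_mul, det_mul, det_mul, hdet, mul_right_comm, ← det_mul, hVV, det_one, one_mul]
  · change V⁻¹ * Φ 0 * V = 1
    rw [h1, Matrix.mul_one, hVV]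
  · change V⁻¹ * Φ 1 * V = _
    rw [Matrix.mul_assoc, hΦV, ← Matrix.mul_assoc, hVV, Matrix.one_mul]

/-- `p` and `r` have proportional linear forms in positions `ij` and `kl`. -/
def Prop2 (P R : Matrix (Fin 3) (Fin 3) K) (i j k l : Fin 3) : Prop :=
  P i j * R k l = P k l * R i j

theorem exists_relation_of_prop2 {P R : Matrix (Fin 3) (Fin 3) K} {i j k l : Fin 3}
    (h : Prop2 P R i j k l) :
    ∃ s t : K, (s ≠ 0 ∨ t ≠ 0) ∧ P i j * s + P k l * t = 0 ∧ R i j * s + R k l * t = 0 := by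
  unfold Prop2 at h
  by_cases h1 : P k l = 0
  · by_cases h2 : R k l = 0
    · exact ⟨0, 1, by simp, by simp [h1], by simp [h2]⟩
    · exact ⟨R k l, -R i j, by simp [h2], by linear_combination h, by ring⟩
  · exact ⟨P k l, -P i j, by simp [h1], by ring, by linear_combination -h⟩

/-- If `l₁l₂` is a constant multiple of `l₃l₄`, `l₁` is not proportional to `l₃`, then it is
proportional to `l₄`. -/
theorem prop_of_mul_eq {p1 r1 p2 r2 p3 r3 p4 r4 c : K}
    (h : ∀ x y : K, (p3 * x + r3 * y) * (p4 * x + r4 * y) =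
      c * ((p1 * x + r1 * y) * (p2 * x + r2 * y)))
    (h13 : p1 * r3 ≠ p3 * r1) : p1 * r4 = p4 * r1 := by
  have h1 := h r1 (-p1)
  have : (p1 * r3 - p3 * r1) * (p1 * r4 - p4 * r1) = 0 := by linear_combination h1
  exact sub_eq_zero.1 ((mul_eq_zero.1 this).resolve_left (sub_ne_zero.2 h13))

theorem exists_smul_of_prop {p r p' r' : K} (h : p * r' = p' * r) (h0 : p ≠ 0 ∨ r ≠ 0) :
    ∃ k : K, p' = k * p ∧ r' = k * r := by
  rcases h0 with h0 | h0
  · exact ⟨p' / p, by field_simp, by field_simp; linear_combination h⟩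
  · exact ⟨r' / r, by field_simp; linear_combination -h, by field_simp⟩

theorem mul_forms_eq_zero {p r p' r' c : K} (h0 : p ≠ 0 ∨ r ≠ 0) (h0' : p' ≠ 0 ∨ r' ≠ 0)
    (h : ∀ x y : K, c * ((p * x + r * y) * (p' * x + r' * y)) = 0) : c = 0 := by
  by_contra hc
  have h1 := h 1 0
  have h2 := h 0 1
  have h3 := h 1 1
  simp [hc] at h1 h2 h3
  grind

/-- If the two off-diagonal forms in some row are proportional, a unit vector u and a vector v
supported on the other two positions suffice. Otherwise unique factorization in the proportional
products B₀₁B₁₀, B₀₂B₂₀, B₁₂B₂₁ forces the cyclic pattern: positions 01, 12, 20 are multiples of one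
form, and positions 10, 21, 02 of another. Vectors u and v are then written down. -/
theorem bordered_aux [IsAlgClosed K] [CharZero K] {ω : K} (hω : ω ^ 2 + ω + 1 = 0)
    (P R : Matrix (Fin 3) (Fin 3) K) (B : Fin 3 → Fin 3 → K → K → K)
    (hB : B = fun i j x y => P i j * x + R i j * y)
    (h2 : ∀ x y, B 0 2 x y * B 2 0 x y = ω * (B 1 2 x y * B 2 1 x y))
    (h3 : ∀ x y, B 0 1 x y * B 1 0 x y = ω ^ 2 * (B 1 2 x y * B 2 1 x y)) :
    ∃ u v : Fin 3 → K, u ≠ 0 ∧ v ≠ 0 ∧ ∀ a b x y : K,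
      u 0 * ((a + b) * v 0 + B 0 1 x y * v 1 + B 0 2 x y * v 2) +
      u 1 * (B 1 0 x y * v 0 + (a + ω * b) * v 1 + B 1 2 x y * v 2) +
      u 2 * (B 2 0 x y * v 0 + B 2 1 x y * v 1 + (a + ω ^ 2 * b) * v 2) = 0 := by
  have hω3 : ω ^ 3 = 1 := by linear_combination (ω - 1) * hω
  have hω1 : ω ≠ 1 := by
    rintro rfl
    norm_num at hω
  have hω0 : ω ≠ 0 := by
    rintro rfl
    norm_num at hω
  have h1 : ∀ x y, B 0 2 x y * B 2 0 x y = ω ^ 2 * (B 0 1 x y * B 1 0 x y) := by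
    intro x y
    rw [h2, h3]
    linear_combination -ω * (B 1 2 x y * B 2 1 x y) * hω3
  have h1' : ∀ x y, B 0 1 x y * B 1 0 x y = ω * (B 0 2 x y * B 2 0 x y) := by
    intro x y
    rw [h2, h3]
    ring
  have h2' : ∀ x y, B 1 2 x y * B 2 1 x y = ω ^ 2 * (B 0 2 x y * B 2 0 x y) := by
    intro x y
    rw [h2]
    linear_combination -(B 1 2 x y * B 2 1 x y) * hω3
  have h3' : ∀ x y, B 1 2 x y * B 2 1 x y = ω * (B 0 1 x y * B 1 0 x y) := by
    intro x y
    rw [h3]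
    linear_combination -(B 1 2 x y * B 2 1 x y) * hω3
  by_cases c0 : Prop2 P R 0 1 0 2
  · obtain ⟨s, t, hst, e1, e2⟩ := exists_relation_of_prop2 c0
    refine ⟨![1, 0, 0], ![0, s, t], ?_, ?_, fun a b x y => ?_⟩
    · exact fun h => by simpa using congrFun h 0
    · rintro h
      have a1 : s = 0 := by simpa using congrFun h 1
      have a2 : t = 0 := by simpa using congrFun h 2
      exact hst.elim (fun h => h a1) fun h => h a2
    · simp [hB]
      linear_combination x * e1 + y * e2
  by_cases c1 : Prop2 P R 1 0 1 2
  · obtain ⟨s, t, hst, e1, e2⟩ := exists_relation_of_prop2 c1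
    refine ⟨![0, 1, 0], ![s, 0, t], ?_, ?_, fun a b x y => ?_⟩
    · exact fun h => by simpa using congrFun h 1
    · rintro h
      have a1 : s = 0 := by simpa using congrFun h 0
      have a2 : t = 0 := by simpa using congrFun h 2
      exact hst.elim (fun h => h a1) fun h => h a2
    · simp [hB]
      linear_combination x * e1 + y * e2
  by_cases c2 : Prop2 P R 2 0 2 1
  · obtain ⟨s, t, hst, e1, e2⟩ := exists_relation_of_prop2 c2
    refine ⟨![0, 0, 1], ![s, t, 0], ?_, ?_, fun a b x y => ?_⟩
    · exact fun h => by simpa using congrFun h 2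
    · rintro h
      have a1 : s = 0 := by simpa using congrFun h 0
      have a2 : t = 0 := by simpa using congrFun h 1
      exact hst.elim (fun h => h a1) fun h => h a2
    · simp [hB]
      linear_combination x * e1 + y * e2
  unfold Prop2 at c0 c1 c2
  simp only [hB] at h1 h1' h2 h2' h3 h3'
  have n01 : P 0 1 ≠ 0 ∨ R 0 1 ≠ 0 := by by_contra! h; simp [h.1, h.2] at c0
  have n10 : P 1 0 ≠ 0 ∨ R 1 0 ≠ 0 := by by_contra! h; simp [h.1, h.2] at c1
  have n20 : P 2 0 ≠ 0 ∨ R 2 0 ≠ 0 := by by_contra! h; simp [h.1, h.2] at c2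
  obtain ⟨k', e1, e2⟩ := exists_smul_of_prop (prop_of_mul_eq h1 c0) n01
  obtain ⟨j, e3, e4⟩ := exists_smul_of_prop
    (prop_of_mul_eq (p1 := P 1 0) (r1 := R 1 0) (p2 := P 0 1) (r2 := R 0 1) (c := ω)
      (fun x y => (h3' x y).trans (by ring)) c1) n10
  have n21 : P 2 1 ≠ 0 ∨ R 2 1 ≠ 0 := by by_contra! h; simp [h.1, h.2] at c2
  obtain ⟨k₀, e5, e6⟩ := exists_smul_of_prop
    (prop_of_mul_eq (p1 := P 2 0) (r1 := R 2 0) (p2 := P 0 2) (r2 := R 0 2) (c := ω ^ 2)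
      (fun x y => ((mul_comm _ _).trans (h2' x y)).trans (by ring)) c2) n20
  obtain ⟨j₀, e7, e8⟩ := exists_smul_of_prop
    (prop_of_mul_eq (p1 := P 2 1) (r1 := R 2 1) (p2 := P 1 2) (r2 := R 1 2) (c := ω)
      (fun x y => ((mul_comm _ _).trans (h2 x y)).trans (by ring)) (fun h => c2 h.symm)) n21
  obtain ⟨k, hk⟩ : ∃ k, k = k₀ * k' := ⟨_, rfl⟩
  obtain ⟨j', hj'⟩ : ∃ j', j' = j₀ * j := ⟨_, rfl⟩
  have e5' : P 1 2 = k * P 0 1 := by rw [e5, e1, hk]; ring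
  have e6' : R 1 2 = k * R 0 1 := by rw [e6, e2, hk]; ring
  have e7' : P 0 2 = j' * P 1 0 := by rw [e7, e3, hj']; ring
  have e8' : R 0 2 = j' * R 1 0 := by rw [e8, e4, hj']; ring
  have hkj : ω ^ 2 * (k * j) - 1 = 0 := mul_forms_eq_zero n01 n10 fun x y => by
    have := h3 x y
    rw [e5', e6', e3, e4] at this
    linear_combination -this
  have hkj' : k' * j' - ω ^ 2 = 0 := mul_forms_eq_zero n01 n10 fun x y => by
    have := h1 x y
    rw [e1, e2, e7', e8'] at this
    linear_combination this
  have hk0 : k ≠ 0 := by rintro rfl; simp at hkj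
  have hk0' : k' ≠ 0 := by rintro rfl; simp [hω0] at hkj'
  obtain ⟨μ, hμ⟩ := IsAlgClosed.exists_pow_nat_eq (k * k') (n := 3) (by norm_num)
  have hμ0 : μ ≠ 0 := by
    rintro rfl
    simp [hk0, hk0'] at hμ
  have hω2 : ω ^ 2 ≠ 1 := fun h => hω1 (by linear_combination hω3 - ω * h)
  -- The diagonal conditions force the products uᵢvᵢ to be proportional to (ω² - ω, 1 - ω², ω - 1),
  -- the cross product of (1, 1, 1) and (1, ω, ω²). Thus v is determined by u up to scale, and the
  -- choice μ³ = kk' makes the coefficients of both remaining forms vanish.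
  refine ⟨![μ ^ 2, μ, k], ![μ * k * (ω ^ 2 - ω), k * μ ^ 2 * (1 - ω ^ 2), μ ^ 2 * μ * (ω - 1)],
    ?_, ?_, fun a b x y => ?_⟩
  · exact fun h => hμ0 (by simpa using congrFun h 1)
  · intro h
    have := congrFun h 2
    simp [hμ0, sub_eq_zero, hω1] at this
  · simp only [hB, e1, e2, e3, e4, e5', e6', e7', e8']
    simp
    have q1 : k * j = ω := by linear_combination ω * hkj - k * j * hω3
    have q2 : k' * j' = ω ^ 2 := by linear_combination hkj'
    refine (mul_eq_zero.1 (?_ : μ * _ = 0)).resolve_left hμ0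
    linear_combination
      (-μ * (P 0 1 * x + R 0 1 * y) * (μ * k * (ω ^ 2 - ω))) * hμ +
      (μ * (P 1 0 * x + R 1 0 * y) * (k * μ ^ 2 * (1 - ω ^ 2))) * q1 +
      (P 1 0 * x + R 1 0 * y) * (μ ^ 2 * μ * (ω - 1)) * (j' * hμ + k * q2)

/-- This is the coefficient of x in the determinant, extracted by interpolation at x = 0, 1, -1, 2.
-/
theorem linear_coeff_det_eq_zero [CharZero K] {d0 d1 d2 : K} {P : Matrix (Fin 3) (Fin 3) K}
    (h : ∀ x : K, (diagonal ![d0, d1, d2] + x • P).det = x ^ 3) :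
    P 0 0 * (d1 * d2) + P 1 1 * (d0 * d2) + P 2 2 * (d0 * d1) = 0 := by
  have h0 := h 0
  have h1 := h 1
  have h2 := h (-1)
  have h3 := h 2
  simp [Fin.prod_univ_three, -mul_eq_zero] at h0
  simp [det_fin_three] at h1 h2 h3
  linear_combination h1 - h2 / 3 - h3 / 6 - h0 / 2

/-- For b = 1 and a = -1, -ω or -ω² the constant a³ + b³ vanishes together with exactly one diagonal
entry of the pencil. The linear coefficient in x is then a nonzero multiple of a single diagonal
entry of `P`. -/
theorem diag_eq_zero [CharZero K] {ω : K} (hω : ω ^ 2 + ω + 1 = 0) {P : Matrix (Fin 3) (Fin 3) K}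
    (h : ∀ a b x : K,
      (diagonal ![a + b, a + ω * b, a + ω ^ 2 * b] + x • P).det = a ^ 3 + b ^ 3 + x ^ 3) :
    ∀ i, P i i = 0 := by
  have hω3 : ω ^ 3 = 1 := by linear_combination (ω - 1) * hω
  have hω1 : ω - 1 ≠ 0 := by
    intro h
    rw [sub_eq_zero] at h
    subst h
    norm_num at hω
  have hω0 : ω ≠ 0 := by
    rintro rfl
    norm_num at hω
  have hω2 : ω + 1 ≠ 0 := fun h => hω0 (by simpa using (by linear_combination -hω + h * (ω + 1) : ω = 0))
  have key : ∀ a : K, a ^ 3 = -1 → P 0 0 * ((a + ω) * (a + ω ^ 2)) +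
      P 1 1 * ((a + 1) * (a + ω ^ 2)) + P 2 2 * ((a + 1) * (a + ω)) = 0 := by
    intro a ha
    refine linear_coeff_det_eq_zero fun x => ?_
    have := h a 1 x
    rw [ha] at this
    simpa using this
  have k0 := key (-1) (by norm_num)
  have k1 := key (-ω) (by linear_combination -hω3)
  have k2 := key (-ω ^ 2) (by linear_combination (-ω ^ 3 - 1) * hω3)
  intro i
  fin_cases i
  · have : P 0 0 * ((ω - 1) * ((ω - 1) * (ω + 1))) = 0 := by linear_combination k0
    simpa [hω1, hω2] using this
  · have : P 1 1 * ((ω - 1) * ((ω - 1) * ω)) = 0 := by linear_combination -k1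
    simpa [hω1, hω0] using this
  · have : P 2 2 * ((ω - 1) * (ω + 1) * ((ω - 1) * ω)) = 0 := by linear_combination k2
    simpa [hω1, hω2, hω0] using this

theorem exists_equivalent_bordered [IsAlgClosed K] [CharZero K]
    {Φ : Fin 4 → Matrix (Fin 3) (Fin 3) K} (hdet : ∀ y, (ev Φ y).det = cub y) (h1 : Φ 0 = 1) :
    ∃ Ψ, Equivalent Φ Ψ ∧ ∀ k, Ψ k 0 0 = 0 := by
  obtain ⟨ω, hω⟩ := exists_sq_add_self_add_one_eq_zero K
  obtain ⟨Ψ, hΦΨ, hΨ, h0, h1⟩ := exists_diagonalization hdet h1 hω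
  have hω3 : ω ^ 3 = 1 := by linear_combination (ω - 1) * hω
  have hP : ∀ i, Ψ 2 i i = 0 := by
    refine diag_eq_zero hω fun a b x => ?_
    have := hΨ ![a, b, x, 0]
    simp only [cub] at this
    rw [det_fin_three] at this ⊢
    simp [ev_apply, h0, h1] at this ⊢
    linear_combination this
  have hR : ∀ i, Ψ 3 i i = 0 := by
    refine diag_eq_zero hω fun a b x => ?_
    have := hΨ ![a, b, 0, x]
    simp only [cub] at this
    rw [det_fin_three] at this ⊢
    simp [ev_apply, h0, h1] at this ⊢
    linear_combination this
  have hF : ∀ a b x y : K, _ := fun a b x y => (det_fin_three (ev Ψ ![a, b, x, y])).symm.trans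
    (hΨ ![a, b, x, y])
  simp [ev_apply, h0, h1, cub, hP, hR] at hF
  -- With zero diagonals in the last two coefficient matrices, `e` and `e'` are the vanishing of the
  -- terms linear in a and in b. Together they make the three products of opposite entries
  -- proportional with ratios powers of ω.
  have e : ∀ x y : K, (x * Ψ 2 0 1 + y * Ψ 3 0 1) * (x * Ψ 2 1 0 + y * Ψ 3 1 0) +
      (x * Ψ 2 0 2 + y * Ψ 3 0 2) * (x * Ψ 2 2 0 + y * Ψ 3 2 0) +
      (x * Ψ 2 1 2 + y * Ψ 3 1 2) * (x * Ψ 2 2 1 + y * Ψ 3 2 1) = 0 := by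
    intro x y
    linear_combination hF 0 0 x y - hF 1 0 x y
  have e' : ∀ x y : K, ω ^ 2 * ((x * Ψ 2 0 1 + y * Ψ 3 0 1) * (x * Ψ 2 1 0 + y * Ψ 3 1 0)) +
      ω * ((x * Ψ 2 0 2 + y * Ψ 3 0 2) * (x * Ψ 2 2 0 + y * Ψ 3 2 0)) +
      (x * Ψ 2 1 2 + y * Ψ 3 1 2) * (x * Ψ 2 2 1 + y * Ψ 3 2 1) = 0 := by
    intro x y
    linear_combination hF 0 0 x y - hF 0 1 x y + hω3
  have hω0 : ω ≠ 0 := by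
    rintro rfl
    norm_num at hω
  have hω1 : ω - 1 ≠ 0 := by
    intro h
    rw [sub_eq_zero] at h
    subst h
    norm_num at hω
  obtain ⟨u, v, hu, hv, huv⟩ := bordered_aux hω (Ψ 2) (Ψ 3) _ rfl
    (fun x y => by
      have : ω * (ω - 1) * ((Ψ 2 0 2 * x + Ψ 3 0 2 * y) * (Ψ 2 2 0 * x + Ψ 3 2 0 * y) -
        ω * ((Ψ 2 1 2 * x + Ψ 3 1 2 * y) * (Ψ 2 2 1 * x + Ψ 3 2 1 * y))) = 0 := by
        linear_combination ω ^ 2 * e x y - e' x y +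
          ((Ψ 2 1 2 * x + Ψ 3 1 2 * y) * (Ψ 2 2 1 * x + Ψ 3 2 1 * y)) * (-hω3)
      exact sub_eq_zero.1 ((mul_eq_zero.1 this).resolve_left (mul_ne_zero hω0 hω1)))
    (fun x y => by
      have : ω * (ω - 1) * ((Ψ 2 0 1 * x + Ψ 3 0 1 * y) * (Ψ 2 1 0 * x + Ψ 3 1 0 * y) -
        ω ^ 2 * ((Ψ 2 1 2 * x + Ψ 3 1 2 * y) * (Ψ 2 2 1 * x + Ψ 3 2 1 * y))) = 0 := by
        linear_combination e' x y - ω * e x y +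
          ((Ψ 2 1 2 * x + Ψ 3 1 2 * y) * (Ψ 2 2 1 * x + Ψ 3 2 1 * y)) * (1 - ω) * hω3
      exact sub_eq_zero.1 ((mul_eq_zero.1 this).resolve_left (mul_ne_zero hω0 hω1)))
  have huv' : ∀ k, u ⬝ᵥ (Ψ k *ᵥ v) = 0 := by
    intro k
    fin_cases k
    · have := huv 1 0 0 0
      simp [h0, dotProduct, Fin.sum_univ_three] at this ⊢
      linear_combination this
    · have := huv 0 1 0 0
      simp [h1, dotProduct, mulVec, Fin.sum_univ_three] at this ⊢
      linear_combination this
    · have := huv 0 0 1 0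
      simp [hP, dotProduct, mulVec, Fin.sum_univ_three] at this ⊢
      linear_combination this
    · have := huv 0 0 0 1
      simp [hR, dotProduct, mulVec, Fin.sum_univ_three] at this ⊢
      linear_combination this
  obtain ⟨Ξ, hΨΞ, hΞ⟩ := exists_equivalent_corner_eq_zero hu hv huv'
  exact ⟨Ξ, hΦΨ.trans hΨΞ, hΞ⟩

end FermatCubic

end

/-! ### The lines on the Fermat cubic surface -/

noncomputable section

namespace FermatCubic

open MvPolynomial Matrix

variable {K : Type*} [Field K]

/-- `W` contains a form `Y_i - p Y_j` with `p³ = -1`. -/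
def Joins (W : Submodule K (Fin 4 → K)) (i j : Fin 4) : Prop :=
  ∃ p : K, p ^ 3 = -1 ∧ (Pi.single i 1 - p • Pi.single j 1 : Fin 4 → K) ∈ W

theorem Joins.symm {W : Submodule K (Fin 4 → K)} {i j : Fin 4} (h : Joins W i j) :
    Joins W j i := by
  obtain ⟨p, hp, h⟩ := h
  have hp0 := ne_zero_of_cube_eq_neg_one hp
  refine ⟨p⁻¹, by rw [inv_pow, hp]; norm_num, ?_⟩
  convert W.smul_mem (-p⁻¹) h using 1
  rw [smul_sub, smul_smul, neg_mul, inv_mul_cancel₀ hp0]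
  simp [sub_eq_add_neg, add_comm]

theorem Joins.of_comp {a b : Fin 4 → K} (σ : Equiv.Perm (Fin 4)) {i j : Fin 4}
    (h : Joins (Submodule.span K {a ∘ σ, b ∘ σ}) i j) :
    Joins (Submodule.span K {a, b}) (σ i) (σ j) := by
  obtain ⟨p, hp, h⟩ := h
  refine ⟨p, hp, ?_⟩
  rw [Submodule.mem_span_pair] at h ⊢
  obtain ⟨x, y, h⟩ := h
  refine ⟨x, y, ?_⟩
  ext k
  have := congrFun h (σ.symm k)
  simpa [Pi.single_apply, Equiv.symm_apply_eq] using this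

/-- The first two coordinates on the line are linear forms Px + Qy and Rx + Ty in the last two, and
the sum of their cubes is -x³ - y³. The vanishing mixed terms force PQ = RT = 0, so each form is a
single variable times a cube root of -1. -/
theorem joins_of_pivot [CharZero K] {a b : Fin 4 → K} (hΔ : a 0 * b 1 - a 1 * b 0 ≠ 0)
    (h : ∀ y : Fin 4 → K, a ⬝ᵥ y = 0 → b ⬝ᵥ y = 0 → cub y = 0) :
    Joins (Submodule.span K {a, b}) 0 3 ∧ Joins (Submodule.span K {a, b}) 1 2 ∨
      Joins (Submodule.span K {a, b}) 0 2 ∧ Joins (Submodule.span K {a, b}) 1 3 := by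
  set Δ := a 0 * b 1 - a 1 * b 0 with hΔ'
  obtain ⟨P, hP⟩ : ∃ P, P = (a 1 * b 2 - b 1 * a 2) / Δ := ⟨_, rfl⟩
  obtain ⟨Q, hQ⟩ : ∃ Q, Q = (a 1 * b 3 - b 1 * a 3) / Δ := ⟨_, rfl⟩
  obtain ⟨R, hR⟩ : ∃ R, R = (b 0 * a 2 - a 0 * b 2) / Δ := ⟨_, rfl⟩
  obtain ⟨T, hT⟩ : ∃ T, T = (b 0 * a 3 - a 0 * b 3) / Δ := ⟨_, rfl⟩
  rw [eq_div_iff hΔ] at hP hQ hR hT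
  have key : ∀ x y : K, (P * x + Q * y) ^ 3 + (R * x + T * y) ^ 3 + x ^ 3 + y ^ 3 = 0 := by
    intro x y
    have := h ![P * x + Q * y, R * x + T * y, x, y] ?_ ?_
    · simpa [cub] using this
    · refine (mul_eq_zero.1 (?_ : Δ * _ = 0)).resolve_left hΔ
      simp [dotProduct, Fin.sum_univ_four, -mul_eq_zero]
      linear_combination a 0 * x * hP + a 0 * y * hQ + a 1 * x * hR + a 1 * y * hT +
        (a 2 * x + a 3 * y) * hΔ'
    · refine (mul_eq_zero.1 (?_ : Δ * _ = 0)).resolve_left hΔ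
      simp [dotProduct, Fin.sum_univ_four, -mul_eq_zero]
      linear_combination b 0 * x * hP + b 0 * y * hQ + b 1 * x * hR + b 1 * y * hT +
        (b 2 * x + b 3 * y) * hΔ'
  have m0 : (fun i => (b 1 * a i - a 1 * b i) / Δ) ∈ Submodule.span K {a, b} :=
    Submodule.mem_span_pair.2 ⟨b 1 / Δ, -a 1 / Δ, by ext i; simp; ring⟩
  have m1 : (fun i => (a 0 * b i - b 0 * a i) / Δ) ∈ Submodule.span K {a, b} :=
    Submodule.mem_span_pair.2 ⟨-b 0 / Δ, a 0 / Δ, by ext i; simp; ring⟩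
  have k1 := key 1 0
  have k2 := key 0 1
  have k3 := key 1 1
  have k4 := key 1 (-1)
  have e1 : P ^ 2 * Q + R ^ 2 * T = 0 := by
    linear_combination (k3 - k4) / 6 - k2 / 3
  have e2 : P * Q ^ 2 + R * T ^ 2 = 0 := by
    linear_combination (k3 + k4) / 6 - k1 / 3
  have e3 : P ^ 3 + R ^ 3 = -1 := by linear_combination k1
  have e4 : Q ^ 3 + T ^ 3 = -1 := by linear_combination k2
  -- Proportional forms would give a multiple of a single cube, which is not -(x³ + y³).
  have hne : P * T - Q * R ≠ 0 := by
    intro h0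
    have hQ0 : Q = 0 := by linear_combination Q * e3 - P * e1 + R ^ 2 * h0
    have hT0 : T = 0 := by linear_combination T * e3 - R * e1 - P ^ 2 * h0
    rw [hQ0, hT0] at e4
    norm_num at e4
  have hPQ : P * Q = 0 := (mul_eq_zero.1 (by linear_combination T * e1 - R * e2 :
    (P * Q) * (P * T - Q * R) = 0)).resolve_right hne
  have hRT : R * T = 0 := (mul_eq_zero.1 (by linear_combination P * e2 - Q * e1 :
    (R * T) * (P * T - Q * R) = 0)).resolve_right hne
  have hv0 : ∀ i, (b 1 * a i - a 1 * b i) / Δ = ![1, 0, -P, -Q] i := by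
    intro i
    rw [div_eq_iff hΔ]
    fin_cases i <;> simp
    · rw [hΔ']; ring
    · ring
    · linear_combination hP
    · linear_combination hQ
  have hv1 : ∀ i, (a 0 * b i - b 0 * a i) / Δ = ![0, 1, -R, -T] i := by
    intro i
    rw [div_eq_iff hΔ]
    fin_cases i <;> simp
    · ring
    · rw [hΔ']; ring
    · linear_combination hR
    · linear_combination hT
  simp only [hv0] at m0
  simp only [hv1] at m1
  rcases mul_eq_zero.1 hPQ with hP0 | hQ0
  · left
    have hR3 : R ^ 3 = -1 := by rw [hP0] at e3; simpa using e3
    have hT0 := (mul_eq_zero.1 hRT).resolve_left (ne_zero_of_cube_eq_neg_one hR3)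
    have hQ3 : Q ^ 3 = -1 := by rw [hT0] at e4; simpa using e4
    refine ⟨⟨Q, hQ3, ?_⟩, ⟨R, hR3, ?_⟩⟩
    · convert m0 using 1
      ext i; fin_cases i <;> simp [hP0]
    · convert m1 using 1
      ext i; fin_cases i <;> simp [hT0]
  · right
    have hT3 : T ^ 3 = -1 := by rw [hQ0] at e4; simpa using e4
    have hR0 := (mul_eq_zero.1 hRT).resolve_right (ne_zero_of_cube_eq_neg_one hT3)
    have hP3 : P ^ 3 = -1 := by rw [hR0] at e3; simpa using e3
    refine ⟨⟨P, hP3, ?_⟩, ⟨T, hT3, ?_⟩⟩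
    · convert m0 using 1
      ext i; fin_cases i <;> simp [hQ0]
    · convert m1 using 1
      ext i; fin_cases i <;> simp [hR0]

theorem joins_of_pivot_perm [CharZero K] {a b : Fin 4 → K}
    (h : ∀ y : Fin 4 → K, a ⬝ᵥ y = 0 → b ⬝ᵥ y = 0 → cub y = 0) (σ : Equiv.Perm (Fin 4))
    (hΔ : a (σ 0) * b (σ 1) - a (σ 1) * b (σ 0) ≠ 0) :
    Joins (Submodule.span K {a, b}) (σ 0) (σ 3) ∧ Joins (Submodule.span K {a, b}) (σ 1) (σ 2) ∨
      Joins (Submodule.span K {a, b}) (σ 0) (σ 2) ∧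
        Joins (Submodule.span K {a, b}) (σ 1) (σ 3) := by
  have hdot : ∀ c y : Fin 4 → K, c ⬝ᵥ (y ∘ σ.symm) = (c ∘ σ) ⬝ᵥ y := by
    intro c y
    rw [dotProduct, dotProduct, ← Equiv.sum_comp σ]
    simp
  have hcub : ∀ y : Fin 4 → K, cub y = ∑ i, y i ^ 3 := fun y => by
    rw [Fin.sum_univ_four]; rfl
  refine (joins_of_pivot (a := a ∘ σ) (b := b ∘ σ) hΔ fun y h1 h2 => ?_).imp
    (And.imp (Joins.of_comp σ) (Joins.of_comp σ)) (And.imp (Joins.of_comp σ) (Joins.of_comp σ))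
  have := h (y ∘ σ.symm) (by rw [hdot, h1]) (by rw [hdot, h2])
  rw [hcub] at this ⊢
  rw [← this, ← Equiv.sum_comp σ fun i => (y ∘ σ.symm) i ^ 3]
  simp

/-- The lines on the Fermat cubic surface. -/
theorem joins_of_line [CharZero K] {a b : Fin 4 → K}
    (h : ∀ y : Fin 4 → K, a ⬝ᵥ y = 0 → b ⬝ᵥ y = 0 → cub y = 0)
    (hab : ∃ i j, a i * b j - a j * b i ≠ 0) :
    Joins (Submodule.span K {a, b}) 0 1 ∧ Joins (Submodule.span K {a, b}) 2 3 ∨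
    Joins (Submodule.span K {a, b}) 0 2 ∧ Joins (Submodule.span K {a, b}) 1 3 ∨
    Joins (Submodule.span K {a, b}) 0 3 ∧ Joins (Submodule.span K {a, b}) 1 2 := by
  -- A nonzero minor at columns i, j allows solving for those variables, which leaves the two
  -- pairings that do not match i with j. All six minors are tried because only some minor is known
  -- to be nonzero.
  have key : ∀ i j k l : Fin 4, (∃ σ : Equiv.Perm (Fin 4), σ 0 = i ∧ σ 1 = j ∧ σ 2 = k ∧ σ 3 = l) →
      a i * b j - a j * b i ≠ 0 →
      Joins (Submodule.span K {a, b}) i l ∧ Joins (Submodule.span K {a, b}) j k ∨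
      Joins (Submodule.span K {a, b}) i k ∧ Joins (Submodule.span K {a, b}) j l := by
    rintro i j k l ⟨σ, rfl, rfl, rfl, rfl⟩ hΔ
    exact joins_of_pivot_perm h σ hΔ
  have h01 := key 0 1 2 3 ⟨1, by decide⟩
  have h02 := key 0 2 1 3 ⟨Equiv.swap 1 2, by decide⟩
  have h03 := key 0 3 2 1 ⟨Equiv.swap 1 3, by decide⟩
  have h21 := key 2 1 0 3 ⟨Equiv.swap 0 2, by decide⟩
  have h31 := key 3 1 2 0 ⟨Equiv.swap 0 3, by decide⟩
  have h23 := key 2 3 0 1 ⟨Equiv.swap 0 2 * Equiv.swap 1 3, by decide⟩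
  have s : ∀ i j, Joins (Submodule.span K {a, b}) i j ↔ Joins (Submodule.span K {a, b}) j i :=
    fun i j => ⟨Joins.symm, Joins.symm⟩
  simp only [s 1 0, s 2 0, s 2 1, s 3 0, s 3 1, s 3 2] at h02 h03 h21 h31 h23
  by_contra hcon
  have z01 : a 0 * b 1 - a 1 * b 0 = 0 := by
    by_contra hh; exact hcon ((h01 hh).elim (fun h => .inr (.inr h)) (fun h => .inr (.inl h)))
  have z02 : a 0 * b 2 - a 2 * b 0 = 0 := by
    by_contra hh; exact hcon ((h02 hh).elim (fun h => .inr (.inr h)) (fun h => .inl h))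
  have z03 : a 0 * b 3 - a 3 * b 0 = 0 := by
    by_contra hh; exact hcon ((h03 hh).elim (fun h => .inl h) (fun h => .inr (.inl h)))
  have z21 : a 2 * b 1 - a 1 * b 2 = 0 := by
    by_contra hh; exact hcon ((h21 hh).elim (fun h => .inl h.symm) (fun h => .inr (.inl h)))
  have z31 : a 3 * b 1 - a 1 * b 3 = 0 := by
    by_contra hh; exact hcon ((h31 hh).elim (fun h => .inr (.inr h)) (fun h => .inl h.symm))
  have z23 : a 2 * b 3 - a 3 * b 2 = 0 := by
    by_contra hh; exact hcon ((h23 hh).elim (fun h => .inr (.inr h.symm)) (fun h => .inr (.inl h)))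
  obtain ⟨i, j, hij⟩ := hab
  apply hij
  fin_cases i <;> fin_cases j <;> simp <;>
    first
    | ring1
    | linear_combination z01
    | linear_combination -z01
    | linear_combination z02
    | linear_combination -z02
    | linear_combination z03
    | linear_combination -z03
    | linear_combination z21
    | linear_combination -z21
    | linear_combination z31
    | linear_combination -z31
    | linear_combination z23
    | linear_combination -z23

end FermatCubic

end

/-! ### From linear determinantal representations to the listed matrices -/

noncomputable section

namespace FermatCubic

open MvPolynomial Matrix

variable {K : Type*} [Field K]

/-- The partner of `Y₁` in the `τ`-th pairing of the variables. -/
def partner : Fin 3 → Fin 4 := ![1, 2, 3]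

/-- The first variable of the second pair in the `τ`-th pairing of the variables. -/
def secondFst : Fin 3 → Fin 4 := ![2, 1, 1]

/-- The second variable of the second pair in the `τ`-th pairing of the variables. -/
def secondSnd : Fin 3 → Fin 4 := ![3, 3, 2]

/-- The coefficients of `Y_i - p Y_j`. -/
def diff (i j : Fin 4) (p : K) : Fin 4 → K := Pi.single i 1 - p • Pi.single j 1

/-- The two binomials involve disjoint pairs of variables, so they are independent, and the change
of basis leading to them is invertible. -/
theorem det_ne_zero_of_diff {a b : Fin 4 → K} {τ : Fin 3} {p q x y z w : K}
    (h1 : x • a + y • b = diff 0 (partner τ) p)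
    (h2 : z • a + w • b = diff (secondFst τ) (secondSnd τ) q) : x * w - y * z ≠ 0 := by
  intro h0
  have e1 : w • diff 0 (partner τ) p - y • diff (secondFst τ) (secondSnd τ) q = 0 := by
    rw [← h1, ← h2]
    ext i
    simp
    linear_combination a i * h0
  have e2 : x • diff (secondFst τ) (secondSnd τ) q - z • diff 0 (partner τ) p = 0 := by
    rw [← h1, ← h2]
    ext i
    simp
    linear_combination b i * h0
  have hw : w = 0 := by
    have := congrFun e1 0
    fin_cases τ <;> simpa [diff, partner, secondFst, secondSnd] using this
  have hx : x = 0 := by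
    have := congrFun e2 (secondFst τ)
    fin_cases τ <;> simpa [diff, partner, secondFst, secondSnd] using this
  have hy : y = 0 := by
    have := congrFun e1 (secondFst τ)
    rw [hw] at this
    fin_cases τ <;> simpa [diff, partner, secondFst, secondSnd] using this
  have := congrFun h1 0
  rw [hx, hy] at this
  fin_cases τ <;> simp [diff, partner] at this

theorem exists_diff_of_line [CharZero K] {a b : Fin 4 → K}
    (h : ∀ y : Fin 4 → K, a ⬝ᵥ y = 0 → b ⬝ᵥ y = 0 → cub y = 0)
    (hab : ∃ i j, a i * b j - a j * b i ≠ 0) :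
    ∃ (τ : Fin 3) (p q x y z w : K), p ^ 3 = -1 ∧ q ^ 3 = -1 ∧ x * w - y * z ≠ 0 ∧
      x • a + y • b = diff 0 (partner τ) p ∧
      z • a + w • b = diff (secondFst τ) (secondSnd τ) q := by
  suffices ∃ τ : Fin 3, Joins (Submodule.span K {a, b}) 0 (partner τ) ∧
      Joins (Submodule.span K {a, b}) (secondFst τ) (secondSnd τ) by
    obtain ⟨τ, ⟨p, hp, h1⟩, ⟨q, hq, h2⟩⟩ := this
    obtain ⟨x, y, h1⟩ := Submodule.mem_span_pair.1 h1
    obtain ⟨z, w, h2⟩ := Submodule.mem_span_pair.1 h2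
    exact ⟨τ, p, q, x, y, z, w, hp, hq, det_ne_zero_of_diff h1 h2, h1, h2⟩
  rcases joins_of_line h hab with h | h | h
  · exact ⟨0, h⟩
  · exact ⟨1, h⟩
  · exact ⟨2, h⟩

theorem lin_diff (i j : Fin 4) (p : K) : lin (diff i j p) = X i - C p * X j :=
  (X_sub_C_mul_X_eq_lin i j p).symm

theorem exists_minor_ne_zero_of_rows {a b c d : Fin 4 → K} (h : (Matrix.of ![a, b, c, d]).det ≠ 0) :
    ∃ i j, a i * b j - a j * b i ≠ 0 := by
  by_contra! hcon
  apply h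
  have z := fun i j => hcon i j
  rw [Matrix.det_succ_row_zero]
  simp [Fin.sum_univ_succ, Matrix.det_fin_three, Fin.succAbove]
  linear_combination (c 2 * d 3 - c 3 * d 2) * z 0 1 - (c 1 * d 3 - c 3 * d 1) * z 0 2 +
    (c 1 * d 2 - c 2 * d 1) * z 0 3 + (c 0 * d 3 - c 3 * d 0) * z 1 2 -
    (c 0 * d 2 - c 2 * d 0) * z 1 3 + (c 0 * d 1 - c 1 * d 0) * z 2 3

theorem isHomogeneous_of_entries {a b c d e g h k l : S K} (ha : a.IsHomogeneous 1)
    (hb : b.IsHomogeneous 1) (hc : c.IsHomogeneous 1) (hd : d.IsHomogeneous 1)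
    (he : e.IsHomogeneous 1) (hg : g.IsHomogeneous 1) (hh : h.IsHomogeneous 1)
    (hk : k.IsHomogeneous 1) (hl : l.IsHomogeneous 1) (i j : Fin 3) :
    ((!![a, b, c; d, e, g; h, k, l] : Matrix (Fin 3) (Fin 3) (S K)) i j).IsHomogeneous 1 := by
  fin_cases i <;> fin_cases j <;> assumption

theorem listed_isHomogeneous {φ : Matrix (Fin 3) (Fin 3) (S K)} (h : Listed φ) (i j : Fin 3) :
    (φ i j).IsHomogeneous 1 := by
  have hX : ∀ k : Fin 4, (X k : S K).IsHomogeneous 1 := isHomogeneous_X K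
  have hCX : ∀ (a : K) (k : Fin 4), (C a * X k : S K).IsHomogeneous 1 := fun a k =>
    isHomogeneous_C_mul_X a k
  have hNX : ∀ (a : K) (k : Fin 4), (-C a * X k : S K).IsHomogeneous 1 := fun a k => by
    rw [neg_mul]; exact (hCX a k).neg
  have h0 : (0 : S K).IsHomogeneous 1 := isHomogeneous_zero _ _ _
  obtain ⟨a, b, c, d, ha, hb, hc, hd, h⟩ := h
  have hA : ∀ ε i j, (matA a b c d ε i j).IsHomogeneous 1 := fun ε =>
    isHomogeneous_of_entries h0 ((hX 0).sub (hCX a 3)) ((hX 1).sub (hCX b 2))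
      ((hX 0).sub (hCX c 1)) ((hNX _ _).sub (hCX _ _)) ((hCX _ _).sub (hCX _ _))
      ((hX _).sub (hCX _ _)) (((hCX _ _).add (hCX _ _)).add (hCX _ _))
      (((hX _).neg.sub (hCX _ _)).sub (hCX _ _))
  have hB : ∀ ε i j, (matB a b c d ε i j).IsHomogeneous 1 := fun ε =>
    isHomogeneous_of_entries h0 ((hX _).sub (hCX _ _)) ((hX _).sub (hCX _ _))
      ((hX _).sub (hCX _ _)) ((hCX _ _).add (hCX _ _)) ((hCX _ _).sub (hCX _ _))
      ((hX _).sub (hCX _ _)) (((hCX _ _).add (hCX _ _)).add (hCX _ _))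
      (((hX _).neg.sub (hCX _ _)).sub (hCX _ _))
  have hC : ∀ ε i j, (matC a b c d ε i j).IsHomogeneous 1 := fun ε =>
    isHomogeneous_of_entries h0 ((hX _).sub (hCX _ _)) ((hX _).sub (hCX _ _))
      ((hX _).sub (hCX _ _)) (((hX _).neg.sub (hCX _ _)).sub (hCX _ _))
      ((hNX _ _).add (hCX _ _)) ((hX _).sub (hCX _ _)) ((hCX _ _).sub (hCX _ _))
      (((hX _).neg.sub (hCX _ _)).sub (hCX _ _))
  rcases h with ⟨ε, h1, h2, ⟨h, rfl | rfl⟩ | ⟨h, rfl | rfl⟩ | ⟨h, rfl | rfl⟩⟩ |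
    ⟨h1, h2, rfl | rfl | rfl⟩
  · exact hA ε i j
  · exact hA ε j i
  · exact hB ε i j
  · exact hB ε j i
  · exact hC ε i j
  · exact hC ε j i
  all_goals
    exact isHomogeneous_of_entries h0 ((hX _).sub (hCX _ _)) ((hX _).sub (hCX _ _))
      ((hX _).sub (hCX _ _)) ((hX _).neg.sub (hCX _ _)) h0 ((hX _).sub (hCX _ _)) h0
      ((hX _).neg.sub (hCX _ _)) i j

theorem eq_lin_of_isHomogeneous {p : S K} (h : p.IsHomogeneous 1) :
    p = lin fun k => eval (Pi.single k 1) p := by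
  have : p ∈ Submodule.span K (Set.range (X : Fin 4 → S K)) := by
    rw [← homogeneousSubmodule_one_eq_span_X]
    exact h
  obtain ⟨c, rfl⟩ := (Submodule.mem_span_range_iff_exists_fun K).1 this
  have : (fun k => eval (Pi.single k 1) (∑ i, c i • X i : S K)) = c := by
    ext k
    simp [MvPolynomial.smul_eq_C_mul, Pi.single_apply]
  rw [this]
  rfl

-- Equal pairings for row and column give D, E, F. Distinct pairings give A, B, C or, with row and
-- column exchanged, their transposes. Independence supplies the parameter condition, with ε the
-- ratio of two elements having equal cubes.
set_option linter.unusedSimpArgs false in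
theorem exists_listed_of_border {τ τ' : Fin 3} {p q p' q' : K} (hp : p ^ 3 = -1)
    (hq : q ^ 3 = -1) (hp' : p' ^ 3 = -1) (hq' : q' ^ 3 = -1)
    (h : LinearIndependent K ![(X 0 - C p * X (partner τ) : S K),
      X (secondFst τ) - C q * X (secondSnd τ), X 0 - C p' * X (partner τ'),
      X (secondFst τ') - C q' * X (secondSnd τ')]) :
    ∃ φ : Matrix (Fin 3) (Fin 3) (S K), Listed φ ∧ φ 0 0 = 0 ∧
      φ 0 1 = X 0 - C p * X (partner τ) ∧ φ 0 2 = X (secondFst τ) - C q * X (secondSnd τ) ∧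
      φ 1 0 = X 0 - C p' * X (partner τ') ∧
      φ 2 0 = X (secondFst τ') - C q' * X (secondSnd τ') := by
  have np := ne_zero_of_cube_eq_neg_one hp
  have nq := ne_zero_of_cube_eq_neg_one hq
  have np' := ne_zero_of_cube_eq_neg_one hp'
  have nq' := ne_zero_of_cube_eq_neg_one hq'
  fin_cases τ <;> fin_cases τ'
  · obtain ⟨h1, h2⟩ := linearIndependent_border_matD.1 h
    exact ⟨_, ⟨p, q, p', q', hp, hq, hp', hq', .inr ⟨h1, h2, .inl rfl⟩⟩, rfl, rfl, rfl, rfl, rfl⟩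
  -- The border does not involve ε, so 0 serves as a dummy value until the actual ε is found from
  -- the independence. The same holds in the later cases.
  · have h1 := (linearIndependent_border_matB_transpose (a := p') (b := q') (c := p) (d := q) 0).1 h
    obtain ⟨ε, e1, e2, e3⟩ := (ne_iff_exists_root_of_unity
      (by simp only [mul_pow, hp, hq, hp', hq']) (by simp only [ne_eq, mul_eq_zero, np, nq, np', nq', or_self, not_false_eq_true])).1 h1
    exact ⟨_, ⟨p', q', p, q, hp', hq', hp, hq, .inl ⟨ε, e1, e2, .inr (.inl ⟨e3, .inr rfl⟩)⟩⟩,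
      rfl, rfl, rfl, rfl, rfl⟩
  · have h1 := (linearIndependent_border_matA_transpose (a := p') (b := q') (c := p) (d := q) 0).1 h
    obtain ⟨ε, e1, e2, e3⟩ := (ne_iff_exists_root_of_unity
      (by simp only [mul_pow, hp, hq, hp', hq']; ring) (by simp only [ne_eq, mul_eq_zero, np, nq, np', nq', or_self, not_false_eq_true])).1 h1
    exact ⟨_, ⟨p', q', p, q, hp', hq', hp, hq, .inl ⟨ε, e1, e2, .inl ⟨e3, .inr rfl⟩⟩⟩,
      rfl, rfl, rfl, rfl, rfl⟩
  · have h1 := (linearIndependent_border_matB (a := p) (b := q) (c := p') (d := q') 0).1 h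
    obtain ⟨ε, e1, e2, e3⟩ := (ne_iff_exists_root_of_unity
      (by simp only [mul_pow, hp, hq, hp', hq']) (by simp only [ne_eq, mul_eq_zero, np, nq, np', nq', or_self, not_false_eq_true])).1 h1
    exact ⟨_, ⟨p, q, p', q', hp, hq, hp', hq', .inl ⟨ε, e1, e2, .inr (.inl ⟨e3, .inl rfl⟩)⟩⟩,
      rfl, rfl, rfl, rfl, rfl⟩
  · obtain ⟨h1, h2⟩ := linearIndependent_border_matE.1 h
    exact ⟨_, ⟨p, q, p', q', hp, hq, hp', hq', .inr ⟨h1, h2, .inr (.inl rfl)⟩⟩,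
      rfl, rfl, rfl, rfl, rfl⟩
  · have h1 := (linearIndependent_border_matC_transpose (a := p') (b := q') (c := p) (d := q) 0).1 h
    obtain ⟨ε, e1, e2, e3⟩ := (ne_iff_exists_root_of_unity
      (by simp only [mul_pow, hp, hq, hp', hq']) (by simp only [ne_eq, mul_eq_zero, np, nq, np', nq', or_self, not_false_eq_true])).1 h1
    exact ⟨_, ⟨p', q', p, q, hp', hq', hp, hq, .inl ⟨ε, e1, e2, .inr (.inr ⟨e3, .inr rfl⟩)⟩⟩,
      rfl, rfl, rfl, rfl, rfl⟩
  · have h1 := (linearIndependent_border_matA (a := p) (b := q) (c := p') (d := q') 0).1 h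
    obtain ⟨ε, e1, e2, e3⟩ := (ne_iff_exists_root_of_unity
      (by simp only [mul_pow, hp, hq, hp', hq']; ring) (by simp only [ne_eq, mul_eq_zero, np, nq, np', nq', or_self, not_false_eq_true])).1 h1
    exact ⟨_, ⟨p, q, p', q', hp, hq, hp', hq', .inl ⟨ε, e1, e2, .inl ⟨e3, .inl rfl⟩⟩⟩,
      rfl, rfl, rfl, rfl, rfl⟩
  · have h1 := (linearIndependent_border_matC (a := p) (b := q) (c := p') (d := q') 0).1 h
    obtain ⟨ε, e1, e2, e3⟩ := (ne_iff_exists_root_of_unity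
      (by simp only [mul_pow, hp, hq, hp', hq']) (by simp only [ne_eq, mul_eq_zero, np, nq, np', nq', or_self, not_false_eq_true])).1 h1
    exact ⟨_, ⟨p, q, p', q', hp, hq, hp', hq', .inl ⟨ε, e1, e2, .inr (.inr ⟨e3, .inl rfl⟩)⟩⟩,
      rfl, rfl, rfl, rfl, rfl⟩
  · obtain ⟨h1, h2⟩ := linearIndependent_border_matF.1 h
    exact ⟨_, ⟨p, q, p', q', hp, hq, hp', hq', .inr ⟨h1, h2, .inr (.inr rfl)⟩⟩,
      rfl, rfl, rfl, rfl, rfl⟩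

/-- The matrix of coefficients of a matrix of linear forms. -/
def coeffs (φ : Matrix (Fin 3) (Fin 3) (S K)) (k : Fin 4) : Matrix (Fin 3) (Fin 3) K :=
  φ.map (eval (Pi.single k 1))

theorem ev_coeffs {φ : Matrix (Fin 3) (Fin 3) (S K)} (h : ∀ i j, (φ i j).IsHomogeneous 1)
    (y : Fin 4 → K) : ev (coeffs φ) y = φ.map (eval y) := by
  ext i j
  rw [ev_apply, map_apply]
  conv_rhs => rw [eq_lin_of_isHomogeneous (h i j), eval_lin]
  simp [coeffs, mul_comm]

/-- Every linear determinantal representation of the Fermat cubic is equivalent to a listed one. -/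
theorem exists_listed_equivalent [IsAlgClosed K] [CharZero K]
    {Φ : Fin 4 → Matrix (Fin 3) (Fin 3) K} (hdet : ∀ y, (ev Φ y).det = cub y) (h1 : Φ 0 = 1) :
    ∃ (τ τ' : Fin 3) (p q p' q' : K) (φ : Matrix (Fin 3) (Fin 3) (S K)),
      p ^ 3 = -1 ∧ q ^ 3 = -1 ∧ p' ^ 3 = -1 ∧ q' ^ 3 = -1 ∧ Listed φ ∧ φ 0 0 = 0 ∧
      φ 0 1 = X 0 - C p * X (partner τ) ∧ φ 0 2 = X (secondFst τ) - C q * X (secondSnd τ) ∧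
      φ 1 0 = X 0 - C p' * X (partner τ') ∧
      φ 2 0 = X (secondFst τ') - C q' * X (secondSnd τ') ∧
      LinearIndependent K (border φ) ∧ Equivalent Φ (coeffs φ) := by
  obtain ⟨Ψ, hΦΨ, h0⟩ := exists_equivalent_bordered hdet h1
  have hcd : HasCubicDet Φ := ⟨1, one_ne_zero, fun y => by rw [hdet, one_mul]⟩
  have hΨ := hcd.of_equivalent hΦΨ
  have hB := det_borderCoeff_ne_zero hΨ h0
  obtain ⟨c, hc, hΨdet⟩ := hΨ
  -- Where both forms vanish the first row is zero, so the line they cut out lies on the surface.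
  have hrow : ∀ y : Fin 4 → K, (fun k => Ψ k 0 1) ⬝ᵥ y = 0 → (fun k => Ψ k 0 2) ⬝ᵥ y = 0 →
      cub y = 0 := by
    intro y e1 e2
    have d := hΨdet y
    have f0 : ev Ψ y 0 0 = 0 := by simp [ev_apply, h0]
    have f1 : ev Ψ y 0 1 = 0 := by
      rw [ev_apply, ← e1]; simp [dotProduct, Fin.sum_univ_four, mul_comm]
    have f2 : ev Ψ y 0 2 = 0 := by
      rw [ev_apply, ← e2]; simp [dotProduct, Fin.sum_univ_four, mul_comm]
    rw [det_fin_three, f0, f1, f2] at d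
    simpa [hc] using d
  have hcol : ∀ y : Fin 4 → K, (fun k => Ψ k 1 0) ⬝ᵥ y = 0 → (fun k => Ψ k 2 0) ⬝ᵥ y = 0 →
      cub y = 0 := by
    intro y e1 e2
    have d := hΨdet y
    have f0 : ev Ψ y 0 0 = 0 := by simp [ev_apply, h0]
    have f1 : ev Ψ y 1 0 = 0 := by
      rw [ev_apply, ← e1]; simp [dotProduct, Fin.sum_univ_four, mul_comm]
    have f2 : ev Ψ y 2 0 = 0 := by
      rw [ev_apply, ← e2]; simp [dotProduct, Fin.sum_univ_four, mul_comm]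
    rw [det_fin_three, f0, f1, f2] at d
    simpa [hc] using d
  have hB' : (Matrix.of ![fun k => Ψ k 1 0, fun k => Ψ k 2 0, fun k => Ψ k 0 1,
      fun k => Ψ k 0 2]).det ≠ 0 := by
    rw [← linearIndependent_lin_iff]
    have := (linearIndependent_lin_iff _ _ _ _).2 hB
    have := this.comp ![2, 3, 0, 1] (by decide)
    convert this using 1
    ext i : 1
    fin_cases i <;> rfl
  obtain ⟨τ, p, q, x, y, z, w, hp, hq, hg, e1, e2⟩ :=
    exists_diff_of_line hrow (exists_minor_ne_zero_of_rows hB)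
  obtain ⟨τ', p', q', x', y', z', w', hp', hq', hg', e1', e2'⟩ :=
    exists_diff_of_line hcol (exists_minor_ne_zero_of_rows hB')
  set U : Matrix (Fin 3) (Fin 3) K := !![1, 0, 0; 0, x', y'; 0, z', w'] with hU
  set V : Matrix (Fin 3) (Fin 3) K := !![1, 0, 0; 0, x, z; 0, y, w] with hV
  have hΨΞ : Equivalent Ψ fun k => U * Ψ k * V := by
    refine ⟨U, V, ?_, ?_, fun k => rfl⟩
    · simpa [hU, det_fin_three] using hg'
    · rw [show V.det = x * w - y * z by simp [hV, det_fin_three, mul_comm]]; exact hg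
  set Ξ : Fin 4 → Matrix (Fin 3) (Fin 3) K := fun k => U * Ψ k * V with hΞ
  have x00 : ∀ k, Ξ k 0 0 = 0 := fun k => by
    simp [hΞ, hU, hV, Matrix.mul_apply, vecMul, dotProduct, Fin.sum_univ_three, h0]
  have x01 : ∀ k, Ξ k 0 1 = diff 0 (partner τ) p k := fun k => by
    rw [← e1]
    simp [hΞ, hU, hV, Matrix.mul_apply, vecMul, dotProduct, Fin.sum_univ_three, mul_comm]
  have x02 : ∀ k, Ξ k 0 2 = diff (secondFst τ) (secondSnd τ) q k := fun k => by
    rw [← e2]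
    simp [hΞ, hU, hV, Matrix.mul_apply, vecMul, dotProduct, Fin.sum_univ_three, mul_comm]
  have x10 : ∀ k, Ξ k 1 0 = diff 0 (partner τ') p' k := fun k => by
    rw [← e1']
    simp [hΞ, hU, hV, Matrix.mul_apply, vecMul, dotProduct, Fin.sum_univ_three]
  have x20 : ∀ k, Ξ k 2 0 = diff (secondFst τ') (secondSnd τ') q' k := fun k => by
    rw [← e2']
    simp [hΞ, hU, hV, Matrix.mul_apply, vecMul, dotProduct, Fin.sum_univ_three]
  have hcdΞ : HasCubicDet Ξ := (hcd.of_equivalent hΦΨ).of_equivalent hΨΞ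
  have hBΞ := det_borderCoeff_ne_zero hcdΞ x00
  obtain ⟨e, he, hΞdet⟩ := hcdΞ
  -- With zero corner the determinant is linear in the lower block, so this scaling turns e times
  -- the Fermat cubic into the cubic itself and keeps the border.
  have hΞΩ := equivalent_smul_block Ξ x00 (inv_ne_zero he)
  set Ω : Fin 4 → Matrix (Fin 3) (Fin 3) K := fun k =>
    !![0, Ξ k 0 1, Ξ k 0 2; Ξ k 1 0, e⁻¹ * Ξ k 1 1, e⁻¹ * Ξ k 1 2;
      Ξ k 2 0, e⁻¹ * Ξ k 2 1, e⁻¹ * Ξ k 2 2] with hΩ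
  have hΩdet : ∀ y, (ev Ω y).det = cub y := by
    intro y
    have h2 := hΞdet y
    have f0 : ev Ξ y 0 0 = 0 := by simp [ev_apply, x00]
    have g0 : ev Ω y 0 0 = 0 := by simp [ev_apply, hΩ]
    have g1 : ev Ω y 0 1 = ev Ξ y 0 1 := by simp [ev_apply, hΩ]
    have g2 : ev Ω y 0 2 = ev Ξ y 0 2 := by simp [ev_apply, hΩ]
    have g3 : ev Ω y 1 0 = ev Ξ y 1 0 := by simp [ev_apply, hΩ]
    have g4 : ev Ω y 2 0 = ev Ξ y 2 0 := by simp [ev_apply, hΩ]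
    have g5 : ev Ω y 1 1 = e⁻¹ * ev Ξ y 1 1 := by simp [ev_apply, hΩ]; ring
    have g6 : ev Ω y 1 2 = e⁻¹ * ev Ξ y 1 2 := by simp [ev_apply, hΩ]; ring
    have g7 : ev Ω y 2 1 = e⁻¹ * ev Ξ y 2 1 := by simp [ev_apply, hΩ]; ring
    have g8 : ev Ω y 2 2 = e⁻¹ * ev Ξ y 2 2 := by simp [ev_apply, hΩ]; ring
    rw [det_fin_three, f0] at h2
    rw [det_fin_three, g0, g1, g2, g3, g4, g5, g6, g7, g8]
    linear_combination e⁻¹ * h2 + cub y * (inv_mul_cancel₀ he)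
  have hli : LinearIndependent K ![(X 0 - C p * X (partner τ) : S K),
      X (secondFst τ) - C q * X (secondSnd τ), X 0 - C p' * X (partner τ'),
      X (secondFst τ') - C q' * X (secondSnd τ')] := by
    have := (linearIndependent_lin_iff _ _ _ _).2 hBΞ
    simp only [x01, x02, x10, x20] at this
    rw [← lin_diff, ← lin_diff, ← lin_diff, ← lin_diff]
    exact this
  obtain ⟨φ, hφ, h00, h01, h02, h10, h20⟩ := exists_listed_of_border hp hq hp' hq' hli
  have hcoef : ∀ (i j k l : Fin _) (r : K), φ i j = X k - C r * X l →
      ∀ n, coeffs φ n i j = diff k l r n := by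
    intro i j k l r hij n
    rw [coeffs, map_apply, hij]
    simp [diff, Pi.single_apply, eq_comm]
  have hBΩ : borderCoeff Ω = borderCoeff Ξ := rfl
  have hΩφ : Equivalent Ω (coeffs φ) := by
    refine equivalent_of_border_eq (hBΩ ▸ hBΞ) (fun y => ?_) (fun k => rfl) (fun k => ?_)
      (fun k => ?_) (fun k => ?_) (fun k => ?_) (fun k => ?_)
    · rw [hΩdet, ev_coeffs (listed_isHomogeneous hφ), ← RingHom.mapMatrix_apply, ← RingHom.map_det,
        hφ.det_eq]
      simp [cub, f]
    · simp [coeffs, h00]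
    · exact (hcoef _ _ _ _ _ h01 k).trans (x01 k).symm
    · exact (hcoef _ _ _ _ _ h02 k).trans (x02 k).symm
    · exact (hcoef _ _ _ _ _ h10 k).trans (x10 k).symm
    · exact (hcoef _ _ _ _ _ h20 k).trans (x20 k).symm
  refine ⟨τ, τ', p, q, p', q', φ, hp, hq, hp', hq', hφ, h00, h01, h02, h10, h20, ?_,
    ((hΦΨ.trans hΨΞ).trans hΞΩ).trans hΩφ⟩
  rw [border, h01, h02, h10, h20]
  exact hli

end FermatCubic

end

/-! ### The ring R₄: integrality, Noether normalization and dimension -/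

noncomputable section

namespace FermatCubic

open MvPolynomial

theorem irreducible_X_pow_three_add_C {A : Type*} [CommRing A] [IsDomain A] {π c : A}
    (hπ : Prime π) (h1 : π ∣ c) (h2 : ¬ π ^ 2 ∣ c) :
    Irreducible (Polynomial.X ^ 3 + Polynomial.C c : Polynomial A) := by
  have hm : (Polynomial.X ^ 3 + Polynomial.C c : Polynomial A).Monic :=
    Polynomial.monic_X_pow_add_C c (by norm_num)
  have hd : (Polynomial.X ^ 3 + Polynomial.C c : Polynomial A).natDegree = 3 :=
    Polynomial.natDegree_X_pow_add_C
  have hP : (Ideal.span {π}).IsPrime := (Ideal.span_singleton_prime hπ.ne_zero).2 hπ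
  refine Polynomial.IsEisensteinAt.irreducible
    (Polynomial.Monic.isEisensteinAt_of_mem_of_notMem hm hP.ne_top (fun {n} hn => ?_) ?_) hP
    hm.isPrimitive (by rw [hd]; norm_num)
  · rw [hd] at hn
    rw [Ideal.mem_span_singleton]
    interval_cases n <;> simp [Polynomial.coeff_X_pow, Polynomial.coeff_C, h1]
  · rw [Ideal.span_singleton_pow, Ideal.mem_span_singleton]
    simpa using h2

variable (K : Type*) [Field K]

/-- `X₀³ + X₁³ + X₂³`. -/
def g : MvPolynomial (Fin 3) K := X 0 ^ 3 + X 1 ^ 3 + X 2 ^ 3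

theorem finSuccEquiv_f : finSuccEquiv K 3 (f K) = Polynomial.X ^ 3 + Polynomial.C (g K) := by
  have e1 : finSuccEquiv K 3 (X 1) = Polynomial.C (X 0) := finSuccEquiv_X_succ (j := 0)
  have e2 : finSuccEquiv K 3 (X 2) = Polynomial.C (X 1) := finSuccEquiv_X_succ (j := 1)
  have e3 : finSuccEquiv K 3 (X 3) = Polynomial.C (X 2) := finSuccEquiv_X_succ (j := 2)
  simp only [f, g, map_add, map_pow, finSuccEquiv_X_zero, e1, e2, e3]
  ring

/-- Eisenstein at X₀ + X₁, which divides X₀³ + X₁³ only once: the cofactor takes the value 3 at (1,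
-1). -/
theorem prime_g [CharZero K] : Prime (g K) := by
  rw [← irreducible_iff_prime, ← MulEquiv.irreducible_iff (finSuccEquiv K 2)]
  have e1 : finSuccEquiv K 2 (X 1) = Polynomial.C (X 0) := finSuccEquiv_X_succ (j := 0)
  have e2 : finSuccEquiv K 2 (X 2) = Polynomial.C (X 1) := finSuccEquiv_X_succ (j := 1)
  have e : finSuccEquiv K 2 (g K) = Polynomial.X ^ 3 +
      Polynomial.C (X 0 ^ 3 + X 1 ^ 3 : MvPolynomial (Fin 2) K) := by
    simp only [g, map_add, map_pow, finSuccEquiv_X_zero, e1, e2]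
    ring
  rw [e]
  have hπ : Prime (X 0 + X 1 : MvPolynomial (Fin 2) K) := by
    rw [← MulEquiv.prime_iff (finSuccEquiv K 1)]
    have e1 : finSuccEquiv K 1 (X 1) = Polynomial.C (X 0) := finSuccEquiv_X_succ (j := 0)
    have : finSuccEquiv K 1 (X 0 + X 1) =
        Polynomial.X - Polynomial.C (-X 0 : MvPolynomial (Fin 1) K) := by
      rw [map_add, finSuccEquiv_X_zero, e1, map_neg, sub_neg_eq_add]
    rw [this]
    exact Polynomial.prime_X_sub_C _
  have hfac : (X 0 ^ 3 + X 1 ^ 3 : MvPolynomial (Fin 2) K) =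
      (X 0 + X 1) * (X 0 ^ 2 - X 0 * X 1 + X 1 ^ 2) := by ring
  refine irreducible_X_pow_three_add_C hπ ⟨_, hfac⟩ ?_
  rw [hfac, pow_two, mul_dvd_mul_iff_left hπ.ne_zero]
  rintro ⟨q, hq⟩
  have := congrArg (eval ![1, -1]) hq
  simp at this
  norm_num at this

/-- Eisenstein again, now at the prime constant term itself. -/
theorem prime_f [CharZero K] : Prime (f K) := by
  rw [← irreducible_iff_prime, ← MulEquiv.irreducible_iff (finSuccEquiv K 3), finSuccEquiv_f]
  refine irreducible_X_pow_three_add_C (prime_g K) dvd_rfl ?_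
  rw [pow_two]
  intro h
  have h1 : g K * g K ∣ g K * 1 := by rwa [mul_one]
  rw [mul_dvd_mul_iff_left (prime_g K).ne_zero] at h1
  exact (prime_g K).not_isUnit (isUnit_of_dvd_one h1)

instance isDomain_R [CharZero K] : IsDomain (R K) :=
  (Ideal.Quotient.isDomain_iff_prime _).2
    ((Ideal.span_singleton_prime (prime_f K).ne_zero).2 (prime_f K))

/-- The class of a polynomial in `R₄`. -/
abbrev cl : S K →ₐ[K] R K := Ideal.Quotient.mkₐ K (Ideal.span {f K})

/-- The inclusion of `K[Y₂, Y₃, Y₄]` into `R₄`. -/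
def noether : MvPolynomial (Fin 3) K →ₐ[K] R K := (cl K).comp (rename Fin.succ)

theorem cl_surjective : Function.Surjective (cl K) := Ideal.Quotient.mk_surjective

variable {K}

theorem cl_eq_zero_iff {p : S K} : cl K p = 0 ↔ f K ∣ p := by
  rw [← Ideal.mem_span_singleton]
  exact Ideal.Quotient.eq_zero_iff_mem

theorem noether_X (i : Fin 3) : noether K (X i) = cl K (X i.succ) := by
  simp [noether]

theorem finSuccEquiv_rename_succ (p : MvPolynomial (Fin 3) K) :
    finSuccEquiv K 3 (rename Fin.succ p) = Polynomial.C p := by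
  induction p using MvPolynomial.induction_on with
  | C a => simp [finSuccEquiv_apply]
  | add p q hp hq => rw [map_add, map_add, hp, hq, map_add]
  | mul_X p i hp => rw [map_mul, map_mul, hp, rename_X, finSuccEquiv_X_succ, map_mul]

theorem cl_X_zero_pow_three : cl K (X 0) ^ 3 = -noether K (g K) := by
  have : cl K (X 0 ^ 3 + X 1 ^ 3 + X 2 ^ 3 + X 3 ^ 3) = 0 := cl_eq_zero_iff.2 (dvd_refl (f K))
  simp only [map_add, map_pow] at this
  simp only [g, map_add, map_pow, noether_X]
  rw [Fin.succ_zero_eq_one, Fin.succ_one_eq_two, show Fin.succ (2 : Fin 3) = 3 from rfl]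
  linear_combination this

/-- A polynomial of degree at most 2 in Y₁ that is divisible by the monic cubic f₄ is zero. -/
theorem noether_combination_eq_zero {a b c : MvPolynomial (Fin 3) K}
    (h : noether K a + noether K b * cl K (X 0) + noether K c * cl K (X 0) ^ 2 = 0) :
    a = 0 ∧ b = 0 ∧ c = 0 := by
  simp only [noether, AlgHom.comp_apply, ← map_mul, ← map_pow, ← map_add] at h
  rw [cl_eq_zero_iff] at h
  have h2 := map_dvd (finSuccEquiv K 3) h
  rw [finSuccEquiv_f] at h2
  simp only [map_add, map_mul, map_pow, finSuccEquiv_rename_succ, finSuccEquiv_X_zero] at h2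
  have h3 := Polynomial.eq_zero_of_dvd_of_natDegree_lt h2 (by
    rw [Polynomial.natDegree_X_pow_add_C]
    exact lt_of_le_of_lt (b := 2) (by compute_degree) (by norm_num))
  refine ⟨?_, ?_, ?_⟩
  · simpa [Polynomial.coeff_X] using congrArg (Polynomial.coeff · 0) h3
  · simpa [Polynomial.coeff_X, Polynomial.coeff_C] using congrArg (Polynomial.coeff · 1) h3
  · simpa [Polynomial.coeff_X, Polynomial.coeff_C] using congrArg (Polynomial.coeff · 2) h3

theorem exists_noether_combination (r : R K) : ∃ a b c : MvPolynomial (Fin 3) K,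
    r = noether K a + noether K b * cl K (X 0) + noether K c * cl K (X 0) ^ 2 := by
  obtain ⟨p, rfl⟩ := cl_surjective K r
  induction p using MvPolynomial.induction_on with
  | C a =>
    refine ⟨C a, 0, 0, ?_⟩
    simp [noether]
  | add p q hp hq =>
    obtain ⟨a, b, c, hp⟩ := hp
    obtain ⟨a', b', c', hq⟩ := hq
    refine ⟨a + a', b + b', c + c', ?_⟩
    rw [map_add, hp, hq, map_add, map_add, map_add]
    ring
  | mul_X p i hp =>
    obtain ⟨a, b, c, hp⟩ := hp
    rw [map_mul, hp]
    refine Fin.cases ?_ (fun j => ?_) i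
    · refine ⟨-c * g K, a, b, ?_⟩
      rw [map_mul, map_neg]
      linear_combination noether K c * cl_X_zero_pow_three (K := K)
    · refine ⟨a * X j, b * X j, c * X j, ?_⟩
      rw [map_mul, map_mul, map_mul, noether_X]
      ring

/-- The constant term of an integral equation of r is a multiple of r. If it maps to zero, the
equation is divided by its variable, which is allowed since r ≠ 0 in a domain. -/
theorem exists_mul_eq_map {A B : Type*} [CommRing A] [CommRing B] [IsDomain B] (σ : A →+* B)
    {r : B} (hr : r ≠ 0) (h : σ.IsIntegralElem r) :
    ∃ (s : B) (p : A), σ p ≠ 0 ∧ s * r = σ p := by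
  obtain ⟨q, hq, hqr⟩ := h
  induction hn : q.natDegree using Nat.strong_induction_on generalizing q with
  | _ n ih =>
  by_cases h0 : σ (q.coeff 0) = 0
  · have hq1 : 0 < q.natDegree := by
      rcases Nat.eq_zero_or_pos q.natDegree with h | h
      · rw [(Polynomial.Monic.natDegree_eq_zero hq).1 h] at hqr
        simp at hqr
      · exact h
    have hdiv : (q.divX).Monic := by
      rw [Polynomial.Monic, Polynomial.leadingCoeff, Polynomial.natDegree_divX_eq_natDegree_tsub_one,
        Polynomial.coeff_divX, Nat.sub_add_cancel hq1]
      exact hq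
    refine ih _ ?_ _ hdiv ?_ rfl
    · rw [Polynomial.natDegree_divX_eq_natDegree_tsub_one]
      lia
    · have h2 := hqr
      rw [← Polynomial.X_mul_divX_add q, Polynomial.eval₂_add, Polynomial.eval₂_C, h0, add_zero,
        Polynomial.eval₂_mul, Polynomial.eval₂_X] at h2
      exact (mul_eq_zero.1 h2).resolve_left hr
  · refine ⟨-q.divX.eval₂ σ r, q.coeff 0, h0, ?_⟩
    have h2 := hqr
    rw [← Polynomial.X_mul_divX_add q, Polynomial.eval₂_add, Polynomial.eval₂_C,
      Polynomial.eval₂_mul, Polynomial.eval₂_X] at h2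
    linear_combination -h2

theorem isIntegralElem_noether (r : R K) : (noether K).toRingHom.IsIntegralElem r := by
  obtain ⟨p, rfl⟩ := cl_surjective K r
  induction p using MvPolynomial.induction_on with
  | C a =>
    have : cl K (C a) = (noether K).toRingHom (C a) := by simp [noether]
    rw [this]
    exact RingHom.isIntegralElem_map _
  | add p q hp hq => rw [map_add]; exact hp.add _ hq
  | mul_X p i hp =>
    rw [map_mul]
    refine hp.mul _ ?_
    refine Fin.cases ?_ (fun j => ?_) i
    · refine ⟨Polynomial.X ^ 3 + Polynomial.C (g K), Polynomial.monic_X_pow_add_C _ (by norm_num), ?_⟩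
      rw [Polynomial.eval₂_add, Polynomial.eval₂_pow, Polynomial.eval₂_X, Polynomial.eval₂_C,
        cl_X_zero_pow_three]
      exact neg_add_cancel _
    · rw [← noether_X]
      exact RingHom.isIntegralElem_map _

theorem exists_mul_eq_noether [CharZero K] {r : R K} (hr : r ≠ 0) :
    ∃ (s : R K) (p : MvPolynomial (Fin 3) K), p ≠ 0 ∧ s * r = noether K p := by
  obtain ⟨s, p, hp, h⟩ := exists_mul_eq_map _ hr (isIntegralElem_noether r)
  exact ⟨s, p, fun h0 => hp (by rw [h0, map_zero]), h⟩

/-- Restriction to the line (s, -s, t, -t) maps R₄ onto a polynomial ring of dimension 2 and kills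
the nonzero element Y₁ + Y₂ of the domain R₄, so the dimension drops by at least one. -/
theorem three_le_ringKrullDim [CharZero K] : 3 ≤ ringKrullDim (R K) := by
  let φ : S K →ₐ[K] MvPolynomial (Fin 2) K := aeval ![X 0, -X 0, X 1, -X 1]
  have hf : φ (f K) = 0 := by
    simp [φ, f]
    ring
  let ψ : R K →ₐ[K] MvPolynomial (Fin 2) K := Ideal.Quotient.liftₐ _ φ (by
    intro a ha
    obtain ⟨b, rfl⟩ := Ideal.mem_span_singleton.1 ha
    rw [map_mul, hf, zero_mul])
  have hψ : ∀ p, ψ (cl K p) = φ p := fun p => rfl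
  have hsurj : Function.Surjective ψ := by
    intro p
    refine ⟨cl K (aeval ![X 0, X 2] p), ?_⟩
    rw [hψ, ← AlgHom.comp_apply]
    conv_rhs => rw [← AlgHom.id_apply (R := K) p]
    congr 1
    ext i : 1
    fin_cases i <;> simp [φ]
  have hne : cl K (X 0 + X 1) ≠ 0 := by
    rw [Ne, cl_eq_zero_iff]
    rintro ⟨q, hq⟩
    have := congrArg (eval ![1, 1, -1, -1]) hq
    simp [f] at this
    norm_num at this
  have h0 : ψ (cl K (X 0 + X 1)) = 0 := by
    rw [hψ]
    simp [φ]
  have key := ringKrullDim_succ_le_of_surjective ψ.toRingHom hsurj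
    (mem_nonZeroDivisors_of_ne_zero hne) h0
  have hdim : ringKrullDim (MvPolynomial (Fin 2) K) = 2 := by
    rw [MvPolynomial.ringKrullDim_of_isNoetherianRing, ringKrullDim_eq_zero_of_field]
    simp
  rw [hdim] at key
  exact le_trans (by norm_num) key

end FermatCubic

end

/-! ### Regular sequences of generic linear forms -/

noncomputable section

namespace FermatCubic

open MvPolynomial

section RegularSequences

variable {A M : Type*} [CommRing A] [AddCommGroup M] [Module A M]

/-- The submodule `rM`. -/
def mulRange (M : Type*) [AddCommGroup M] [Module A M] (r : A) : Submodule A M :=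
  LinearMap.range (LinearMap.lsmul A M r)

theorem mem_mulRange {r : A} {x : M} : x ∈ mulRange M r ↔ ∃ m, r • m = x := Iff.rfl

theorem smul_mem_mulRange (r : A) (m : M) : r • m ∈ mulRange M r := ⟨m, rfl⟩

theorem mulRange_eq_span_smul_top (r : A) : mulRange M r = Ideal.span {r} • ⊤ := by
  ext x
  rw [mem_mulRange]
  simp [Submodule.ideal_span_singleton_smul, Submodule.mem_smul_pointwise_iff_exists]

/-- `rs` is a weakly regular sequence on `M ⧸ N`. -/
def RegularOn : Submodule A M → List A → Prop
  | _, [] => True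
  | N, r :: rs => (∀ m : M, r • m ∈ N → m ∈ N) ∧ RegularOn (N ⊔ mulRange M r) rs

/-- The submodule `N + (rs)M`. -/
def addRanges : Submodule A M → List A → Submodule A M
  | N, [] => N
  | N, r :: rs => addRanges (N ⊔ mulRange M r) rs

theorem mem_of_isSMulRegular_quotient {N : Submodule A M} {r : A} (h : IsSMulRegular (M ⧸ N) r)
    {m : M} (hm : r • m ∈ N) : m ∈ N := by
  rw [← Submodule.Quotient.mk_eq_zero] at hm ⊢
  refine h ?_
  change r • _ = r • _
  rw [smul_zero, ← Submodule.Quotient.mk_smul, hm]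

theorem regularOn_of_forall (rs pre : List A)
    (h : ∀ i (hi : i < rs.length),
      IsSMulRegular (M ⧸ (Ideal.ofList (pre ++ rs.take i) • ⊤ : Submodule A M)) rs[i]) :
    RegularOn (Ideal.ofList pre • ⊤ : Submodule A M) rs := by
  induction rs generalizing pre with
  | nil => trivial
  | cons r rs ih =>
    refine ⟨fun m hm => ?_, ?_⟩
    · have h0 := h 0 (by simp)
      rw [List.take_zero, List.append_nil] at h0
      exact mem_of_isSMulRegular_quotient h0 hm
    · have := ih (pre ++ [r]) fun i hi => by
        have := h (i + 1) (by simpa using hi)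
        rw [List.take_succ_cons] at this
        rw [List.append_assoc]
        exact this
      rwa [Ideal.ofList_append, Ideal.ofList_singleton, Submodule.sup_smul,
        ← mulRange_eq_span_smul_top] at this

theorem RegularOn.of_isWeaklyRegular {rs : List A}
    (h : RingTheory.Sequence.IsWeaklyRegular M rs) : RegularOn (⊥ : Submodule A M) rs := by
  have := regularOn_of_forall (M := M) rs [] fun i hi => h.regular_mod_prev i hi
  rwa [Ideal.ofList_nil, Submodule.bot_smul] at this

/-- The half of the exchange of two regular elements that needs no local or graded hypothesis. -/
theorem regular_swap {N : Submodule A M} {r l : A} (hr : ∀ m : M, r • m ∈ N → m ∈ N)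
    (hl : ∀ m : M, l • m ∈ N ⊔ mulRange M r → m ∈ N ⊔ mulRange M r) (u : M)
    (hu : r • u ∈ N ⊔ mulRange M l) : u ∈ N ⊔ mulRange M l := by
  obtain ⟨n, hn, x, ⟨v, rfl⟩, h⟩ := Submodule.mem_sup.1 hu
  have hv : v ∈ N ⊔ mulRange M r := by
    refine hl v ?_
    have : l • v = r • u - n := eq_sub_of_add_eq' h
    rw [this]
    exact sub_mem (Submodule.mem_sup_right (smul_mem_mulRange r u)) (Submodule.mem_sup_left hn)
  obtain ⟨n', hn', x, ⟨w, rfl⟩, rfl⟩ := Submodule.mem_sup.1 hv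
  have hw : u - l • w ∈ N := by
    refine hr _ ?_
    have : r • (u - l • w) = n + l • n' := by
      rw [smul_sub, ← h]
      simp only [LinearMap.lsmul_apply, smul_add]
      rw [smul_comm l r w]
      abel
    rw [this]
    exact N.add_mem hn (N.smul_mem _ hn')
  rw [← sub_add_cancel u (l • w)]
  exact add_mem (Submodule.mem_sup_left hw) (Submodule.mem_sup_right (smul_mem_mulRange l w))

end RegularSequences

section GenericElements

variable {K A M V : Type*} [Field K] [CommRing A] [Algebra K A] [AddCommGroup M] [Module A M]
  [IsNoetherianRing A] [Module.Finite A M] [AddCommGroup V] [Module K V]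

/-- Zero divisors on M/N form the union of finitely many associated primes. None of these contains
all the forms `L v`, since it would then contain 𝔪 and with it the regular element r. The bad
vectors thus lie in finitely many proper subspaces. -/
theorem exists_finset_regular (L : V →ₗ[K] A) {𝔪 : Ideal A}
    (hL : ∀ p : Ideal A, p.IsPrime → (∀ v, L v ∈ p) → 𝔪 ≤ p) {N : Submodule A M} {r : A}
    (hr𝔪 : r ∈ 𝔪) (hr : ∀ m : M, r • m ∈ N → m ∈ N) :
    ∃ 𝒲 : Finset (Submodule K V), ⊤ ∉ 𝒲 ∧
      ∀ v, (∀ W ∈ 𝒲, v ∉ W) → ∀ m : M, L v • m ∈ N → m ∈ N := by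
  classical
  have hfin := associatedPrimes.finite A (M ⧸ N)
  refine ⟨hfin.toFinset.image fun p => (p.restrictScalars K).comap L, ?_, fun v hv m hm => ?_⟩
  · intro htop
    obtain ⟨p, hp, hp'⟩ := Finset.mem_image.1 htop
    have hp := hfin.mem_toFinset.1 hp
    have h𝔪 : 𝔪 ≤ p := hL p hp.isPrime fun v => by
      have : v ∈ (p.restrictScalars K).comap L := hp' ▸ Submodule.mem_top
      exact this
    have hreg : r ∈ (⋃ p ∈ associatedPrimes A (M ⧸ N), (p : Set A)) :=
      Set.mem_biUnion hp (h𝔪 hr𝔪)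
    rw [biUnion_associatedPrimes_eq_compl_regular] at hreg
    refine hreg ?_
    change IsSMulRegular (M ⧸ N) r
    rw [isSMulRegular_iff_right_eq_zero_of_smul]
    intro x hx
    obtain ⟨m, rfl⟩ := Submodule.Quotient.mk_surjective _ x
    rw [← Submodule.Quotient.mk_smul, Submodule.Quotient.mk_eq_zero] at hx
    exact (Submodule.Quotient.mk_eq_zero _).2 (hr m hx)
  · by_contra hmN
    have hreg : L v ∈ (⋃ p ∈ associatedPrimes A (M ⧸ N), (p : Set A)) := by
      rw [biUnion_associatedPrimes_eq_compl_regular]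
      exact fun h => hmN (mem_of_isSMulRegular_quotient h hm)
    obtain ⟨p, hp, hvp⟩ := Set.mem_iUnion₂.1 hreg
    exact hv _ (Finset.mem_image.2 ⟨p, hfin.mem_toFinset.2 hp, rfl⟩) hvp

/-- A generic form replaces the last element of the sequence and is moved to the front by repeated
exchange. The tail that remains has one element less, so the construction can be iterated. -/
theorem exists_finset_regular_sequence (L : V →ₗ[K] A) {𝔪 : Ideal A}
    (hL : ∀ p : Ideal A, p.IsPrime → (∀ v, L v ∈ p) → 𝔪 ≤ p) (rs : List A) (r : A)
    (N : Submodule A M) (hrs : ∀ x ∈ r :: rs, x ∈ 𝔪) (h : RegularOn N (r :: rs)) :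
    ∃ 𝒲 : Finset (Submodule K V), ⊤ ∉ 𝒲 ∧ ∀ v, (∀ W ∈ 𝒲, v ∉ W) →
      (∀ m : M, L v • m ∈ N → m ∈ N) ∧ ∃ rs' : List A, rs'.length = rs.length ∧
        (∀ x ∈ rs', x ∈ 𝔪) ∧ RegularOn (N ⊔ mulRange M (L v)) rs' := by
  classical
  induction rs generalizing r N with
  | nil =>
    obtain ⟨𝒲, h1, h2⟩ := exists_finset_regular L hL (hrs r (by simp)) h.1
    exact ⟨𝒲, h1, fun v hv => ⟨h2 v hv, [], rfl, by simp, trivial⟩⟩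
  | cons r₂ rs ih =>
    obtain ⟨𝒲, h1, h2⟩ := exists_finset_regular L hL (hrs r (by simp)) h.1
    obtain ⟨𝒲', h1', h2'⟩ := ih r₂ (N ⊔ mulRange M r)
      (fun x hx => hrs x (List.mem_cons_of_mem _ hx)) h.2
    refine ⟨𝒲 ∪ 𝒲', by simp [h1, h1'], fun v hv => ?_⟩
    obtain ⟨e1, rs', e2, e3, e4⟩ := h2' v fun W hW => hv W (Finset.mem_union_right _ hW)
    refine ⟨h2 v fun W hW => hv W (Finset.mem_union_left _ hW), r :: rs', by simp [e2], ?_,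
      regular_swap h.1 e1, ?_⟩
    · intro x hx
      rcases List.mem_cons.1 hx with rfl | hx
      · exact hrs _ (by simp)
      · exact e3 x hx
    · rwa [sup_right_comm]

/-- A vector space over an infinite field is not a finite union of proper subspaces. Adding the span
of the earlier vectors to the list keeps the successive choices independent. -/
theorem exists_notMem_subspaces [Infinite K] {n : ℕ} (𝒲 : Finset (Submodule K V)) (h : ⊤ ∉ 𝒲)
    (v : Fin n → V) (hn : n < Module.finrank K V) :
    ∃ w, (∀ W ∈ 𝒲, w ∉ W) ∧ w ∉ Submodule.span K (Set.range v) := by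
  classical
  have hspan : Submodule.span K (Set.range v) ≠ ⊤ := by
    intro htop
    have h1 := finrank_range_le_card (R := K) v
    rw [Set.finrank, htop, finrank_top, Fintype.card_fin] at h1
    omega
  have h1 : ⊤ ∉ insert (Submodule.span K (Set.range v)) 𝒲 := by
    rw [Finset.mem_insert]
    rintro (h | h')
    · exact hspan h.symm
    · exact h h'
  obtain ⟨w, hw⟩ := (Set.ne_univ_iff_exists_notMem _).1 (Subspace.biUnion_ne_univ_of_top_notMem h1)
  simp only [Set.mem_iUnion, not_exists] at hw
  exact ⟨w, fun W hW => hw W (Finset.mem_insert_of_mem hW), hw _ (Finset.mem_insert_self _ _)⟩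

theorem exists_regular_linear_sequence [Infinite K] (L : V →ₗ[K] A) {𝔪 : Ideal A}
    (hL : ∀ p : Ideal A, p.IsPrime → (∀ v, L v ∈ p) → 𝔪 ≤ p) (hV : 3 ≤ Module.finrank K V)
    {rs : List A} (hrs : ∀ x ∈ rs, x ∈ 𝔪) (hlen : 3 ≤ rs.length)
    (h : RegularOn (⊥ : Submodule A M) rs) :
    ∃ v : Fin 3 → V, LinearIndependent K v ∧
      RegularOn (⊥ : Submodule A M) (List.ofFn fun i => L (v i)) := by
  match rs, hlen with
  | r :: rs, hlen =>
  obtain ⟨𝒲, h1, h2⟩ := exists_finset_regular_sequence L hL rs r ⊥ hrs h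
  obtain ⟨v₁, hv₁, hv₁'⟩ := exists_notMem_subspaces 𝒲 h1 ![] (by omega)
  obtain ⟨reg₁, rs', hl', hrs', h'⟩ := h2 v₁ hv₁
  match rs', hl' with
  | [], hl' => simp [← hl'] at hlen
  | r' :: rs', hl' =>
  obtain ⟨𝒲', h1', h2'⟩ := exists_finset_regular_sequence L hL rs' r' _ hrs' h'
  obtain ⟨v₂, hv₂, hv₂'⟩ := exists_notMem_subspaces 𝒲' h1' ![v₁] (by omega)
  obtain ⟨reg₂, rs'', hl'', hrs'', h''⟩ := h2' v₂ hv₂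
  match rs'', hl'' with
  | [], hl'' => simp [← hl', ← hl''] at hlen
  | r'' :: rs'', hl'' =>
  obtain ⟨𝒲'', h1'', h2''⟩ := exists_finset_regular_sequence L hL rs'' r'' _ hrs'' h''
  obtain ⟨v₃, hv₃, hv₃'⟩ := exists_notMem_subspaces 𝒲'' h1'' ![v₂, v₁] (by omega)
  obtain ⟨reg₃, -⟩ := h2'' v₃ hv₃
  refine ⟨![v₁, v₂, v₃], ?_, ?_⟩
  · have i1 : LinearIndependent K ![v₁] :=
      (linearIndependent_finCons (x := v₁) (v := ![])).2 ⟨linearIndependent_empty_type, hv₁'⟩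
    have i2 : LinearIndependent K ![v₂, v₁] :=
      (linearIndependent_finCons (x := v₂) (v := ![v₁])).2 ⟨i1, hv₂'⟩
    have i3 : LinearIndependent K ![v₃, v₂, v₁] :=
      (linearIndependent_finCons (x := v₃) (v := ![v₂, v₁])).2 ⟨i2, hv₃'⟩
    have := i3.comp ![2, 1, 0] (by decide)
    convert this using 1
    ext i : 1
    fin_cases i <;> rfl
  · simp only [List.ofFn_succ, List.ofFn_zero]
    exact ⟨reg₁, reg₂, reg₃, trivial⟩

end GenericElements

section Independence

variable {K A M : Type*} [Field K] [CommRing A] [Algebra K A] [AddCommGroup M] [Module A M]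

/-- A family that is linearly independent modulo a regular sequence is independent over the
polynomial ring in the sequence. -/
theorem independent_of_regularOn {J : Type*} [Fintype J] (b : J → M) (n : ℕ) (l : Fin n → A)
    (N : Submodule A M) (hreg : RegularOn N (List.ofFn l))
    (hb : ∀ c : J → K, ∑ j, algebraMap K A (c j) • b j ∈ addRanges N (List.ofFn l) → c = 0)
    (p : J → MvPolynomial (Fin n) K) (hp : ∑ j, aeval l (p j) • b j ∈ N) : p = 0 := by
  induction n generalizing N with
  | zero =>
    have : ∀ j, p j = C (coeff 0 (p j)) := fun j => eq_C_of_isEmpty _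
    have h := hb (fun j => coeff 0 (p j)) (by
      rw [List.ofFn_zero]
      refine (congrArg (· ∈ N) (Finset.sum_congr rfl fun j _ => ?_)).mpr hp
      conv_rhs => rw [this j]
      rw [aeval_C])
    ext1 j
    rw [this j, show coeff 0 (p j) = 0 from congrFun h j, C_0]
    rfl
  | succ n ih =>
    rw [List.ofFn_succ] at hreg hb
    -- Modulo l 0 only the constant coefficients in the first variable survive, and they vanish by
    -- induction on the length of the sequence. Regularity of l 0 then allows division by it, which
    -- brings the next coefficient down to degree zero.
    have key : ∀ (k : ℕ) (q : J → Polynomial (MvPolynomial (Fin n) K)),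
        ∑ j, (q j).eval₂ (aeval fun i => l i.succ : _ →ₐ[K] A).toRingHom (l 0) • b j ∈ N →
        ∀ j, (q j).coeff k = 0 := by
      intro k
      have hsplit : ∀ q : J → Polynomial (MvPolynomial (Fin n) K),
          ∑ j, (q j).eval₂ (aeval fun i => l i.succ : _ →ₐ[K] A).toRingHom (l 0) • b j =
          l 0 • ∑ j, ((q j).divX).eval₂ (aeval fun i => l i.succ : _ →ₐ[K] A).toRingHom (l 0) • b j +
          ∑ j, aeval (fun i => l i.succ) ((q j).coeff 0) • b j := by
        intro q
        rw [Finset.smul_sum, ← Finset.sum_add_distrib]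
        refine Finset.sum_congr rfl fun j _ => ?_
        conv_lhs => rw [← Polynomial.X_mul_divX_add (q j)]
        rw [Polynomial.eval₂_add, Polynomial.eval₂_mul, Polynomial.eval₂_X, Polynomial.eval₂_C,
          add_smul, mul_smul]
        rfl
      have hzero : ∀ q : J → Polynomial (MvPolynomial (Fin n) K),
          ∑ j, (q j).eval₂ (aeval fun i => l i.succ : _ →ₐ[K] A).toRingHom (l 0) • b j ∈ N →
          (fun j => (q j).coeff 0) = 0 := by
        intro q hq
        refine ih _ _ hreg.2 hb _ ?_
        rw [hsplit] at hq
        have h1 : l 0 • ∑ j, ((q j).divX).eval₂ (aeval fun i => l i.succ : _ →ₐ[K] A).toRingHom (l 0)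
            • b j ∈ N ⊔ mulRange M (l 0) := Submodule.mem_sup_right (smul_mem_mulRange _ _)
        exact (Submodule.add_mem_iff_right _ h1).1 (Submodule.mem_sup_left hq)
      induction k with
      | zero => exact fun q hq j => congrFun (hzero q hq) j
      | succ k ihk =>
        intro q hq j
        have h0 := hzero q hq
        rw [hsplit] at hq
        have h1 : ∑ j, aeval (fun i => l i.succ) ((q j).coeff 0) • b j = 0 :=
          Finset.sum_eq_zero fun j _ => by
            rw [show (q j).coeff 0 = 0 from congrFun h0 j, map_zero, zero_smul]
        rw [h1, add_zero] at hq
        have := ihk (fun j => (q j).divX) (hreg.1 _ hq) j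
        rwa [Polynomial.coeff_divX] at this
    have heval : ∀ q : MvPolynomial (Fin (n + 1)) K, aeval l q =
        (finSuccEquiv K n q).eval₂ (aeval fun i => l i.succ : _ →ₐ[K] A).toRingHom (l 0) := by
      intro q
      induction q using MvPolynomial.induction_on with
      | C a => simp [finSuccEquiv_apply]
      | add p q hp hq => rw [map_add, hp, hq, map_add, Polynomial.eval₂_add]
      | mul_X p i hp =>
        rw [map_mul, hp, map_mul, Polynomial.eval₂_mul]
        congr 1
        refine Fin.cases ?_ (fun j => ?_) i
        · rw [finSuccEquiv_X_zero, Polynomial.eval₂_X, aeval_X]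
        · rw [finSuccEquiv_X_succ, Polynomial.eval₂_C, aeval_X]
          simp
    ext1 j
    have : finSuccEquiv K n (p j) = 0 := by
      ext1 k
      rw [Polynomial.coeff_zero]
      refine key k (fun j => finSuccEquiv K n (p j)) ?_ j
      simpa only [heval] using hp
    simpa using this

end Independence

end FermatCubic

end

/-! ### Graded modules and freeness over K[Y₂, Y₃, Y₄] -/

noncomputable section

namespace FermatCubic

open MvPolynomial

variable {K : Type*} [Field K] {M : Type*} [AddCommGroup M] [Module (R K) M]

theorem zero_smul_R (x : M) : (0 : R K) • x = 0 := zero_smul (R K) x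

theorem exists_projections {ℳ : ℤ → AddSubgroup M} (h : DirectSum.IsInternal ℳ) :
    ∃ π : ℤ → M →+ M, (∀ k x, π k x ∈ ℳ k) ∧ (∀ k, ∀ x ∈ ℳ k, π k x = x) ∧
      (∀ j k, j ≠ k → ∀ x ∈ ℳ j, π k x = 0) ∧ ∀ x, ∃ s : Finset ℤ, x = ∑ k ∈ s, π k x := by
  classical
  let := h.chooseDecomposition
  refine ⟨fun k => (ℳ k).subtype.comp ((DFinsupp.evalAddMonoidHom k).comp
    (DirectSum.decomposeAddEquiv ℳ).toAddMonoidHom), fun k x => Subtype.prop _, ?_, ?_, ?_⟩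
  · intro k x hx
    exact DirectSum.decompose_of_mem_same ℳ hx
  · intro j k hjk x hx
    exact DirectSum.decompose_of_mem_ne ℳ hx hjk
  · intro x
    exact ⟨_, (DirectSum.sum_support_decompose ℳ x).symm⟩

/-- The homogeneous component of integral degree. -/
def homComp {σ : Type*} (m : ℤ) (p : MvPolynomial σ K) : MvPolynomial σ K :=
  if 0 ≤ m then homogeneousComponent m.toNat p else 0

theorem homComp_of_neg {σ : Type*} {m : ℤ} (h : m < 0) (p : MvPolynomial σ K) :
    homComp m p = 0 := if_neg (not_le.2 h)

theorem homComp_natCast {σ : Type*} (m : ℕ) (p : MvPolynomial σ K) :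
    homComp m p = homogeneousComponent m p := by
  simp [homComp]

theorem isHomogeneous_homComp {σ : Type*} {m : ℤ} (p : MvPolynomial σ K) :
    (homComp m p).IsHomogeneous m.toNat := by
  rw [homComp]
  split_ifs
  · exact homogeneousComponent_isHomogeneous _ _
  · exact isHomogeneous_zero _ _ _

/-- `ψ` maps forms of degree `n` to elements of degree `n`. -/
def IsGradedHom {σ : Type*} (ψ : MvPolynomial σ K →ₐ[K] R K) : Prop :=
  ∀ (n : ℕ) (p : MvPolynomial σ K), p.IsHomogeneous n → ψ p ∈ piece K n

theorem mem_piece_natCast {n : ℕ} {r : R K} :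
    r ∈ piece K n ↔ ∃ p : S K, p.IsHomogeneous n ∧ cl K p = r := by
  rw [piece, if_pos (Int.natCast_nonneg n), Int.toNat_natCast]
  rfl

theorem isGradedHom_cl : IsGradedHom (cl K) := fun _ p hp => mem_piece_natCast.2 ⟨p, hp, rfl⟩

theorem isGradedHom_noether : IsGradedHom (noether K) := fun _ _ hp =>
  mem_piece_natCast.2 ⟨_, hp.rename_isHomogeneous, rfl⟩

theorem proj_smul {ℳ : ℤ → AddSubgroup M} (hG : IsGrading (K := K) ℳ) {π : ℤ → M →+ M}
    (h1 : ∀ k, ∀ x ∈ ℳ k, π k x = x) (h2 : ∀ j k, j ≠ k → ∀ x ∈ ℳ j, π k x = 0)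
    {σ : Type*} {ψ : MvPolynomial σ K →ₐ[K] R K} (hψ : IsGradedHom ψ) (p : MvPolynomial σ K)
    {j : ℤ} {x : M} (hx : x ∈ ℳ j) (k : ℤ) : π k (ψ p • x) = ψ (homComp (k - j) p) • x := by
  have hterm : ∀ n : ℕ, ψ (homogeneousComponent n p) • x ∈ ℳ (n + j) := fun n =>
    hG.smul_mem _ _ _ _ (hψ n _ (homogeneousComponent_isHomogeneous n p)) hx
  conv_lhs => rw [← sum_homogeneousComponent p, map_sum, Finset.sum_smul, map_sum]
  by_cases hk : 0 ≤ k - j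
  · obtain ⟨n, hn⟩ := Int.eq_ofNat_of_zero_le hk
    have hkn : k = n + j := by omega
    rw [hn, homComp_natCast]
    by_cases hnd : n ∈ Finset.range (p.totalDegree + 1)
    · rw [Finset.sum_eq_single_of_mem n hnd fun m _ hmn => h2 _ _ (by omega) _ (hterm m)]
      rw [hkn]
      exact h1 _ _ (hterm n)
    · rw [homogeneousComponent_eq_zero n p (by
        rw [Finset.mem_range] at hnd; omega), map_zero, zero_smul_R]
      refine Finset.sum_eq_zero fun m hm => h2 _ _ ?_ _ (hterm m)
      rintro h
      have : m = n := by omega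
      exact hnd (this ▸ hm)
  · rw [homComp_of_neg (not_le.1 hk), map_zero, zero_smul_R]
    exact Finset.sum_eq_zero fun m _ => h2 _ _ (by omega) _ (hterm m)

/-- `b` is a finite homogeneous family, with degrees `d`, that generates `M` over
`K[Y₂, Y₃, Y₄]`. -/
def Generates (ℳ : ℤ → AddSubgroup M) {n : ℕ} (b : Fin n → M) (d : Fin n → ℤ) : Prop :=
  (∀ j, b j ∈ ℳ (d j)) ∧ ∀ m : M, ∃ p : Fin n → MvPolynomial (Fin 3) K,
    m = ∑ j, noether K (p j) • b j

/-- The homogeneous components of finitely many generators over R₄, multiplied by 1, Y₁, Y₁²,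
generate over K[Y₂, Y₃, Y₄]. -/
theorem exists_homogeneous_generators {ℳ : ℤ → AddSubgroup M} (hG : IsGrading (K := K) ℳ)
    [Module.Finite (R K) M] :
    ∃ (n : ℕ) (b : Fin n → M) (d : Fin n → ℤ), Generates (K := K) ℳ b d := by
  classical
  obtain ⟨π, h0, h1, h2, h3⟩ := exists_projections hG.isInternal
  obtain ⟨T, hT⟩ := (Module.finite_def.1 ‹Module.Finite (R K) M›)
  choose s hs using h3
  have hy : cl K (X 0) ∈ piece K 1 := isGradedHom_cl 1 _ (isHomogeneous_X K 0)
  let ι := Σ x : T, (s x.1 : Finset ℤ) × Fin 3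
  let z : ι → M := fun i => cl K (X 0) ^ (i.2.2 : ℕ) • π i.2.1 i.1.1
  let e := (Fintype.equivFin ι).symm
  have hpow : ∀ n : ℕ, cl K (X 0) ^ n ∈ piece K n := fun n => by
    rw [← map_pow]
    exact isGradedHom_cl n _ (by simpa using (isHomogeneous_X K (0 : Fin 4)).pow n)
  have hgen : ∀ m : M, ∃ p : ι → MvPolynomial (Fin 3) K, m = ∑ j, noether K (p j) • z j := by
    let Q : Submodule (R K) M :=
      { carrier := {m | ∃ p : ι → MvPolynomial (Fin 3) K, m = ∑ j, noether K (p j) • z j}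
        zero_mem' := ⟨0, by simp [zero_smul_R]⟩
        add_mem' := by
          rintro _ _ ⟨p, rfl⟩ ⟨q, rfl⟩
          exact ⟨p + q, by simp [add_smul, Finset.sum_add_distrib]⟩
        smul_mem' := by
          rintro r _ ⟨p, rfl⟩
          choose u v w huvw using fun j : ι => exists_noether_combination
            (r * cl K (X 0) ^ (j.2.2 : ℕ))
          refine ⟨fun j => ∑ l : Fin 3, p ⟨j.1, j.2.1, l⟩ *
            ![u ⟨j.1, j.2.1, l⟩, v ⟨j.1, j.2.1, l⟩, w ⟨j.1, j.2.1, l⟩] j.2.2, ?_⟩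
          simp only [ι, Fintype.sum_sigma, Fintype.sum_prod_type, Finset.smul_sum]
          refine Finset.sum_congr rfl fun x _ => Finset.sum_congr rfl fun k _ => ?_
          have key : ∀ l : Fin 3, r • noether K (p ⟨x, k, l⟩) • z ⟨x, k, l⟩ =
              noether K (p ⟨x, k, l⟩ * u ⟨x, k, l⟩) • z ⟨x, k, 0⟩ +
              noether K (p ⟨x, k, l⟩ * v ⟨x, k, l⟩) • z ⟨x, k, 1⟩ +
              noether K (p ⟨x, k, l⟩ * w ⟨x, k, l⟩) • z ⟨x, k, 2⟩ := by
            intro l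
            simp only [z, smul_smul, ← add_smul]
            congr 1
            have := huvw ⟨x, k, l⟩
            simp only [map_mul]
            simp only [Fin.val_zero, Fin.val_one, Fin.val_two, pow_zero, pow_one]
            linear_combination noether K (p ⟨x, k, l⟩) * this
          simp only [key, Fin.sum_univ_three, map_add, add_smul]
          simp
          abel }
    have hQ : ∀ x : T, x.1 ∈ Q := by
      intro x
      rw [hs x.1]
      refine Q.sum_mem fun k hk => ?_
      refine ⟨Pi.single ⟨x, ⟨k, hk⟩, 0⟩ 1, ?_⟩
      rw [Finset.sum_eq_single_of_mem ⟨x, ⟨k, hk⟩, 0⟩ (Finset.mem_univ _)]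
      · simp [z]
      · intro j _ hj
        rw [Pi.single_eq_of_ne hj, map_zero, zero_smul_R]
    intro m
    have : (⊤ : Submodule (R K) M) ≤ Q := by
      rw [← hT]
      exact Submodule.span_le.2 fun x hx => hQ ⟨x, hx⟩
    exact this (Submodule.mem_top (x := m))
  refine ⟨Fintype.card ι, z ∘ e, fun j => (e j).2.2 + (e j).2.1, fun j => ?_, fun m => ?_⟩
  · exact hG.smul_mem _ _ _ _ (hpow _) (h0 _ _)
  · obtain ⟨p, hp⟩ := hgen m
    refine ⟨p ∘ e, ?_⟩
    rw [hp, ← Equiv.sum_comp e]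
    rfl

theorem Generates.remove {ℳ : ℤ → AddSubgroup M} {n : ℕ} {b : Fin (n + 1) → M}
    {d : Fin (n + 1) → ℤ} (h : Generates (K := K) ℳ b d) {j₀ : Fin (n + 1)}
    {q : Fin (n + 1) → MvPolynomial (Fin 3) K} (hq0 : q j₀ = 0)
    (hq : b j₀ = ∑ j, noether K (q j) • b j) :
    Generates (K := K) ℳ (b ∘ j₀.succAbove) (d ∘ j₀.succAbove) := by
  refine ⟨fun j => h.1 _, fun m => ?_⟩
  obtain ⟨p, rfl⟩ := h.2 m
  refine ⟨fun j => p (j₀.succAbove j) + p j₀ * q (j₀.succAbove j), ?_⟩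
  rw [Fin.sum_univ_succAbove _ j₀, hq0, map_zero, zero_smul_R, zero_add] at hq
  rw [Fin.sum_univ_succAbove _ j₀]
  simp only [map_add, add_smul, map_mul, mul_smul, Finset.sum_add_distrib, ← Finset.smul_sum,
    Function.comp_apply]
  rw [← hq, add_comm]

/-- A minimal homogeneous generating family is linearly independent modulo `(Y₂, Y₃, Y₄)`. -/
theorem Generates.independent_mod {ℳ : ℤ → AddSubgroup M} (hG : IsGrading (K := K) ℳ) {n : ℕ}
    {b : Fin n → M} {d : Fin n → ℤ} (h : Generates (K := K) ℳ b d)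
    (hmin : ∀ n' (b' : Fin n' → M) (d' : Fin n' → ℤ), Generates (K := K) ℳ b' d' → n ≤ n')
    (c : Fin n → K) (m : Fin 3 → M)
    (hc : ∑ j, algebraMap K (R K) (c j) • b j = ∑ i, cl K (X (Fin.succ i)) • m i) : c = 0 := by
  by_contra hne
  obtain ⟨j₀, hj₀⟩ := Function.ne_iff.1 hne
  obtain ⟨π, h0, h1, h2, h3⟩ := exists_projections hG.isInternal
  obtain _ | n := n
  · exact j₀.elim0
  choose p hp using fun i => h.2 (m i)
  have hC : ∀ a : K, algebraMap K (R K) a = noether K (C a) := fun a => by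
    simp [noether]
  have e1 : π (d j₀) (∑ j, algebraMap K (R K) (c j) • b j) =
      ∑ j, noether K (homComp (d j₀ - d j) (C (c j))) • b j := by
    rw [map_sum]
    refine Finset.sum_congr rfl fun j _ => ?_
    rw [hC, proj_smul hG h1 h2 isGradedHom_noether _ (h.1 j)]
  have e2 : π (d j₀) (∑ i, cl K (X (Fin.succ i)) • m i) =
      ∑ j, noether K (homComp (d j₀ - d j) (∑ i, X i * p i j)) • b j := by
    have : ∑ i, cl K (X (Fin.succ i)) • m i = ∑ j, noether K (∑ i, X i * p i j) • b j := by
      simp only [map_sum, Finset.sum_smul, map_mul, mul_smul, noether_X]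
      rw [Finset.sum_comm]
      refine Finset.sum_congr rfl fun i _ => ?_
      rw [← Finset.smul_sum, ← hp]
    rw [this, map_sum]
    refine Finset.sum_congr rfl fun j _ => ?_
    rw [proj_smul hG h1 h2 isGradedHom_noether _ (h.1 j)]
  -- In degree d j₀ the coefficient of b j₀ is the scalar c j₀ on the left and zero on the right,
  -- where all coefficients lie in (Y₂, Y₃, Y₄). Hence b j₀ is a combination of the other
  -- generators, against minimality.
  have e3 : homComp (d j₀ - d j₀) (C (c j₀) : MvPolynomial (Fin 3) K) = C (c j₀) := by
    rw [sub_self]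
    simpa using homComp_natCast (K := K) 0 (C (c j₀) : MvPolynomial (Fin 3) K)
  have e4 : homComp (d j₀ - d j₀) (∑ i, X i * p i j₀) = 0 := by
    rw [sub_self]
    have := homComp_natCast (K := K) 0 (∑ i, X i * p i j₀)
    rw [Nat.cast_zero] at this
    rw [this, homogeneousComponent_zero, ← constantCoeff_eq, map_sum]
    simp
  have hc' := congrArg (π (d j₀)) hc
  rw [e1, e2, ← sub_eq_zero, ← Finset.sum_sub_distrib] at hc'
  have hq : b j₀ = ∑ j, noether K (if j = j₀ then 0 else -C (c j₀)⁻¹ *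
      (homComp (d j₀ - d j) (C (c j)) - homComp (d j₀ - d j) (∑ i, X i * p i j))) • b j := by
    rw [Fin.sum_univ_succAbove _ j₀] at hc' ⊢
    rw [e3, e4, map_zero, zero_smul_R, sub_zero] at hc'
    simp only [if_true, map_zero, zero_smul_R, zero_add, Fin.succAbove_ne, if_false, map_mul,
      mul_smul, map_sub, sub_smul, map_neg]
    rw [← Finset.smul_sum, ← neg_eq_of_add_eq_zero_right hc', smul_neg, neg_smul, neg_neg, smul_smul,
      ← map_mul, ← C_mul, inv_mul_cancel₀ hj₀, C_1, map_one, one_smul]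
  have := hmin _ _ _ (h.remove (by simp) hq)
  omega

/-- The linear forms in `Y₂, Y₃, Y₄`. -/
def linTail (K : Type*) [Field K] : (Fin 3 → K) →ₗ[K] R K :=
  Fintype.linearCombination K fun i => cl K (X (Fin.succ i))

theorem linTail_apply (v : Fin 3 → K) :
    linTail K v = ∑ i, algebraMap K (R K) (v i) * cl K (X (Fin.succ i)) := by
  rw [linTail, Fintype.linearCombination_apply]
  exact Finset.sum_congr rfl fun i _ => Algebra.smul_def (v i) (cl K (X (Fin.succ i)))

/-- Since Y₁³ is a polynomial without constant term in Y₂, Y₃, Y₄, a prime containing these contains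
Y₁. This is why linear forms in three variables suffice for prime avoidance. -/
theorem irrelevant_le_of_linTail_mem (p : Ideal (R K)) (hp : p.IsPrime)
    (h : ∀ v, linTail K v ∈ p) : irrelevant K ≤ p := by
  have hi : ∀ i : Fin 3, cl K (X i.succ) ∈ p := fun i => by
    have := h (Pi.single i 1)
    rw [linTail_apply, Finset.sum_eq_single_of_mem i (Finset.mem_univ _)] at this
    · simpa using this
    · intro j _ hj
      rw [Pi.single_eq_of_ne hj, map_zero, zero_mul]
  have h0 : cl K (X 0) ∈ p := by
    refine hp.mem_of_pow_mem 3 ?_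
    rw [cl_X_zero_pow_three, neg_mem_iff]
    simp only [g, map_add, map_pow, noether_X]
    exact p.add_mem (p.add_mem (p.pow_mem_of_mem (hi 0) 3 (by norm_num))
      (p.pow_mem_of_mem (hi 1) 3 (by norm_num))) (p.pow_mem_of_mem (hi 2) 3 (by norm_num))
  rw [irrelevant, Ideal.span_le]
  rintro _ ⟨i, rfl⟩
  exact Fin.cases h0 hi i

theorem mem_addRanges_linTail (v : Fin 3 → Fin 3 → K) {x : M}
    (hx : x ∈ addRanges (⊥ : Submodule (R K) M) (List.ofFn fun i => linTail K (v i))) :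
    ∃ m : Fin 3 → M, x = ∑ i, cl K (X (Fin.succ i)) • m i := by
  simp only [List.ofFn_succ, List.ofFn_zero, addRanges, bot_sup_eq] at hx
  obtain ⟨_, h, _, ⟨m₂, rfl⟩, rfl⟩ := Submodule.mem_sup.1 hx
  obtain ⟨_, ⟨m₀, rfl⟩, _, ⟨m₁, rfl⟩, rfl⟩ := Submodule.mem_sup.1 h
  refine ⟨fun i => algebraMap K (R K) (v 0 i) • m₀ + algebraMap K (R K) (v 1 i) • m₁ +
    algebraMap K (R K) (v 2 i) • m₂, ?_⟩
  simp only [LinearMap.lsmul_apply, linTail_apply, Finset.sum_smul, smul_add,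
    Finset.sum_add_distrib, smul_smul]
  simp only [mul_comm]
  rfl

/-- Three independent linear forms are a linear change of coordinates of K[Y₂, Y₃, Y₄]. Independence
over the polynomial ring in the forms thus transfers to the original variables. -/
theorem aeval_linTail_injective {v : Fin 3 → Fin 3 → K} (hv : LinearIndependent K v) :
    ∃ θ : MvPolynomial (Fin 3) K →ₐ[K] MvPolynomial (Fin 3) K, Function.Injective θ ∧
      ∀ p, noether K p = aeval (fun i => linTail K (v i)) (θ p) := by
  have hu : IsUnit (Matrix.of v) := Matrix.linearIndependent_rows_iff_isUnit.1 hv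
  have hu' : IsUnit (Matrix.of v).det := (Matrix.isUnit_iff_isUnit_det _).1 hu
  set D := (Matrix.of v)⁻¹ with hD
  have hDv : D * Matrix.of v = 1 := Matrix.nonsing_inv_mul _ hu'
  have hDv' : ∀ i j, ∑ k, D i k * v k j = if i = j then 1 else 0 := fun i j => by
    have := congrFun (congrFun hDv i) j
    rwa [Matrix.mul_apply, Matrix.one_apply] at this
  let θ : MvPolynomial (Fin 3) K →ₐ[K] MvPolynomial (Fin 3) K :=
    aeval fun i => ∑ k, C (D i k) * X k
  let θ' : MvPolynomial (Fin 3) K →ₐ[K] MvPolynomial (Fin 3) K :=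
    aeval fun k => ∑ i, C (v k i) * X i
  have hθ : θ'.comp θ = AlgHom.id K _ := by
    ext i : 1
    simp only [θ, θ', AlgHom.comp_apply, aeval_X, map_sum, map_mul, AlgHom.id_apply]
    simp only [algHom_C, algebraMap_eq, Finset.mul_sum, ← mul_assoc, ← C_mul]
    rw [Finset.sum_comm]
    simp only [← Finset.sum_mul, ← map_sum, hDv']
    simp
  refine ⟨θ, fun p q h => ?_, fun p => ?_⟩
  · have := congrArg θ' h
    rwa [← AlgHom.comp_apply, ← AlgHom.comp_apply, hθ] at this
  · rw [← AlgHom.comp_apply]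
    congr 1
    ext i : 1
    simp only [θ, AlgHom.comp_apply, aeval_X, map_sum, map_mul, noether_X, linTail_apply]
    simp only [algHom_C, Finset.mul_sum, ← mul_assoc, ← map_mul]
    rw [Finset.sum_comm]
    simp only [← Finset.sum_mul, ← map_sum, hDv']
    simp

/-- A graded maximal Cohen-Macaulay module is free over `K[Y₂, Y₃, Y₄]`, with a homogeneous
basis. -/
theorem exists_homogeneous_basis [CharZero K] {ℳ : ℤ → AddSubgroup M}
    (hG : IsGrading (K := K) ℳ) (hM : IsMCM K M) :
    ∃ (n : ℕ) (b : Fin n → M) (d : Fin n → ℤ), Generates (K := K) ℳ b d ∧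
      ∀ p : Fin n → MvPolynomial (Fin 3) K, ∑ j, noether K (p j) • b j = 0 → p = 0 := by
  classical
  obtain ⟨hfin, rs, hrs, hreg, hlen⟩ := hM
  have hex := exists_homogeneous_generators hG
  obtain ⟨b, d, hbd⟩ := Nat.find_spec hex
  have hmin : ∀ n' (b' : Fin n' → M) (d' : Fin n' → ℤ), Generates (K := K) ℳ b' d' →
      Nat.find hex ≤ n' := fun n' b' d' h' => Nat.find_min' hex ⟨b', d', h'⟩
  refine ⟨_, b, d, hbd, fun p hp => ?_⟩
  have hlen' : 3 ≤ rs.length := by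
    have := three_le_ringKrullDim (K := K)
    rw [← hlen] at this
    exact_mod_cast this
  obtain ⟨v, hv, hvreg⟩ := exists_regular_linear_sequence (M := M) (linTail K)
    irrelevant_le_of_linTail_mem (by simp) hrs hlen'
    (RegularOn.of_isWeaklyRegular hreg.toIsWeaklyRegular)
  obtain ⟨θ, hθ, hθ'⟩ := aeval_linTail_injective hv
  have := independent_of_regularOn b 3 _ ⊥ hvreg (fun c hc => by
    obtain ⟨m, hm⟩ := mem_addRanges_linTail v hc
    exact hbd.independent_mod hG hmin c m hm) (fun j => θ (p j)) (by
      rw [Submodule.mem_bot, ← hp]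
      exact Finset.sum_congr rfl fun j _ => by rw [hθ'])
  ext1 j
  exact hθ ((congrFun this j).trans (map_zero θ).symm)

end FermatCubic

end

/-! ### Torsion-freeness and the count of basis elements -/

noncomputable section

namespace FermatCubic

open MvPolynomial

section Generic

variable {A M : Type*} [CommRing A] [AddCommGroup M] [Module A M]

/-- If `N` annihilates the family `b`, then so does its determinant. -/
theorem det_smul_eq_zero_of_sum_smul_eq_zero {ι : Type*} [Fintype ι] [DecidableEq ι]
    {N : Matrix ι ι A} {b : ι → M} (h : ∀ j, ∑ i, N i j • b i = 0) (k : ι) :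
    N.det • b k = 0 := by
  have e : ∑ i, (N * N.adjugate) i k • b i = 0 := by
    simp only [Matrix.mul_apply, Finset.sum_smul]
    rw [Finset.sum_comm]
    refine Finset.sum_eq_zero fun j _ => ?_
    simp only [mul_comm (N _ j), mul_smul, ← Finset.smul_sum]
    rw [h, smul_zero]
  rw [Matrix.mul_adjugate, Finset.sum_eq_single_of_mem k (Finset.mem_univ k)] at e
  · simpa using e
  · intro i _ hi
    rw [Matrix.smul_apply, Matrix.one_apply_ne hi, smul_zero, zero_smul]

theorem det_eq_mul_det_submatrix_of_row_eq_zero {n : ℕ} {N : Matrix (Fin (n + 1)) (Fin (n + 1)) A}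
    {i : Fin (n + 1)} (h : ∀ j, j ≠ i → N i j = 0) :
    N.det = N i i * (N.submatrix i.succAbove i.succAbove).det := by
  rw [Matrix.det_succ_row N i, Finset.sum_eq_single_of_mem i (Finset.mem_univ i)]
  · rw [← two_mul, pow_mul]
    simp
  · intro j _ hj
    rw [h j hj]
    simp

/-- In a torsion-free module of rank one, a nonzero multiple of a given vector is a multiple
of any given nonzero vector. -/
theorem exists_smul_eq_smul_of_rank_eq_one [Nontrivial A] (hr : Module.rank A M = 1)
    (ht : ∀ (r : A) (m : M), r ≠ 0 → r • m = 0 → m = 0) {m₀ : M} (h0 : m₀ ≠ 0) (m : M) :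
    ∃ s r : A, s ≠ 0 ∧ s • m = r • m₀ := by
  have h : ¬ LinearIndependent A ![m₀, m] := by
    intro hli
    have := hli.cardinal_lift_le_rank
    rw [hr] at this
    simp at this
  rw [LinearIndependent.pair_iff] at h
  push Not at h
  obtain ⟨r, s, hrs, hne⟩ := h
  refine ⟨s, -r, fun hs => ?_, ?_⟩
  · rw [hs, zero_smul, add_zero] at hrs
    by_cases hr0 : r = 0
    · exact hne hr0 hs
    · exact h0 (ht r m₀ hr0 hrs)
  · rw [neg_smul]
    exact (neg_eq_of_add_eq_zero_right hrs).symm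

theorem spanFinrank_le_of_span_range_eq_top {ι : Type*} [Fintype ι] {b : ι → M}
    (h : Submodule.span A (Set.range b) = ⊤) :
    Submodule.spanFinrank (⊤ : Submodule A M) ≤ Fintype.card ι := by
  rw [← h]
  refine (Submodule.spanFinrank_span_le_ncard_of_finite (Set.finite_range b)).trans ?_
  rw [← Set.image_univ, ← Nat.card_eq_fintype_card, ← Set.ncard_univ]
  exact Set.ncard_image_le

end Generic

variable {K : Type*} [Field K] {M : Type*} [AddCommGroup M] [Module (R K) M]

/-- A nonzero r has a nonzero multiple in K[Y₂, Y₃, Y₄], over which M is free. -/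
theorem eq_zero_of_smul_eq_zero [CharZero K] {n : ℕ} {b : Fin n → M}
    (hb : ∀ m : M, ∃ p : Fin n → MvPolynomial (Fin 3) K, m = ∑ j, noether K (p j) • b j)
    (hi : ∀ p : Fin n → MvPolynomial (Fin 3) K, ∑ j, noether K (p j) • b j = 0 → p = 0)
    {r : R K} (hr : r ≠ 0) {m : M} (h : r • m = 0) : m = 0 := by
  obtain ⟨s, p, hp, hs⟩ := exists_mul_eq_noether hr
  obtain ⟨q, rfl⟩ := hb m
  have h1 : ∑ j, noether K (p * q j) • b j = 0 := by
    simp only [map_mul, mul_smul, ← Finset.smul_sum]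
    rw [← hs, mul_smul, h, smul_zero]
  have h2 := hi _ h1
  refine Finset.sum_eq_zero fun j _ => ?_
  rw [(mul_eq_zero.1 (congrFun h2 j)).resolve_left hp, map_zero, zero_smul_R]

/-- After multiplication by a common denominator, all b j lie in R₄m₀. Their coefficients, expanded
in 1, Y₁, Y₁², are vectors in a free module of rank 3 over K[Y₂, Y₃, Y₄], where four vectors are
dependent. -/
theorem card_le_three [CharZero K] {n : ℕ} {b : Fin n → M}
    (hb : ∀ m : M, ∃ p : Fin n → MvPolynomial (Fin 3) K, m = ∑ j, noether K (p j) • b j)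
    (hi : ∀ p : Fin n → MvPolynomial (Fin 3) K, ∑ j, noether K (p j) • b j = 0 → p = 0)
    (hr : Module.rank (R K) M = 1) : n ≤ 3 := by
  have ht : ∀ (r : R K) (m : M), r ≠ 0 → r • m = 0 → m = 0 := fun r m h0 h =>
    eq_zero_of_smul_eq_zero hb hi h0 h
  have : Nontrivial M := by
    by_contra hM
    rw [not_nontrivial_iff_subsingleton] at hM
    rw [rank_subsingleton'] at hr
    exact zero_ne_one hr
  obtain ⟨m₀, h0⟩ := exists_ne (0 : M)
  choose s r hs hsr using fun j => exists_smul_eq_smul_of_rank_eq_one hr ht h0 (b j)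
  choose u v w huvw using fun j => exists_noether_combination
    ((∏ i ∈ Finset.univ.erase j, s i) * r j)
  by_contra hn
  have hdep : ¬ LinearIndependent (MvPolynomial (Fin 3) K) fun j => ![u j, v j, w j] := by
    intro hli
    have := hli.fintype_card_le_finrank
    simp at this
    omega
  rw [Fintype.not_linearIndependent_iff] at hdep
  obtain ⟨c, hc, j, hj⟩ := hdep
  refine hj (congrFun (hi c (ht (∏ i, s i) _ (Finset.prod_ne_zero_iff.2 fun i _ => hs i) ?_)) j)
  have key : ∀ j, (∏ i, s i) • noether K (c j) • b j =
      (noether K (c j * u j) + noether K (c j * v j) * cl K (X 0) +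
        noether K (c j * w j) * cl K (X 0) ^ 2) • m₀ := by
    intro j
    rw [← Finset.mul_prod_erase _ s (Finset.mem_univ j), smul_smul,
      show s j * (∏ i ∈ Finset.univ.erase j, s i) * noether K (c j) =
        noether K (c j) * (∏ i ∈ Finset.univ.erase j, s i) * s j by ring, mul_smul, hsr, ← mul_smul,
      mul_assoc, huvw]
    congr 1
    simp only [map_mul]
    ring
  rw [Finset.smul_sum]
  simp only [key]
  rw [← Finset.sum_smul, Finset.sum_add_distrib, Finset.sum_add_distrib, ← Finset.sum_mul,
    ← Finset.sum_mul, ← map_sum, ← map_sum, ← map_sum]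
  have e0 : ∑ j, c j * u j = 0 := by simpa using congrFun hc 0
  have e1 : ∑ j, c j * v j = 0 := by simpa using congrFun hc 1
  have e2 : ∑ j, c j * w j = 0 := by simpa using congrFun hc 2
  rw [e0, e1, e2, map_zero, zero_mul, zero_mul, add_zero, add_zero, zero_smul_R]

theorem span_range_eq_top {n : ℕ} {b : Fin n → M}
    (hb : ∀ m : M, ∃ p : Fin n → MvPolynomial (Fin 3) K, m = ∑ j, noether K (p j) • b j) :
    Submodule.span (R K) (Set.range b) = ⊤ := by
  rw [eq_top_iff]
  rintro m -
  obtain ⟨p, rfl⟩ := hb m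
  exact Submodule.sum_mem _ fun j _ => Submodule.smul_mem _ _ (Submodule.subset_span ⟨j, rfl⟩)

end FermatCubic

end

/-! ### The matrix of multiplication by Y₁ -/

noncomputable section

namespace FermatCubic

open MvPolynomial

variable {K : Type*} [Field K] {M : Type*} [AddCommGroup M] [Module (R K) M]

/-- The elements of `b` form a basis of `M` over `K[Y₂, Y₃, Y₄]`. -/
def IsNoetherBasis (K : Type*) [Field K] {M : Type*} [AddCommGroup M] [Module (R K) M] {n : ℕ}
    (b : Fin n → M) : Prop :=
  (∀ m : M, ∃ p : Fin n → MvPolynomial (Fin 3) K, m = ∑ j, noether K (p j) • b j) ∧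
    ∀ p : Fin n → MvPolynomial (Fin 3) K, ∑ j, noether K (p j) • b j = 0 → p = 0

/-- `T` is the matrix of the multiplication by `Y₁`. -/
def IsMulMatrix {n : ℕ} (b : Fin n → M)
    (T : Matrix (Fin n) (Fin n) (MvPolynomial (Fin 3) K)) : Prop :=
  ∀ j, cl K (X 0) • b j = ∑ i, noether K (T i j) • b i

/-- The matrix `Y₁ - T` over `R₄`. -/
def relMatrix {n : ℕ} (T : Matrix (Fin n) (Fin n) (MvPolynomial (Fin 3) K)) :
    Matrix (Fin n) (Fin n) (R K) :=
  cl K (X 0) • (1 : Matrix (Fin n) (Fin n) (R K)) - T.map (noether K)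

theorem relMatrix_apply_self {n : ℕ} (T : Matrix (Fin n) (Fin n) (MvPolynomial (Fin 3) K))
    (i : Fin n) : relMatrix T i i = cl K (X 0) - noether K (T i i) := by
  simp [relMatrix]

theorem relMatrix_apply_ne {n : ℕ} (T : Matrix (Fin n) (Fin n) (MvPolynomial (Fin 3) K))
    {i j : Fin n} (h : i ≠ j) : relMatrix T i j = -noether K (T i j) := by
  simp [relMatrix, Matrix.one_apply_ne h]

/-- Projecting the expansion of Y₁b j to its degree yields another expansion, and uniqueness of
coordinates makes each entry homogeneous of the predicted degree. -/
theorem exists_isMulMatrix {ℳ : ℤ → AddSubgroup M} (hG : IsGrading (K := K) ℳ) {n : ℕ}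
    {b : Fin n → M} {d : Fin n → ℤ} (hb : IsNoetherBasis K b) (hd : ∀ j, b j ∈ ℳ (d j)) :
    ∃ T : Matrix (Fin n) (Fin n) (MvPolynomial (Fin 3) K), IsMulMatrix b T ∧
      ∀ i j, T i j = homComp (1 + d j - d i) (T i j) := by
  obtain ⟨π, h0, h1, h2, h3⟩ := exists_projections hG.isInternal
  choose T hT using fun j => hb.1 (cl K (X 0) • b j)
  refine ⟨fun i j => T j i, hT, fun i j => ?_⟩
  have hy : cl K (X 0) • b j ∈ ℳ (1 + d j) :=
    hG.smul_mem _ _ _ _ (isGradedHom_cl 1 _ (isHomogeneous_X K 0)) (hd j)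
  have e := h1 _ _ hy
  rw [hT, map_sum] at e
  have e' : ∑ i, noether K (homComp (1 + d j - d i) (T j i) - T j i) • b i = 0 := by
    simp only [map_sub, sub_smul, Finset.sum_sub_distrib]
    rw [sub_eq_zero, ← e]
    exact Finset.sum_congr rfl fun i _ =>
      (proj_smul hG h1 h2 isGradedHom_noether _ (hd i) _).symm
  exact (sub_eq_zero.1 (congrFun (hb.2 _ e') i)).symm

theorem sum_relMatrix_smul {n : ℕ} {b : Fin n → M}
    {T : Matrix (Fin n) (Fin n) (MvPolynomial (Fin 3) K)} (hT : IsMulMatrix b T) (j : Fin n) :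
    ∑ i, relMatrix T i j • b i = 0 := by
  have : ∀ i, relMatrix T i j • b i =
      (if i = j then cl K (X 0) • b i else 0) - noether K (T i j) • b i := by
    intro i
    split_ifs with h
    · subst h
      rw [relMatrix_apply_self, sub_smul]
    · rw [relMatrix_apply_ne _ h, neg_smul, zero_sub]
  simp only [this, Finset.sum_sub_distrib]
  rw [Finset.sum_ite_eq' Finset.univ j, if_pos (Finset.mem_univ j), hT, sub_self]

theorem IsNoetherBasis.ne_zero {n : ℕ} {b : Fin n → M} (hb : IsNoetherBasis K b) (i : Fin n) :
    b i ≠ 0 := by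
  intro h0
  have := congrFun (hb.2 (Pi.single i 1) (Finset.sum_eq_zero fun j _ => by
    by_cases hj : j = i
    · rw [hj, h0, smul_zero]
    · rw [Pi.single_eq_of_ne hj, map_zero, zero_smul_R])) i
  simp at this

theorem det_relMatrix [CharZero K] {n : ℕ} {b : Fin (n + 1) → M} (hb : IsNoetherBasis K b)
    {T : Matrix (Fin (n + 1)) (Fin (n + 1)) (MvPolynomial (Fin 3) K)} (hT : IsMulMatrix b T) :
    (relMatrix T).det = 0 := by
  by_contra hne
  exact hb.ne_zero 0 (eq_zero_of_smul_eq_zero hb.1 hb.2 hne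
    (det_smul_eq_zero_of_sum_smul_eq_zero (sum_relMatrix_smul hT) 0))

/-- Such an entry has degree at most 0. A nonzero constant would express b i through the other two
elements over R₄, contradicting the minimal number of generators. -/
theorem apply_eq_zero_of_lt {b : Fin 3 → M} {d : Fin 3 → ℤ}
    (hb : IsNoetherBasis K b) (h3 : ThreeGenerated K M)
    {T : Matrix (Fin 3) (Fin 3) (MvPolynomial (Fin 3) K)} (hT : IsMulMatrix b T)
    (hhom : ∀ i j, T i j = homComp (1 + d j - d i) (T i j)) {i j : Fin 3} (hij : d j < d i) :
    T i j = 0 := by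
  obtain h | h : 1 + d j - d i < 0 ∨ 1 + d j - d i = 0 := by omega
  · rw [hhom, homComp_of_neg h]
  have hne : i ≠ j := by rintro rfl; omega
  have hC : T i j = C (coeff 0 (T i j)) := by
    conv_lhs => rw [hhom, h]
    have := homComp_natCast (K := K) 0 (T i j)
    rw [Nat.cast_zero] at this
    rw [this, homogeneousComponent_zero]
  by_contra h0
  set c := coeff 0 (T i j) with hc
  have hc0 : c ≠ 0 := fun h => h0 (by rw [hC, h, C_0])
  have hmem : b i ∈ Submodule.span (R K) (Set.range (b ∘ i.succAbove)) := by
    have hk : ∀ k, k ≠ i → b k ∈ Submodule.span (R K) (Set.range (b ∘ i.succAbove)) := by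
      intro k hk
      obtain ⟨l, rfl⟩ := Fin.exists_succAbove_eq hk
      exact Submodule.subset_span ⟨l, rfl⟩
    have e := hT j
    rw [Fin.sum_univ_succAbove _ i, ← sub_eq_iff_eq_add] at e
    have : b i = noether K (C c⁻¹) • (cl K (X 0) • b j -
        ∑ l, noether K (T (i.succAbove l) j) • b (i.succAbove l)) := by
      rw [e, hC, smul_smul, ← map_mul, ← C_mul, inv_mul_cancel₀ hc0, C_1, map_one, one_smul]
    rw [this]
    exact Submodule.smul_mem _ _ (Submodule.sub_mem _ (Submodule.smul_mem _ _ (hk j hne.symm))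
      (Submodule.sum_mem _ fun l _ => Submodule.smul_mem _ _ (Submodule.subset_span ⟨l, rfl⟩)))
  have hspan : Submodule.span (R K) (Set.range (b ∘ i.succAbove)) = ⊤ := by
    rw [eq_top_iff, ← span_range_eq_top hb.1, Submodule.span_le]
    rintro _ ⟨k, rfl⟩
    by_cases hk : k = i
    · exact hk ▸ hmem
    · obtain ⟨l, rfl⟩ := Fin.exists_succAbove_eq hk
      exact Submodule.subset_span ⟨l, rfl⟩
  have := spanFinrank_le_of_span_range_eq_top hspan
  rw [h3, Fintype.card_fin] at this
  omega

theorem cl_X_zero_sub_noether_ne_zero (p : MvPolynomial (Fin 3) K) :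
    cl K (X 0) - noether K p ≠ 0 := by
  intro h
  have := noether_combination_eq_zero (K := K) (a := -p) (b := 1) (c := 0) (by
    simp only [map_neg, map_one, map_zero]
    linear_combination h)
  exact one_ne_zero this.2.1

/-- A strictly largest degree makes a row of Y₁ - T vanish off the diagonal, so the zero determinant
factors in the domain R₄ into a linear and a quadratic factor, both monic in Y₁ and hence nonzero. A
strictly smallest degree makes b i an eigenvector, killed by the nonzero element Y₁ - T i i. Three
integers with no strict maximum and no strict minimum are equal. -/
theorem degrees_eq [CharZero K] {b : Fin 3 → M} {d : Fin 3 → ℤ}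
    (hb : IsNoetherBasis K b) {T : Matrix (Fin 3) (Fin 3) (MvPolynomial (Fin 3) K)}
    (hT : IsMulMatrix b T) (hlt : ∀ i j, d j < d i → T i j = 0) (i j : Fin 3) : d i = d j := by
  have hdet := det_relMatrix hb hT
  have hmax : ∀ i, ¬ ∀ j, j ≠ i → d j < d i := by
    intro i h
    rw [det_eq_mul_det_submatrix_of_row_eq_zero (i := i) fun j hj => by
      rw [relMatrix_apply_ne _ hj.symm, hlt i j (h j hj), map_zero, neg_zero],
      relMatrix_apply_self, Matrix.det_fin_two] at hdet
    have h01 : i.succAbove 0 ≠ i.succAbove 1 := fun h =>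
      absurd (Fin.succAbove_right_injective h) (by decide)
    simp only [Matrix.submatrix_apply] at hdet
    rw [relMatrix_apply_self, relMatrix_apply_self, relMatrix_apply_ne _ h01,
      relMatrix_apply_ne _ h01.symm] at hdet
    set p := T (i.succAbove 0) (i.succAbove 0)
    set q := T (i.succAbove 0) (i.succAbove 1)
    set r := T (i.succAbove 1) (i.succAbove 0)
    set s := T (i.succAbove 1) (i.succAbove 1)
    have := noether_combination_eq_zero (K := K) (a := p * s - q * r) (b := -(p + s)) (c := 1) (by
      simp only [map_neg, map_one, map_sub, map_mul, map_add]
      linear_combination (mul_eq_zero.1 hdet).resolve_left (cl_X_zero_sub_noether_ne_zero _))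
    exact one_ne_zero this.2.2
  have hmin : ∀ i, ¬ ∀ j, j ≠ i → d i < d j := by
    intro i h
    have e : (cl K (X 0) - noether K (T i i)) • b i = 0 := by
      rw [sub_smul, hT, Finset.sum_eq_single_of_mem i (Finset.mem_univ i), sub_self]
      intro j _ hj
      rw [hlt j i (h j hj), map_zero, zero_smul_R]
    exact hb.ne_zero i (eq_zero_of_smul_eq_zero hb.1 hb.2 (cl_X_zero_sub_noether_ne_zero _) e)
  have a0 := hmax 0
  have a1 := hmax 1
  have a2 := hmax 2
  have b0 := hmin 0
  have b1 := hmin 1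
  have b2 := hmin 2
  simp [Fin.forall_fin_succ] at a0 a1 a2 b0 b1 b2
  have : d 0 = d 1 ∧ d 0 = d 2 := by omega
  fin_cases i <;> fin_cases j <;> simp <;> omega

end FermatCubic

end

/-! ### The determinantal presentation of the module -/

noncomputable section

namespace FermatCubic

open MvPolynomial

variable {K : Type*} [Field K] {M : Type*} [AddCommGroup M] [Module (R K) M]

/-- The matrix of linear forms with coefficient matrices `Φ`. -/
def ofCoeffs (Φ : Fin 4 → Matrix (Fin 3) (Fin 3) K) : Matrix (Fin 3) (Fin 3) (S K) :=
  Matrix.of fun i j => lin fun k => Φ k i j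

theorem ofCoeffs_coeffs {φ : Matrix (Fin 3) (Fin 3) (S K)} (h : ∀ i j, (φ i j).IsHomogeneous 1) :
    ofCoeffs (coeffs φ) = φ := by
  ext1 i j
  exact (eq_lin_of_isHomogeneous (h i j)).symm

theorem ofCoeffs_mul_mul (Φ : Fin 4 → Matrix (Fin 3) (Fin 3) K) (U V : Matrix (Fin 3) (Fin 3) K) :
    ofCoeffs (fun k => U * Φ k * V) = U.map C * ofCoeffs Φ * V.map C := by
  ext1 i j
  simp only [ofCoeffs, Matrix.of_apply, Matrix.mul_apply, lin_apply, Fin.sum_univ_three,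
    Matrix.map_apply, map_add, map_mul]
  ring

theorem mem_image_iff {φ : Matrix (Fin 3) (Fin 3) (S K)} {v : Fin 3 → R K} :
    v ∈ image φ ↔ ∃ w, (φ.map (cl K)).mulVec w = v := Iff.rfl

theorem eq_sum_of_isHomogeneous_one {p : MvPolynomial (Fin 3) K} (h : p.IsHomogeneous 1) :
    ∃ c : Fin 3 → K, p = ∑ k, C (c k) * X k := by
  have : p ∈ Submodule.span K (Set.range (X : Fin 3 → MvPolynomial (Fin 3) K)) := by
    rw [← homogeneousSubmodule_one_eq_span_X]
    exact h
  obtain ⟨c, rfl⟩ := (Submodule.mem_span_range_iff_exists_fun K).1 this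
  exact ⟨c, Finset.sum_congr rfl fun k _ => smul_eq_C_mul _ _⟩

/-- A matrix of linear forms in `Y₂, Y₃, Y₄` representing the multiplication by `Y₁` gives a
determinantal representation of the Fermat cubic. -/
theorem exists_coeffs [CharZero K] {b : Fin 3 → M} (hb : IsNoetherBasis K b)
    {T : Matrix (Fin 3) (Fin 3) (MvPolynomial (Fin 3) K)} (hT : IsMulMatrix b T)
    (hhom : ∀ i j, (T i j).IsHomogeneous 1) :
    ∃ Φ : Fin 4 → Matrix (Fin 3) (Fin 3) K, Φ 0 = 1 ∧ (∀ y, (ev Φ y).det = cub y) ∧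
      (ofCoeffs Φ).map (cl K) = relMatrix T := by
  choose t ht using fun i j => eq_sum_of_isHomogeneous_one (hhom i j)
  let Φ : Fin 4 → Matrix (Fin 3) (Fin 3) K :=
    Fin.cons 1 fun k => Matrix.of fun i j => -t i j k
  have hΦ : ∀ i j, ofCoeffs Φ i j =
      (if i = j then X 0 else 0) - rename Fin.succ (T i j) := by
    intro i j
    rw [ht, ofCoeffs, Matrix.of_apply, lin_apply]
    have e1 : Φ 1 i j = -t i j 0 := rfl
    have e2 : Φ 2 i j = -t i j 1 := rfl
    have e3 : Φ 3 i j = -t i j 2 := rfl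
    have e0 : Φ 0 i j = if i = j then 1 else 0 := Matrix.one_apply
    rw [e0, e1, e2, e3, Fin.sum_univ_three]
    simp only [map_add, map_mul, rename_C, rename_X, map_neg, Fin.succ_zero_eq_one,
      Fin.succ_one_eq_two, show Fin.succ (2 : Fin 3) = (3 : Fin 4) from rfl]
    split_ifs <;> simp <;> ring
  have hev : ∀ y i j, ev Φ y i j =
      (if i = j then y 0 else 0) - eval (fun k : Fin 3 => y k.succ) (T i j) := by
    intro y i j
    have : ev Φ y i j = eval y (ofCoeffs Φ i j) := by
      rw [ev_apply, ofCoeffs, Matrix.of_apply, eval_lin]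
      ring
    rw [this, hΦ, map_sub, eval_rename]
    split_ifs <;> simp [Function.comp_def]
  have hrel : (ofCoeffs Φ).map (cl K) = relMatrix T := by
    ext1 i j
    rw [Matrix.map_apply, hΦ, map_sub]
    by_cases hij : i = j
    · subst hij
      rw [if_pos rfl, relMatrix_apply_self]
      rfl
    · rw [if_neg hij, relMatrix_apply_ne _ hij, map_zero, zero_sub]
      rfl
  refine ⟨Φ, rfl, fun y => ?_, hrel⟩
  have hdet := det_relMatrix hb hT
  rw [Matrix.det_fin_three] at hdet
  simp only [relMatrix_apply_self, relMatrix_apply_ne T (show (0 : Fin 3) ≠ 1 by decide),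
    relMatrix_apply_ne T (show (0 : Fin 3) ≠ 2 by decide),
    relMatrix_apply_ne T (show (1 : Fin 3) ≠ 0 by decide),
    relMatrix_apply_ne T (show (1 : Fin 3) ≠ 2 by decide),
    relMatrix_apply_ne T (show (2 : Fin 3) ≠ 0 by decide),
    relMatrix_apply_ne T (show (2 : Fin 3) ≠ 1 by decide)] at hdet
  -- The determinant is a monic cubic in Y₁ that vanishes in R₄. Replacing Y₁³ by -(Y₂³ + Y₃³ + Y₄³)
  -- and comparing coefficients of 1, Y₁, Y₁² identifies it with f₄.
  obtain ⟨ha, hb', hc⟩ := noether_combination_eq_zero (K := K) (a := -g K - T.det)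
    (b := T 0 0 * T 1 1 + T 0 0 * T 2 2 + T 1 1 * T 2 2 - T 0 1 * T 1 0 - T 0 2 * T 2 0 -
      T 1 2 * T 2 1) (c := -(T 0 0 + T 1 1 + T 2 2)) (by
    rw [Matrix.det_fin_three]
    simp only [map_neg, map_sub, map_mul, map_add]
    linear_combination hdet - cl_X_zero_pow_three (K := K))
  rw [Matrix.det_fin_three] at ha
  have ha' := congrArg (eval fun k : Fin 3 => y k.succ) ha
  have hb'' := congrArg (eval fun k : Fin 3 => y k.succ) hb'
  have hc' := congrArg (eval fun k : Fin 3 => y k.succ) hc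
  simp only [g, map_neg, map_sub, map_mul, map_add, map_pow, map_zero, eval_X] at ha' hb'' hc'
  simp only [Fin.succ_zero_eq_one, Fin.succ_one_eq_two,
    show Fin.succ (2 : Fin 3) = (3 : Fin 4) from rfl] at ha' hb'' hc'
  rw [Matrix.det_fin_three]
  simp only [hev, if_true, show ¬ (0 : Fin 3) = 1 by decide, show ¬ (0 : Fin 3) = 2 by decide,
    show ¬ (1 : Fin 3) = 0 by decide, show ¬ (1 : Fin 3) = 2 by decide,
    show ¬ (2 : Fin 3) = 0 by decide, show ¬ (2 : Fin 3) = 1 by decide, if_false, cub]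
  linear_combination ha' + y 0 * hb'' + y 0 ^ 2 * hc'

theorem relMatrix_mulVec {n : ℕ} (T : Matrix (Fin n) (Fin n) (MvPolynomial (Fin 3) K))
    (v : Fin n → R K) :
    (relMatrix T).mulVec v = cl K (X 0) • v - (T.map (noether K)).mulVec v := by
  rw [relMatrix, Matrix.sub_mulVec, Matrix.smul_mulVec, Matrix.one_mulVec]

/-- Modulo the columns of `Y₁ - T`, every vector has entries in `K[Y₂, Y₃, Y₄]`. -/
theorem exists_sub_mem_range {n : ℕ} (T : Matrix (Fin n) (Fin n) (MvPolynomial (Fin 3) K))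
    (v : Fin n → R K) : ∃ p : Fin n → MvPolynomial (Fin 3) K,
      v - (fun i => noether K (p i)) ∈ LinearMap.range (Matrix.mulVecLin (relMatrix T)) := by
  set Q := LinearMap.range (Matrix.mulVecLin (relMatrix T)) with hQ
  -- Modulo the columns of Y₁ - T, multiplication by Y₁ acts as T on vectors over K[Y₂, Y₃, Y₄]; so
  -- u + vY₁ + wY₁² acts as u + vT + wT².
  have hy : ∀ p : Fin n → MvPolynomial (Fin 3) K,
      cl K (X 0) • (fun i => noether K (p i)) - (fun i => noether K (T.mulVec p i)) ∈ Q := by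
    intro p
    refine ⟨fun i => noether K (p i), ?_⟩
    rw [Matrix.mulVecLin_apply, relMatrix_mulVec]
    congr 1
    ext1 i
    simp [Matrix.mulVec, dotProduct]
  have hr : ∀ (r : R K) (p : Fin n → MvPolynomial (Fin 3) K),
      ∃ q : Fin n → MvPolynomial (Fin 3) K,
        r • (fun i => noether K (p i)) - (fun i => noether K (q i)) ∈ Q := by
    intro r p
    obtain ⟨u, v, w, rfl⟩ := exists_noether_combination r
    refine ⟨u • p + v • T.mulVec p + w • T.mulVec (T.mulVec p), ?_⟩
    have h1 := Q.smul_mem (noether K v + noether K w * cl K (X 0)) (hy p)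
    have h2 := Q.smul_mem (noether K w) (hy (T.mulVec p))
    convert Q.add_mem h1 h2 using 1
    ext1 i
    simp only [Pi.sub_apply, Pi.smul_apply, Pi.add_apply, smul_eq_mul, map_add, map_mul]
    ring
  choose q hq using fun j => hr (v j) (Pi.single j 1)
  refine ⟨∑ j, q j, ?_⟩
  convert Q.sum_mem fun j (_ : j ∈ Finset.univ) => hq j using 1
  ext1 i
  rw [Finset.sum_apply]
  simp only [Pi.sub_apply, Pi.smul_apply, Finset.sum_apply, Finset.sum_sub_distrib, map_sum,
    smul_eq_mul]
  congr 1
  rw [Finset.sum_eq_single_of_mem i (Finset.mem_univ i)]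
  · rw [Pi.single_eq_same, map_one, mul_one]
  · intro j _ hj
    rw [Pi.single_eq_of_ne hj.symm, map_zero, mul_zero]

/-- A relation is reduced modulo the columns to one with entries in K[Y₂, Y₃, Y₄], and freeness
makes that one trivial. -/
theorem sum_smul_eq_zero_iff {n : ℕ} {b : Fin n → M} (hb : IsNoetherBasis K b)
    {T : Matrix (Fin n) (Fin n) (MvPolynomial (Fin 3) K)} (hT : IsMulMatrix b T)
    (v : Fin n → R K) :
    ∑ i, v i • b i = 0 ↔ v ∈ LinearMap.range (Matrix.mulVecLin (relMatrix T)) := by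
  have hrange : ∀ v ∈ LinearMap.range (Matrix.mulVecLin (relMatrix T)), ∑ i, v i • b i = 0 := by
    rintro _ ⟨w, rfl⟩
    simp only [Matrix.mulVecLin_apply, Matrix.mulVec, dotProduct, Finset.sum_smul]
    rw [Finset.sum_comm]
    refine Finset.sum_eq_zero fun j _ => ?_
    simp only [mul_comm _ (w j), mul_smul, ← Finset.smul_sum]
    rw [sum_relMatrix_smul hT, smul_zero]
  refine ⟨fun h => ?_, hrange v⟩
  obtain ⟨p, hp⟩ := exists_sub_mem_range T v
  have h' := hrange _ hp
  simp only [Pi.sub_apply, sub_smul, Finset.sum_sub_distrib, h, zero_sub, neg_eq_zero] at h'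
  have hp0 := hb.2 p h'
  have : (fun i => noether K (p i)) = 0 := by
    ext1 i
    rw [hp0]
    exact map_zero _
  rwa [this, sub_zero] at hp

/-- The presentation of a graded maximal Cohen-Macaulay module of rank one with three
generators by a linear determinantal representation of the Fermat cubic. -/
theorem exists_linear_presentation [CharZero K] {ℳ : ℤ → AddSubgroup M}
    (hG : IsGrading (K := K) ℳ) (hM : IsMCM K M) (hr : Module.rank (R K) M = 1)
    (h3 : ThreeGenerated K M) :
    ∃ (b : Fin 3 → M) (s : ℤ) (Φ : Fin 4 → Matrix (Fin 3) (Fin 3) K), Φ 0 = 1 ∧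
      (∀ y, (ev Φ y).det = cub y) ∧ (∀ i, b i ∈ ℳ s) ∧
      Submodule.span (R K) (Set.range b) = ⊤ ∧
      ∀ v : Fin 3 → R K, ∑ i, v i • b i = 0 ↔ v ∈ image (ofCoeffs Φ) := by
  obtain ⟨n, b, d, ⟨hd, hgen⟩, hi⟩ := exists_homogeneous_basis hG hM
  have hn : n ≤ 3 := card_le_three hgen hi hr
  have hn' := spanFinrank_le_of_span_range_eq_top (span_range_eq_top hgen)
  rw [h3, Fintype.card_fin] at hn'
  obtain rfl : n = 3 := by omega
  have hb : IsNoetherBasis K b := ⟨hgen, hi⟩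
  obtain ⟨T, hT, hhom⟩ := exists_isMulMatrix hG hb hd
  have hdeg := degrees_eq hb hT fun i j h => apply_eq_zero_of_lt hb h3 hT hhom h
  obtain ⟨Φ, h1, hdet, hrel⟩ := exists_coeffs hb hT fun i j => by
    rw [hhom, hdeg i j]
    simpa using isHomogeneous_homComp (m := 1) (T i j)
  refine ⟨b, d 0, Φ, h1, hdet, fun i => hdeg i 0 ▸ hd i, span_range_eq_top hgen, fun v => ?_⟩
  rw [sum_smul_eq_zero_iff hb hT, ← hrel]
  rfl

end FermatCubic

end

/-! ### Graded isomorphism with the cokernel -/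

noncomputable section

namespace FermatCubic

open MvPolynomial

variable {K : Type*} [Field K] {M : Type*} [AddCommGroup M] [Module (R K) M]

theorem homComp_mem_piece (k : ℤ) (p : S K) : cl K (homComp k p) ∈ piece K k := by
  obtain hk | hk := lt_or_ge k 0
  · rw [homComp_of_neg hk, map_zero]
    exact zero_mem _
  · obtain ⟨n, rfl⟩ := Int.eq_ofNat_of_zero_le hk
    rw [homComp_natCast]
    exact isGradedHom_cl n _ (homogeneousComponent_isHomogeneous n p)

/-- A presentation with generators in the same degree is an isomorphism of graded modules. -/
theorem exists_equiv_of_presentation {ℳ : ℤ → AddSubgroup M} (hG : IsGrading (K := K) ℳ)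
    {φ : Matrix (Fin 3) (Fin 3) (S K)} {b : Fin 3 → M} {s : ℤ} (hs : ∀ i, b i ∈ ℳ s)
    (hspan : Submodule.span (R K) (Set.range b) = ⊤)
    (hker : ∀ v : Fin 3 → R K, ∑ i, v i • b i = 0 ↔ v ∈ image φ) :
    ∃ (e : Coker φ ≃ₗ[R K] M) (s : ℤ), ∀ (k : ℤ) (x : Coker φ),
      x ∈ cokerPiece φ k ↔ e x ∈ ℳ (k + s) := by
  let L : (Fin 3 → R K) →ₗ[R K] M := Fintype.linearCombination (R K) b
  have hL : ∀ v, L v = ∑ i, v i • b i := fun v => Fintype.linearCombination_apply (R K) b v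
  have hLs : Function.Surjective L := by
    rw [← LinearMap.range_eq_top, Fintype.range_linearCombination, hspan]
  have hLk : image φ = LinearMap.ker L := by
    ext v
    rw [LinearMap.mem_ker, hL, hker]
  let e : Coker φ ≃ₗ[R K] M :=
    (Submodule.quotEquivOfEq _ _ hLk).trans (L.quotKerEquivOfSurjective hLs)
  have he : ∀ v, e ((image φ).mkQ v) = ∑ i, v i • b i := fun v => hL v
  refine ⟨e, s, fun k x => ⟨?_, fun hx => ?_⟩⟩
  · rintro ⟨v, hv, rfl⟩
    rw [he]
    exact AddSubgroup.sum_mem _ fun i _ => hG.smul_mem _ _ _ _ (hv i) (hs i)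
  · obtain ⟨π, h0, h1, h2, h3⟩ := exists_projections hG.isInternal
    obtain ⟨v, rfl⟩ := (image φ).mkQ_surjective x
    choose p hp using fun i => cl_surjective K (v i)
    -- All generators have degree s, so keeping the degree k part of each coordinate projects the
    -- image to degree k + s, where it already lies.
    refine ⟨fun i => cl K (homComp k (p i)), fun i => homComp_mem_piece k _, e.injective ?_⟩
    rw [← h1 _ _ hx, he, he, map_sum]
    refine Finset.sum_congr rfl fun i _ => ?_
    rw [← hp, proj_smul hG h1 h2 isGradedHom_cl _ (hs i), add_sub_cancel_right]

theorem presentation_of_equivalent {ℳ : ℤ → AddSubgroup M} (hG : IsGrading (K := K) ℳ)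
    {Φ Ψ : Fin 4 → Matrix (Fin 3) (Fin 3) K} (h : Equivalent Φ Ψ) {b : Fin 3 → M} {s : ℤ}
    (hs : ∀ i, b i ∈ ℳ s) (hspan : Submodule.span (R K) (Set.range b) = ⊤)
    (hker : ∀ v : Fin 3 → R K, ∑ i, v i • b i = 0 ↔ v ∈ image (ofCoeffs Φ)) :
    ∃ b' : Fin 3 → M, (∀ i, b' i ∈ ℳ s) ∧ Submodule.span (R K) (Set.range b') = ⊤ ∧
      ∀ v : Fin 3 → R K, ∑ i, v i • b' i = 0 ↔ v ∈ image (ofCoeffs Ψ) := by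
  obtain ⟨U, V, hU, hV, h⟩ := h
  obtain rfl : Ψ = fun k => U * Φ k * V := funext h
  let κ : Matrix (Fin 3) (Fin 3) K →+* Matrix (Fin 3) (Fin 3) (R K) :=
    (algebraMap K (R K)).mapMatrix
  have hUi : κ U⁻¹ * κ U = 1 := by
    rw [← map_mul, Matrix.nonsing_inv_mul _ (isUnit_iff_ne_zero.2 hU), map_one]
  have hUi' : κ U * κ U⁻¹ = 1 := by
    rw [← map_mul, Matrix.mul_nonsing_inv _ (isUnit_iff_ne_zero.2 hU), map_one]
  have hVi : κ V * κ V⁻¹ = 1 := by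
    rw [← map_mul, Matrix.mul_nonsing_inv _ (isUnit_iff_ne_zero.2 hV), map_one]
  -- Left multiplication of the presentation matrix by U corresponds to changing the generators by
  -- U⁻¹. The entries are scalars, so the degree stays s; V only recombines the relations.
  let b' : Fin 3 → M := fun j => ∑ i, κ U⁻¹ i j • b i
  have hsum : ∀ v : Fin 3 → R K, ∑ j, v j • b' j = ∑ i, (κ U⁻¹).mulVec v i • b i := by
    intro v
    simp only [b', Finset.smul_sum, smul_smul, Matrix.mulVec, dotProduct, Finset.sum_smul]
    rw [Finset.sum_comm]
    simp only [mul_comm]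
  have hmap : (ofCoeffs fun k => U * Φ k * V).map (cl K) = κ U * (ofCoeffs Φ).map (cl K) * κ V := by
    rw [ofCoeffs_mul_mul]
    have hκ : ∀ W : Matrix (Fin 3) (Fin 3) K, (W.map C).map (cl K) = κ W := fun W => rfl
    rw [← hκ, ← hκ]
    exact (Matrix.map_mul (f := cl K)).trans (congrArg (· * _) (Matrix.map_mul (f := cl K)))
  refine ⟨b', fun j => AddSubgroup.sum_mem _ fun i _ => ?_, ?_, fun v => ?_⟩
  · have : κ U⁻¹ i j ∈ piece K 0 := isGradedHom_cl 0 _ (isHomogeneous_C (Fin 4) (U⁻¹ i j))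
    simpa using hG.smul_mem _ _ _ _ this (hs i)
  · rw [eq_top_iff, ← hspan, Submodule.span_le]
    rintro _ ⟨i, rfl⟩
    have e : b i = ∑ j, κ U j i • b' j := by
      rw [hsum fun j => κ U j i]
      have : ∀ j, (κ U⁻¹).mulVec (fun j => κ U j i) j = if j = i then 1 else 0 := fun j => by
        rw [← Matrix.one_apply, ← hUi]
        rfl
      rw [Finset.sum_eq_single_of_mem i (Finset.mem_univ i)]
      · rw [this, if_pos rfl, one_smul]
      · intro j _ hj
        rw [this, if_neg hj, zero_smul_R]
    rw [e]
    exact Submodule.sum_mem _ fun j _ => Submodule.smul_mem _ _ (Submodule.subset_span ⟨j, rfl⟩)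
  · rw [hsum, hker, mem_image_iff, mem_image_iff, hmap]
    constructor
    · rintro ⟨w, hw⟩
      refine ⟨(κ V⁻¹).mulVec w, ?_⟩
      rw [Matrix.mulVec_mulVec, Matrix.mul_assoc, hVi, Matrix.mul_one, ← Matrix.mulVec_mulVec, hw,
        Matrix.mulVec_mulVec, hUi', Matrix.one_mulVec]
    · rintro ⟨w, rfl⟩
      refine ⟨(κ V).mulVec w, ?_⟩
      rw [Matrix.mulVec_mulVec, Matrix.mulVec_mulVec, ← Matrix.mul_assoc, ← Matrix.mul_assoc, hUi,
        Matrix.one_mul]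

end FermatCubic

end

/-! ### Assembly of the three statements -/

theorem mainTheorem2 {K : Type*} [Field K] [IsAlgClosed K] [CharZero K] :
    -- every graded MCM module of rank one with three generators
    (∀ (M : Type*) [AddCommGroup M] [Module (R K) M] (ℳ : ℤ → AddSubgroup M),
      IsGrading (K := K) ℳ → IsMCM K M → Module.rank (R K) M = 1 → ThreeGenerated K M →
      ∃ (i j : Fin 4) (α β γ δ m n w t : S K),
        1 ≤ i ∧ 1 ≤ j ∧ α ∈ 𝓛 K 0 ∧ γ ∈ 𝓛 K 0 ∧ β ∈ 𝓛 K j ∧ δ ∈ 𝓛 K i ∧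
        LinearIndependent K ![α, β, γ, δ] ∧
        m.IsHomogeneous 1 ∧ n.IsHomogeneous 1 ∧ w.IsHomogeneous 1 ∧ t.IsHomogeneous 1 ∧
        IsMatrixFactorizationOf ℳ !![0, α, β; γ, m, n; δ, w, t]
          (Matrix.adjugate !![0, α, β; γ, m, n; δ, w, t]) ∧
        Listed !![0, α, β; γ, m, n; δ, w, t]) ∧
    -- the conditions of linear independence in the nine cases
    (∀ a b c d : K, a ^ 3 = -1 → b ^ 3 = -1 → c ^ 3 = -1 → d ^ 3 = -1 →
      ((b * c * d ≠ a ↔ ∃ ε : K, ε ^ 3 = 1 ∧ ε ≠ 1 ∧ b * c * d = ε * a) ∧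
       (a * d ≠ b * c ↔ ∃ ε : K, ε ^ 3 = 1 ∧ ε ≠ 1 ∧ a * d = ε * (b * c)) ∧
       (a * b ≠ c * d ↔ ∃ ε : K, ε ^ 3 = 1 ∧ ε ≠ 1 ∧ a * b = ε * (c * d))) ∧
      (∀ ε : K,
        (LinearIndependent K (border (matA a b c d ε)) ↔ b * c * d ≠ a) ∧
        (LinearIndependent K (border (matA a b c d ε).transpose) ↔ b * c * d ≠ a) ∧
        (LinearIndependent K (border (matB a b c d ε)) ↔ a * d ≠ b * c) ∧
        (LinearIndependent K (border (matB a b c d ε).transpose) ↔ a * d ≠ b * c) ∧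
        (LinearIndependent K (border (matC a b c d ε)) ↔ a * b ≠ c * d) ∧
        (LinearIndependent K (border (matC a b c d ε).transpose) ↔ a * b ≠ c * d)) ∧
      (LinearIndependent K (border (matD a b c d)) ↔ a ≠ c ∧ b ≠ d) ∧
      (LinearIndependent K (border (matE a b c d)) ↔ a ≠ c ∧ b ≠ d) ∧
      (LinearIndependent K (border (matF a b c d)) ↔ a ≠ c ∧ b ≠ d)) ∧
    -- all the listed matrices give matrix factorizations
    (∀ φ : Matrix (Fin 3) (Fin 3) (S K), Listed φ → IsMatrixFactorization φ φ.adjugate) := by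
  refine ⟨fun M _ _ ℳ hG hM hr h3 => ?_, fun a b c d ha hb hc hd => ⟨⟨?_, ?_, ?_⟩, fun ε =>
    ⟨linearIndependent_border_matA ε, linearIndependent_border_matA_transpose ε,
      linearIndependent_border_matB ε, linearIndependent_border_matB_transpose ε,
      linearIndependent_border_matC ε,
      linearIndependent_border_matC_transpose ε⟩,
    linearIndependent_border_matD, linearIndependent_border_matE,
    linearIndependent_border_matF⟩, fun φ h => isMatrixFactorization_adjugate h.det_eq⟩
  · obtain ⟨b, s, Φ, h1, hdet, hs, hspan, hker⟩ := exists_linear_presentation hG hM hr h3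
    obtain ⟨τ, τ', p, q, p', q', φ, hp, hq, hp', hq', hφ, h00, h01, h02, h10, h20, hli, heq⟩ :=
      exists_listed_equivalent hdet h1
    have hhom := listed_isHomogeneous hφ
    obtain ⟨b', hs', hspan', hker'⟩ := presentation_of_equivalent hG heq hs hspan hker
    rw [ofCoeffs_coeffs hhom] at hker'
    have hφ' : φ = !![0, φ 0 1, φ 0 2; φ 1 0, φ 1 1, φ 1 2; φ 2 0, φ 2 1, φ 2 2] := by
      rw [← h00]
      exact Matrix.eta_fin_three φ
    -- The second binomial of each pairing starts at `secondFst`, which is never the first variable;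
    -- this gives both indices and their lower bounds.
    refine ⟨secondFst τ', secondFst τ, φ 0 1, φ 0 2, φ 1 0, φ 2 0, φ 1 1, φ 1 2, φ 2 1, φ 2 2,
      by fin_cases τ' <;> decide, by fin_cases τ <;> decide,
      ⟨partner τ, p, by fin_cases τ <;> decide, hp, h01⟩,
      ⟨partner τ', p', by fin_cases τ' <;> decide, hp', h10⟩,
      ⟨secondSnd τ, q, by fin_cases τ <;> decide, hq, h02⟩,
      ⟨secondSnd τ', q', by fin_cases τ' <;> decide, hq', h20⟩,
      hli, hhom _ _, hhom _ _, hhom _ _, hhom _ _, ?_⟩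
    rw [← hφ']
    exact ⟨⟨isMatrixFactorization_adjugate hφ.det_eq,
      exists_equiv_of_presentation hG hs' hspan' hker'⟩, hφ⟩
  · exact ne_iff_exists_root_of_unity (by simp only [mul_pow, ha, hb, hc, hd]; norm_num)
      (ne_zero_of_cube_eq_neg_one ha)
  · exact ne_iff_exists_root_of_unity (by simp only [mul_pow, ha, hb, hc, hd])
      (mul_ne_zero (ne_zero_of_cube_eq_neg_one hb) (ne_zero_of_cube_eq_neg_one hc))
  · exact ne_iff_exists_root_of_unity (by simp only [mul_pow, ha, hb, hc, hd])
      (mul_ne_zero (ne_zero_of_cube_eq_neg_one hc) (ne_zero_of_cube_eq_neg_one hd))
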